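/- Setting. Let $(M^n,g)$ be an oriented smooth Riemannian manifold with Levi-Civita connection $\overline\nabla$, and let $\alpha_0,\dots,\alpha_N$ be smooth differential forms on $M$ (of possibly different degrees), where $\alpha=\alpha_0$ has degree $k$. For $x\in M$ let $$\mathrm G_x=\{P\in \mathrm{SO}(T_xM): P^*\alpha_j|_x=\alpha_j|_x,\ 0\le j\le N\},$$ with Lie algebra $\mathfrak g_x\subseteq\mathfrak{so}(T_xM)=\Lambda^2(T_xM)$. For a $k$-plane $W\subset T_xM$ let $\mathrm H_{W}=\{P\in \mathrm G_x:P(W)=W\}$, with Lie algebra $\mathfrak h_W\subseteq\mathfrak g_x$, and let $\mathfrak h_W^{\perp_{\mathfrak g}}$ be the orthogonal complement of $\mathfrak h_W$ in $\mathfrak g_x$. Let $W\otimes W^\perp\subset\Lambda^2(T_xM)$ be the space of skew-adjoint endomorphisms that map $W$ to $W^\perp$ and $W^\perp$ to $W$. An oriented $k$-plane $W\subset T_xM$ is calibrated if $\alpha|_W=\mathsf{vol}_W$. Assume that $\alpha$ is a parallel-compliant calibration, that is: (i) the forms define a $\mathrm G$-structure on $M$: there is a single group $\mathrm G\subseteq\mathrm{SO}(n)$,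 the stabilizer in $\mathrm{SO}(n)$ of finitely many forms on $\mathbb R^n$ (of the same degrees), to which every $\mathrm G_x$ corresponds under some oriented isometry $\mathbb R^n\cong T_xM$; (ii) for every $x\in M$, $|\alpha(e_1,\dots,e_k)|\le 1$ for all orthonormal $e_1,\dots,e_k\in T_xM$, with equality at least once; (iii) for every $x\in M$, $\mathrm G_x$ acts transitively on the calibrated planes in $T_xM$; (iv) $\alpha$ is compliant: $\mathfrak h_W^{\perp_{\mathfrak g}}=\mathfrak g_x\cap(W\otimes W^\perp)$ for every $x\in M$ and every calibrated plane $W\subset T_xM$; (v) $\overline\nabla\alpha_j=0$ for all $0\le j\le N$ (in particular $\alpha$ is closed). Let $\iota\colon L\to M$ be an immersion of an oriented $k$-dimensional smooth manifold that is $\alpha$-calibrated, that is, every oriented plane $T_xL\subset T_{\iota(x)}M$ is calibrated. On $E=\iota^*TM=TL\oplus NL$ let $\overline\nabla$ also denote the pullback connection, with $\overline\nabla_u v=\nabla_u v+A_u v$ and $\overline\nabla_u\xi=-A_u^*\xi+D_u\xi$ the decompositions into tangential and normal parts for $u,v\in\Gamma(TL)$, $\xi\in\Gamma(NL)$. Let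 $\widehat\nabla=\nabla\oplus D$, let $B_u\in\Gamma(\mathrm{End}\,E)$ be given by $B_u(v,\xi)=(-A_u^*\xi,A_uv)$, and let $(\widehat\nabla_uB)_v s=\widehat\nabla_u(B_vs)-B_{\nabla_uv}s-B_v(\widehat\nabla_us)$ for $s\in\Gamma(E)$. Write $\mathfrak g=\mathfrak g_{\iota(x)}$ and $\mathfrak h=\mathfrak h_{T_xL}$ at each $x\in L$. Statement. For all $u,v\in\Gamma(TL)$, at every point of $L$, $$[B_u,B_v]=B_uB_v-B_vB_u\in\mathfrak h\qquad\text{and}\qquad(\widehat\nabla_uB)_v-(\widehat\nabla_vB)_u\in\mathfrak h^{\perp_{\mathfrak g}}.$$ -/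

import Mathlib

open Bundle Manifold ContDiff Topology

set_option linter.unusedSectionVars false

noncomputable section

namespace Calib

/-! ### Calibrations and compliancy on an inner product space -/

section LinearAlgebra

variable {V : Type*} [NormedAddCommGroup V] [InnerProductSpace ℝ V]

/-- The Lie algebra of a (closed) group `G` of linear isometries of `V`: all endomorphisms `X` whose
one-parameter group `exp (t X)` stays in `G`. -/
def lieAlg (G : Subgroup (V ≃ₗᵢ[ℝ] V)) : Set (V →L[ℝ] V) :=
  {X | ∀ t : ℝ, ∃ P ∈ G, (P.toContinuousLinearEquiv : V →L[ℝ] V) = NormedSpace.exp (t • X)}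

/-- The group `{P ∈ SO(V) : P^* α_j = α_j for all j}`. -/
def formStab {N : ℕ} {d : Fin (N + 1) → ℕ} (α : ∀ j, V [⋀^Fin (d j)]→L[ℝ] ℝ) :
    Subgroup (V ≃ₗᵢ[ℝ] V) where
  carrier := {P | LinearMap.det (P.toLinearEquiv : V →ₗ[ℝ] V) = 1 ∧
    ∀ j, ∀ v : Fin (d j) → V, α j (fun i => P (v i)) = α j v}
  mul_mem' := by
    rintro P Q ⟨hP, hP'⟩ ⟨hQ, hQ'⟩
    refine ⟨?_, fun j v => ?_⟩
    · have h : ((P * Q).toLinearEquiv : V →ₗ[ℝ] V) =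
          (P.toLinearEquiv : V →ₗ[ℝ] V) ∘ₗ (Q.toLinearEquiv : V →ₗ[ℝ] V) := rfl
      rw [h, LinearMap.det_comp, hP, hQ, one_mul]
    · exact (hP' j (fun i => Q (v i))).trans (hQ' j v)
  one_mem' := ⟨LinearMap.det_id, fun _ _ => rfl⟩
  inv_mem' := by
    rintro P ⟨hP, hP'⟩
    refine ⟨?_, fun j v => ?_⟩
    · have h : (P.toLinearEquiv : V →ₗ[ℝ] V) ∘ₗ ((P⁻¹).toLinearEquiv : V →ₗ[ℝ] V) =
          LinearMap.id := by
        ext v; exact P.apply_symm_apply v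
      have h2 := congrArg LinearMap.det h
      rwa [LinearMap.det_comp, hP, one_mul, LinearMap.det_id] at h2
    · rw [← hP' j]
      congr 1
      ext i
      exact P.apply_symm_apply (v i)

/-- The stabilizer `{P ∈ G : P(W) = W}` of a plane `W` in `G`. -/
def planeStab (G : Subgroup (V ≃ₗᵢ[ℝ] V)) (W : Submodule ℝ V) : Subgroup (V ≃ₗᵢ[ℝ] V) where
  carrier := {P | P ∈ G ∧ W.map (P.toLinearEquiv : V →ₗ[ℝ] V) = W}
  mul_mem' := by
    rintro P Q ⟨hP, hP'⟩ ⟨hQ, hQ'⟩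
    refine ⟨G.mul_mem hP hQ, ?_⟩
    have h : ((P * Q).toLinearEquiv : V →ₗ[ℝ] V) =
        (P.toLinearEquiv : V →ₗ[ℝ] V) ∘ₗ (Q.toLinearEquiv : V →ₗ[ℝ] V) := rfl
    rw [h, Submodule.map_comp, hQ', hP']
  one_mem' := ⟨G.one_mem, Submodule.map_id W⟩
  inv_mem' := by
    rintro P ⟨hP, hP'⟩
    refine ⟨G.inv_mem hP, ?_⟩
    have h : ((P⁻¹).toLinearEquiv : V →ₗ[ℝ] V) ∘ₗ (P.toLinearEquiv : V →ₗ[ℝ] V) =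
        LinearMap.id := by
      ext v; exact P.symm_apply_apply v
    conv_lhs => rw [← hP']
    rw [← Submodule.map_comp, h, Submodule.map_id]

/-- `β` has comass one: `|β(e₁, …, e_k)| ≤ 1` on orthonormal `k`-tuples, with equality at least
once. -/
def IsCalibration {k : ℕ} (β : V [⋀^Fin k]→L[ℝ] ℝ) : Prop :=
  (∀ e : Fin k → V, Orthonormal ℝ e → |β e| ≤ 1) ∧ ∃ e : Fin k → V, Orthonormal ℝ e ∧ |β e| = 1

/-- The oriented `k`-plane `(W, o)` is calibrated: `β` restricts on `W` to the volume form. -/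
def IsCalibrated {k : ℕ} (β : V [⋀^Fin k]→L[ℝ] ℝ) (W : Submodule ℝ V)
    (o : Orientation ℝ W (Fin k)) : Prop :=
  ∃ h : Module.finrank ℝ W = k, ∀ w : Fin k → W,
    β (fun i => (w i : V)) = (haveI := Fact.mk h; o.volumeForm w)

/-- The calibrated Grassmannian. The orientation that makes a plane calibrated is determined by
the plane, so that calibrated planes may be recorded as subspaces. -/
def calGrass {k : ℕ} (β : V [⋀^Fin k]→L[ℝ] ℝ) : Set (Submodule ℝ V) :=
  {W | ∃ o : Orientation ℝ W (Fin k), IsCalibrated β W o}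

/-- `G` acts transitively on the calibrated planes. -/
def IsTransitiveOnCal {k : ℕ} (G : Subgroup (V ≃ₗᵢ[ℝ] V)) (β : V [⋀^Fin k]→L[ℝ] ℝ) : Prop :=
  ∀ W ∈ calGrass β, ∀ W' ∈ calGrass β, ∃ P ∈ G, W.map (P.toLinearEquiv : V →ₗ[ℝ] V) = W'

/-- The subspace `W ⊗ W^⊥` of `𝔰𝔬(V) = Λ²V`: the skew endomorphisms that interchange `W` and
`W^⊥`. -/
def offDiag (W : Submodule ℝ V) : Set (V →L[ℝ] V) :=
  {X | (∀ v w, inner ℝ (X v) w = -inner ℝ v (X w)) ∧ (∀ w ∈ W, X w ∈ Wᗮ) ∧ ∀ w ∈ Wᗮ, X w ∈ W}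

variable [FiniteDimensional ℝ V]

/-- The orthogonal complement of `𝔥` in `𝔤` for the inner product `tr(Xᵀ Y)`. -/
def perpIn (𝔤 𝔥 : Set (V →L[ℝ] V)) : Set (V →L[ℝ] V) :=
  {X | X ∈ 𝔤 ∧ ∀ Y ∈ 𝔥,
    LinearMap.trace ℝ V (LinearMap.adjoint (X : V →ₗ[ℝ] V) ∘ₗ (Y : V →ₗ[ℝ] V)) = 0}

variable {N : ℕ} {d : Fin (N + 1) → ℕ}

/-- The Lie algebra `𝔤` of the stabilizer `G` of the forms. -/
def lieG (α : ∀ j, V [⋀^Fin (d j)]→L[ℝ] ℝ) : Set (V →L[ℝ] V) := lieAlg (formStab α)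

/-- The Lie algebra `𝔥` of the stabilizer `H_W` of `W` in `G`. -/
def lieH (α : ∀ j, V [⋀^Fin (d j)]→L[ℝ] ℝ) (W : Submodule ℝ V) : Set (V →L[ℝ] V) :=
  lieAlg (planeStab (formStab α) W)

/-- Compliancy of the calibration `α 0`: `𝔥^{⊥_𝔤} = 𝔤 ∩ (W ⊗ W^⊥)` for calibrated `W`. -/
def IsCompliant (α : ∀ j, V [⋀^Fin (d j)]→L[ℝ] ℝ) : Prop :=
  ∀ W ∈ calGrass (α 0), perpIn (lieG α) (lieH α W) = lieG α ∩ offDiag W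

end LinearAlgebra

/-! ### The Levi-Civita connection -/

section Koszul

variable {V F : Type*} [NormedAddCommGroup V] [InnerProductSpace ℝ V] [NormedAddCommGroup F]
  [NormedSpace ℝ F] (c : V →L[ℝ] F) (K : V →L[ℝ] F →L[ℝ] F →L[ℝ] ℝ)

/-- The linear form `w ↦ (K u v w + K v u w - K w u v) / 2`, where `c : V → F` is understood. -/
def koszulForm (u v : V) : V →L[ℝ] ℝ :=
  (1 / 2 : ℝ) • (K u (c v) ∘L c + K v (c u) ∘L c -
    ContinuousLinearMap.apply ℝ ℝ (c v) ∘L ContinuousLinearMap.apply ℝ _ (c u) ∘L K)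

theorem koszulForm_apply (u v w : V) :
    koszulForm c K u v w = (K u (c v) (c w) + K v (c u) (c w) - K w (c u) (c v)) / 2 := by
  have h : koszulForm c K u v w =
      (1 / 2 : ℝ) * (K u (c v) (c w) + K v (c u) (c w) - K w (c u) (c v)) := rfl
  rw [h]
  ring

variable [FiniteDimensional ℝ V]

/-- If `K u v w` stands for `∂_u g(v, w)`, then `koszulMap c K v` is the endomorphism `u ↦ Γ(u, v)`
with `⟨Γ(u, v), w⟩ = (K u v w + K v u w - K w u v) / 2`. -/
def koszulMap (v : V) : V →L[ℝ] V :=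
  LinearMap.toContinuousLinearMap
    { toFun := fun u => (InnerProductSpace.toDual ℝ V).symm (koszulForm c K u v)
      map_add' := fun u u' => by
        rw [← map_add]
        congr 1
        ext w
        have h : K (u + u') (c v) (c w) = K u (c v) (c w) + K u' (c v) (c w) := by
          rw [K.map_add]; rfl
        have h' : K w (c u + c u') (c v) = K w (c u) (c v) + K w (c u') (c v) := by
          rw [(K w).map_add]; rfl
        have h'' : K v (c u + c u') (c w) = K v (c u) (c w) + K v (c u') (c w) := by
          rw [(K v).map_add]; rfl
        rw [add_apply, koszulForm_apply, koszulForm_apply, koszulForm_apply, h, c.map_add, h', h'']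
        ring
      map_smul' := fun a u => by
        rw [RingHom.id_apply]
        refine Eq.trans ?_ ((InnerProductSpace.toDual ℝ V).symm.map_smul a _)
        congr 1
        ext w
        have h : K (a • u) (c v) (c w) = a * K u (c v) (c w) := by
          rw [K.map_smul]; rfl
        have h' : K w (a • c u) (c v) = a * K w (c u) (c v) := by
          rw [(K w).map_smul]; rfl
        have h'' : K v (a • c u) (c w) = a * K v (c u) (c w) := by
          rw [(K v).map_smul]; rfl
        have hr : ∀ f : V →L[ℝ] ℝ, (a • f) w = a * f w := fun f => rfl
        rw [hr, koszulForm_apply, koszulForm_apply, h, c.map_smul, h', h'']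
        ring }

theorem inner_koszulMap (u v w : V) :
    inner ℝ (koszulMap c K v u) w = (K u (c v) (c w) + K v (c u) (c w) - K w (c u) (c v)) / 2 := by
  rw [← koszulForm_apply]
  exact InnerProductSpace.toDual_symm_apply

theorem koszulMap_add (v v' : V) : koszulMap c K (v + v') = koszulMap c K v + koszulMap c K v' := by
  ext u
  refine ext_inner_right ℝ fun w => ?_
  have h : K (v + v') (c u) (c w) = K v (c u) (c w) + K v' (c u) (c w) := by
    rw [K.map_add]; rfl
  have h' : K u (c v + c v') (c w) = K u (c v) (c w) + K u (c v') (c w) := by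
    rw [(K u).map_add]; rfl
  rw [add_apply, inner_add_left, inner_koszulMap, inner_koszulMap, inner_koszulMap, h, c.map_add,
    h', (K w (c u)).map_add]
  ring

theorem koszulMap_smul (a : ℝ) (v : V) : koszulMap c K (a • v) = a • koszulMap c K v := by
  ext u
  refine ext_inner_right ℝ fun w => ?_
  have h : K (a • v) (c u) (c w) = a * K v (c u) (c w) := by
    rw [K.map_smul]; rfl
  have h' : K u (a • c v) (c w) = a * K u (c v) (c w) := by
    rw [(K u).map_smul]; rfl
  rw [smul_apply, real_inner_smul_left, inner_koszulMap, inner_koszulMap, h, c.map_smul, h',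
    (K w (c u)).map_smul, smul_eq_mul]
  ring

end Koszul

section LeviCivita

variable {E : Type*} [NormedAddCommGroup E] [NormedSpace ℝ E] [FiniteDimensional ℝ E]
  {H : Type*} [TopologicalSpace H] (I : ModelWithCorners ℝ E H)
  {M : Type*} [TopologicalSpace M] [ChartedSpace H M] [IsManifold I ∞ M]
  {E' : Type*} [NormedAddCommGroup E'] [NormedSpace ℝ E']
  {H' : Type*} [TopologicalSpace H'] (J : ModelWithCorners ℝ E' H')
  {L : Type*} [TopologicalSpace L] [ChartedSpace H' L]

instance (x : M) : FiniteDimensional ℝ (TangentSpace I x) := inferInstanceAs (FiniteDimensional ℝ E)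

variable [RiemannianBundle (fun x : M => TangentSpace I x)]

/-- The metric at `y` near `x`, expressed in the chart at `x`. -/
def chartMetric (x y : M) : E →L[ℝ] E →L[ℝ] ℝ :=
  (innerSL ℝ (E := TangentSpace I y)).bilinearComp
    ((trivializationAt E (TangentSpace I) x).symmL ℝ y)
    ((trivializationAt E (TangentSpace I) x).symmL ℝ y)

/-- The Christoffel symbol `u ↦ Γ(u, v)` of the metric at `x`, in the chart at `x`, so that
`⟨Γ(u, v), w⟩ = (∂_u g(v, w) + ∂_v g(u, w) - ∂_w g(u, v)) / 2`. -/
def christoffel (x : M) (v : TangentSpace I x) : TangentSpace I x →L[ℝ] TangentSpace I x :=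
  koszulMap ((trivializationAt E (TangentSpace I) x).continuousLinearMapAt ℝ x)
    (mvfderiv I (chartMetric I x) x) v

/-- The derivative `∂_u s` at `x` of a section `s` of `f^* TM`, in the chart at `f x`. -/
def coordDeriv {f : L → M} (s : ∀ y, TangentSpace I (f y)) (x : L) :
    TangentSpace J x →L[ℝ] TangentSpace I (f x) :=
  (trivializationAt E (TangentSpace I) (f x)).symmL ℝ (f x) ∘L
    mvfderiv J (fun y => (trivializationAt E (TangentSpace I) (f x)).continuousLinearMapAt ℝ (f y)
      (s y)) x

/-- The pullback `f^*∇` to `f^* TM` of the Levi-Civita connection `∇` of `M`, along a map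
`f : L → M`: `(f^*∇)_u s = ∂_u s + Γ(df(u), s)` for a section `s` of `f^* TM`. -/
def covAlong (f : L → M) (s : ∀ y, TangentSpace I (f y)) (x : L) :
    TangentSpace J x →L[ℝ] TangentSpace I (f x) :=
  coordDeriv I J s x + christoffel I (f x) (s x) ∘L mfderiv J I f x

/-- A section `s` of `f^* TM` is smooth. -/
def IsSmoothAlong (f : L → M) (s : ∀ y, TangentSpace I (f y)) : Prop :=
  ContMDiff J I.tangent ∞ (fun y => (⟨f y, s y⟩ : TangentBundle I M))

theorem mdifferentiableAt_coord {f : L → M} {r : ∀ y, TangentSpace I (f y)} {x : L}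
    (hf : ContinuousAt f x)
    (hr : MDifferentiableAt J I.tangent (fun y => (⟨f y, r y⟩ : TangentBundle I M)) x) :
    MDifferentiableAt J 𝓘(ℝ, E) (fun y =>
      (trivializationAt E (TangentSpace I) (f x)).continuousLinearMapAt ℝ (f y) (r y)) x := by
  refine ((mdifferentiableAt_totalSpace I _).1 hr).2.congr_of_eventuallyEq ?_
  have hx : (trivializationAt E (TangentSpace I) (f x)).baseSet ∈ 𝓝 (f x) :=
    (trivializationAt E (TangentSpace I) (f x)).open_baseSet.mem_nhds
      (FiberBundle.mem_baseSet_trivializationAt' (f x))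
  filter_upwards [hf.preimage_mem_nhds hx] with y hy
  exact (trivializationAt E (TangentSpace I) (f x)).continuousLinearMapAt_apply_of_mem ℝ hy _

theorem covAlong_add {f : L → M} {s t : ∀ y, TangentSpace I (f y)} {x : L}
    (hf : ContinuousAt f x)
    (hs : MDifferentiableAt J I.tangent (fun y => (⟨f y, s y⟩ : TangentBundle I M)) x)
    (ht : MDifferentiableAt J I.tangent (fun y => (⟨f y, t y⟩ : TangentBundle I M)) x) :
    covAlong I J f (fun y => s y + t y) x = covAlong I J f s x + covAlong I J f t x := by
  unfold covAlong coordDeriv christoffel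
  have h := mvfderiv_fun_add (mdifferentiableAt_coord I J hf hs)
    (mdifferentiableAt_coord I J hf ht)
  rw [koszulMap_add]
  simp only [map_add]
  rw [h, ContinuousLinearMap.comp_add, ContinuousLinearMap.add_comp]
  abel

theorem covAlong_smul {f : L → M} {s : ∀ y, TangentSpace I (f y)} {x : L} (a : ℝ)
    (hf : ContinuousAt f x)
    (hs : MDifferentiableAt J I.tangent (fun y => (⟨f y, s y⟩ : TangentBundle I M)) x) :
    covAlong I J f (fun y => a • s y) x = a • covAlong I J f s x := by
  unfold covAlong coordDeriv christoffel
  have h := mvfderiv_fun_smul (a := fun _ : L => a) mdifferentiableAt_const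
    (mdifferentiableAt_coord I J hf hs)
  rw [koszulMap_smul]
  simp only [map_smul]
  rw [h, mvfderiv_const, smul_add, ContinuousLinearMap.smul_comp]
  congr 1
  ext u
  simp

end LeviCivita

/-! ### Immersed submanifolds -/

section Extrinsic

variable {E : Type*} [NormedAddCommGroup E] [NormedSpace ℝ E] [FiniteDimensional ℝ E]
  {H : Type*} [TopologicalSpace H] {I : ModelWithCorners ℝ E H}
  {M : Type*} [TopologicalSpace M] [ChartedSpace H M] [IsManifold I ∞ M]
  [RiemannianBundle (fun x : M => TangentSpace I x)]
  {E' : Type*} [NormedAddCommGroup E'] [NormedSpace ℝ E'] [FiniteDimensional ℝ E']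
  {H' : Type*} [TopologicalSpace H'] {J : ModelWithCorners ℝ E' H'}
  {L : Type*} [TopologicalSpace L] [ChartedSpace H' L] [IsManifold J ∞ L]
  {ι : L → M}

variable (I J) in
/-- A smooth immersion of finite-dimensional manifolds. -/
structure IsSmoothImmersion (ι : L → M) : Prop where
  smooth : ContMDiff J I ∞ ι
  injective : ∀ x, Function.Injective (mfderiv J I ι x)

variable (I J) in
/-- The tangent space of `L` at `x`, as a subspace of `T_{ι x}M`. -/
def tanPlane (ι : L → M) (x : L) : Submodule ℝ (TangentSpace I (ι x)) :=
  LinearMap.range (mfderiv J I ι x : TangentSpace J x →ₗ[ℝ] TangentSpace I (ι x))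

variable (I J) in
/-- The orthogonal projection `π_{NL}` of `E = ι^* TM` at `x`. -/
def projN (ι : L → M) (x : L) : TangentSpace I (ι x) →L[ℝ] TangentSpace I (ι x) :=
  (tanPlane I J ι x)ᗮ.starProjection

variable (J) in
/-- The vector field on `L`, near `x`, that extends `v` and has constant coefficients in the chart
at `x`. -/
def constExt (x : L) (v : TangentSpace J x) (y : L) : TangentSpace J y :=
  (trivializationAt E' (TangentSpace J) x).symmL ℝ y
    ((trivializationAt E' (TangentSpace J) x).continuousLinearMapAt ℝ x v)

theorem constExt_self (x : L) (v : TangentSpace J x) : constExt J x v x = v :=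
  (trivializationAt E' (TangentSpace J) x).symmL_continuousLinearMapAt
    (FiberBundle.mem_baseSet_trivializationAt' x) v

theorem mdifferentiableAt_constExt (x : L) (v : TangentSpace J x) :
    MDifferentiableAt J J.tangent (fun y => (⟨y, constExt J x v y⟩ : TangentBundle J L)) x := by
  refine (FiberBundle.mdifferentiableAt_extend J E' v).congr_of_eventuallyEq ?_
  have hx : (trivializationAt E' (TangentSpace J) x).baseSet ∈ 𝓝 x :=
    (trivializationAt E' (TangentSpace J) x).open_baseSet.mem_nhds
      (FiberBundle.mem_baseSet_trivializationAt' x)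
  filter_upwards [hx] with y hy
  rw [constExt, (trivializationAt E' (TangentSpace J) x).continuousLinearMapAt_apply_of_mem ℝ
    (FiberBundle.mem_baseSet_trivializationAt' x), FiberBundle.extend,
    Bundle.Trivialization.symmL_apply _ hy]

namespace IsSmoothImmersion

/-- The isomorphism `T_xL ≃ dι(T_xL)`. -/
def tanEquiv (hι : IsSmoothImmersion I J ι) (x : L) :
    TangentSpace J x ≃ₗ[ℝ] tanPlane I J ι x :=
  LinearEquiv.ofInjective (mfderiv J I ι x : TangentSpace J x →ₗ[ℝ] TangentSpace I (ι x))
    (hι.injective x)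

/-- The projection `π_{TL}`, regarded as a map to `T_xL`. -/
def tanPart (hι : IsSmoothImmersion I J ι) (x : L) : TangentSpace I (ι x) →ₗ[ℝ] TangentSpace J x :=
  (hι.tanEquiv x).symm.toLinearMap ∘ₗ (tanPlane I J ι x).orthogonalProjectionOnto

theorem mdifferentiableAt_push (hι : IsSmoothImmersion I J ι) {V : ∀ y : L, TangentSpace J y}
    {x : L} (hV : MDifferentiableAt J J.tangent (fun y => (⟨y, V y⟩ : TangentBundle J L)) x) :
    MDifferentiableAt J I.tangent
      (fun y => (⟨ι y, mfderiv J I ι y (V y)⟩ : TangentBundle I M)) x := by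
  have h : ContMDiff J.tangent I.tangent ∞ (tangentMap J I ι) := by
    exact hι.smooth.contMDiff_tangentMap (by simp)
  exact ((h _).mdifferentiableAt (by simp)).comp x hV

/-- The second fundamental form `A_u v = π_{NL} (∇̄_u v)`, computed with an extension of `v` to a
vector field of `L`. -/
def secondFF (hι : IsSmoothImmersion I J ι) (x : L) (u : TangentSpace J x) :
    TangentSpace J x →ₗ[ℝ] TangentSpace I (ι x) where
  toFun v := projN I J ι x
    (covAlong I J ι (fun y => mfderiv J I ι y (constExt J x v y)) x u)
  map_add' v w := by
    have h : (fun y => mfderiv J I ι y (constExt J x (v + w) y)) =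
        fun y => mfderiv J I ι y (constExt J x v y) +
          mfderiv J I ι y (constExt J x w y) := by
      funext y
      rw [← map_add]
      congr 1
      simp only [constExt, map_add]
    rw [h, covAlong_add I J hι.smooth.continuous.continuousAt
      (hι.mdifferentiableAt_push (mdifferentiableAt_constExt x v))
      (hι.mdifferentiableAt_push (mdifferentiableAt_constExt x w)), add_apply, map_add]
  map_smul' a v := by
    have h : (fun y => mfderiv J I ι y (constExt J x (a • v) y)) =
        fun y => a • mfderiv J I ι y (constExt J x v y) := by
      funext y
      rw [← map_smul]
      congr 1
      simp only [constExt, map_smul]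
    rw [h, covAlong_smul I J a hι.smooth.continuous.continuousAt
      (hι.mdifferentiableAt_push (mdifferentiableAt_constExt x v)), smul_apply, map_smul,
      RingHom.id_apply]

/-- The endomorphism `B_u (v, ξ) = (-A_u^* ξ, A_u v)` of `T_{ι x}M = T_xL ⊕ N_xL`: it is `S - S^*`,
where `S` is `A_u` on `T_xL` and `0` on `N_xL`, so that `S^*` is `0` on `T_xL` and `A_u^*` on
`N_xL`. -/
def sffEnd (hι : IsSmoothImmersion I J ι) (x : L) (u : TangentSpace J x) :
    TangentSpace I (ι x) →L[ℝ] TangentSpace I (ι x) :=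
  let S : TangentSpace I (ι x) →ₗ[ℝ] TangentSpace I (ι x) := hι.secondFF x u ∘ₗ hι.tanPart x
  LinearMap.toContinuousLinearMap (S - LinearMap.adjoint S)

/-- The induced connection `∇_u v = π_{TL} (∇̄_u v)` on `TL`. -/
def tanCov (hι : IsSmoothImmersion I J ι) (v : ∀ y : L, TangentSpace J y) (x : L)
    (u : TangentSpace J x) : TangentSpace J x :=
  hι.tanPart x (covAlong I J ι (fun y => mfderiv J I ι y (v y)) x u)

variable (I J) in
/-- The induced connection `D_u ξ = π_{NL} (∇̄_u ξ)` on `NL`. -/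
def norCov (ι : L → M) (ξ : ∀ y : L, TangentSpace I (ι y)) (x : L) (u : TangentSpace J x) :
    TangentSpace I (ι x) :=
  projN I J ι x (covAlong I J ι ξ x u)

/-- The direct sum connection `∇̂ = ∇ ⊕ D` on `E = TL ⊕ NL`. -/
def hatCov (hι : IsSmoothImmersion I J ι) (s : ∀ y : L, TangentSpace I (ι y)) (x : L)
    (u : TangentSpace J x) : TangentSpace I (ι x) :=
  mfderiv J I ι x (hι.tanCov (fun y => hι.tanPart y (s y)) x u) +
    norCov I J ι (fun y => projN I J ι y (s y)) x u

/-- `(∇̂_u B)_v s = ∇̂_u (B_v s) - B_{∇_u v} s - B_v (∇̂_u s)` at the point `x`, for vector fields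
`u`, `v` on `L` and a section `s` of `E`. -/
def covDerivB (hι : IsSmoothImmersion I J ι) (u v : ∀ y : L, TangentSpace J y)
    (s : ∀ y : L, TangentSpace I (ι y)) (x : L) : TangentSpace I (ι x) :=
  hι.hatCov (fun y => hι.sffEnd y (v y) (s y)) x (u x) -
    hι.sffEnd x (hι.tanCov v x (u x)) (s x) - hι.sffEnd x (v x) (hι.hatCov s x (u x))

end IsSmoothImmersion

end Extrinsic

/-! ### Oriented manifolds and differential forms -/

section Forms

variable {E : Type*} [NormedAddCommGroup E] [NormedSpace ℝ E] [FiniteDimensional ℝ E]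
  {H : Type*} [TopologicalSpace H] (I : ModelWithCorners ℝ E H)
  {M : Type*} [TopologicalSpace M] [ChartedSpace H M] [IsManifold I ∞ M]

/-- A family of orientations of the tangent spaces is an orientation of the manifold if it is
locally constant in charts. -/
def IsManifoldOrientation {n : ℕ} (o : ∀ x : M, Orientation ℝ (TangentSpace I x) (Fin n)) : Prop :=
  ∀ x : M, ∃ o₀ : Orientation ℝ E (Fin n), ∀ᶠ y in 𝓝 x,
    ∃ hy : y ∈ (trivializationAt E (TangentSpace I) x).baseSet,
      Orientation.map (Fin n) ((trivializationAt E (TangentSpace I) x).continuousLinearEquivAt ℝ y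
        hy).toLinearEquiv (o y) = o₀

/-- A differential form on `M` is smooth: its coefficients in the charts are smooth. -/
def IsSmoothForm {m : ℕ} (β : ∀ x : M, TangentSpace I x [⋀^Fin m]→L[ℝ] ℝ) : Prop :=
  ∀ (x : M) (v : Fin m → E), ContMDiffOn I 𝓘(ℝ) ∞
    (fun y => β y (fun i => (trivializationAt E (TangentSpace I) x).symmL ℝ y (v i)))
    (trivializationAt E (TangentSpace I) x).baseSet

variable [RiemannianBundle (fun x : M => TangentSpace I x)]

/-- `∇̄ β = 0` for the Levi-Civita connection:
`u (β(X₁, …, X_m)) = ∑ᵢ β(X₁, …, ∇̄_u Xᵢ, …, X_m)`. -/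
def IsParallelForm {m : ℕ} (β : ∀ x : M, TangentSpace I x [⋀^Fin m]→L[ℝ] ℝ) : Prop :=
  ∀ (x : M) (X : Fin m → ∀ y : M, TangentSpace I y),
    (∀ i, MDifferentiableAt I I.tangent (fun y => (⟨y, X i y⟩ : TangentBundle I M)) x) →
    ∀ u : TangentSpace I x, mvfderiv I (fun y => β y (fun i => X i y)) x u =
      ∑ i, β x (Function.update (fun j => X j x) i (covAlong I I (fun y => y) (X i) x u))

/-- The manifold `M`, with orientation `o`, carries the `G`-structure defined by the forms `α_j`:
there is one group `G ⊆ SO(n)`, the stabilizer of some forms `a_j` on `ℝⁿ`, to which every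
stabilizer `G_x` of the forms `α_j` at `x` corresponds under an oriented isometry `ℝⁿ ≃ T_xM`. -/
def IsGStructure {n N : ℕ} {d : Fin (N + 1) → ℕ}
    (o : ∀ x : M, Orientation ℝ (TangentSpace I x) (Fin n))
    (α : ∀ j, ∀ x : M, TangentSpace I x [⋀^Fin (d j)]→L[ℝ] ℝ) : Prop :=
  ∃ a : ∀ j, EuclideanSpace ℝ (Fin n) [⋀^Fin (d j)]→L[ℝ] ℝ,
    ∀ x : M, ∃ φ : EuclideanSpace ℝ (Fin n) ≃ₗᵢ[ℝ] TangentSpace I x,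
      Orientation.map (Fin n) φ.toLinearEquiv
        (EuclideanSpace.basisFun (Fin n) ℝ).toBasis.orientation = o x ∧
      ∀ P : EuclideanSpace ℝ (Fin n) ≃ₗᵢ[ℝ] EuclideanSpace ℝ (Fin n),
        P ∈ formStab a ↔ (φ.symm.trans P).trans φ ∈ formStab (fun j => α j x)

/-- `α 0` is a parallel-compliant calibration on the oriented Riemannian manifold `M`, with respect
to the `G`-structure defined by the forms `α 0, …, α N`. (A parallel form is closed.) -/
structure IsParallelCompliant {n N : ℕ} {d : Fin (N + 1) → ℕ}
    (o : ∀ x : M, Orientation ℝ (TangentSpace I x) (Fin n))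
    (α : ∀ j, ∀ x : M, TangentSpace I x [⋀^Fin (d j)]→L[ℝ] ℝ) : Prop where
  smooth : ∀ j, IsSmoothForm I (α j)
  gStructure : IsGStructure I o α
  calibration : ∀ x, IsCalibration (α 0 x)
  transitive : ∀ x, IsTransitiveOnCal (formStab (fun j => α j x)) (α 0 x)
  compliant : ∀ x, IsCompliant (fun j => α j x)
  parallel : ∀ j, IsParallelForm I (α j)

variable {I} {E' : Type*} [NormedAddCommGroup E'] [NormedSpace ℝ E'] [FiniteDimensional ℝ E']
  {H' : Type*} [TopologicalSpace H'] {J : ModelWithCorners ℝ E' H'}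
  {L : Type*} [TopologicalSpace L] [ChartedSpace H' L] [IsManifold J ∞ L]
  {ι : L → M}

/-- The immersed submanifold `L`, with orientation `o`, is calibrated by `β`. -/
def IsSmoothImmersion.IsCalibratedBy (hι : IsSmoothImmersion I J ι) {k : ℕ}
    (o : ∀ x : L, Orientation ℝ (TangentSpace J x) (Fin k))
    (β : ∀ x : M, TangentSpace I x [⋀^Fin k]→L[ℝ] ℝ) : Prop :=
  ∀ x : L, IsCalibrated (β (ι x)) (tanPlane I J ι x) (Orientation.map (Fin k) (hι.tanEquiv x) (o x))

end Forms

end Calib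
end

noncomputable section

namespace Calib

section LinearAlgebra

variable {V : Type*} [NormedAddCommGroup V] [InnerProductSpace ℝ V]
variable {N : ℕ} {d : Fin (N + 1) → ℕ}

/-- The derivative of an alternating form along a curve of tuples. -/
theorem hasDerivAt_alternating {m : ℕ} (β : V [⋀^Fin m]→L[ℝ] ℝ) {c : ℝ → Fin m → V}
    {c' : Fin m → V} {t : ℝ} (h : ∀ i, HasDerivAt (fun s => c s i) (c' i) t) :
    HasDerivAt (fun s => β (c s)) (∑ i, β (Function.update (c t) i (c' i))) t := by
  have h1 := (β.toContinuousMultilinearMap.hasFDerivAt (c t)).comp_hasDerivAt t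
    (hasDerivAt_pi.2 h)
  rw [ContinuousMultilinearMap.linearDeriv_apply] at h1
  exact h1

/-- The Lie algebra of skew endomorphisms that annihilate the forms `α j`. -/
def annihilator (α : ∀ j, V [⋀^Fin (d j)]→L[ℝ] ℝ) : Submodule ℝ (V →L[ℝ] V) where
  carrier := {X | (∀ v w, inner ℝ (X v) w = -inner ℝ v (X w)) ∧
    ∀ j, ∀ v : Fin (d j) → V, ∑ i, α j (Function.update v i (X (v i))) = 0}
  add_mem' := by
    rintro X Y ⟨hX, hX'⟩ ⟨hY, hY'⟩
    refine ⟨fun v w => ?_, fun j v => ?_⟩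
    · rw [add_apply, add_apply, inner_add_left, inner_add_right, hX, hY]
      ring
    · simp only [add_apply, ContinuousAlternatingMap.map_update_add,
        Finset.sum_add_distrib, hX', hY', add_zero]
  zero_mem' := by
    refine ⟨fun v w => by simp, fun j v => Finset.sum_eq_zero fun i _ => ?_⟩
    exact (α j).map_coord_zero i (by simp)
  smul_mem' := by
    rintro a X ⟨hX, hX'⟩
    refine ⟨fun v w => ?_, fun j v => ?_⟩
    · rw [smul_apply, smul_apply, real_inner_smul_left, real_inner_smul_right, hX]
      ring
    · simp only [smul_apply, ContinuousAlternatingMap.map_update_smul, ← Finset.smul_sum, hX',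
        smul_zero]

theorem hasDerivAt_exp_apply [CompleteSpace V] (X : V →L[ℝ] V) (v : V) (t : ℝ) :
    HasDerivAt (fun s : ℝ => NormedSpace.exp (s • X) v) (X (NormedSpace.exp (t • X) v)) t :=
  (hasDerivAt_exp_smul_const' X t).clm_apply (hasDerivAt_const t v) |>.congr_deriv (by simp)

variable [FiniteDimensional ℝ V]

/-- The set of endomorphisms underlying the stabilizer of the forms `α j`. -/
def stabSet (α : ∀ j, V [⋀^Fin (d j)]→L[ℝ] ℝ) : Set (V →L[ℝ] V) :=
  {A | (∀ v w, inner ℝ (A v) (A w) = inner ℝ v w) ∧ LinearMap.det (A : V →ₗ[ℝ] V) = 1 ∧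
    ∀ j, ∀ v : Fin (d j) → V, α j (fun i => A (v i)) = α j v}

theorem coe_mem_stabSet {α : ∀ j, V [⋀^Fin (d j)]→L[ℝ] ℝ} {P : V ≃ₗᵢ[ℝ] V}
    (hP : P ∈ formStab α) : (P.toContinuousLinearEquiv : V →L[ℝ] V) ∈ stabSet α :=
  ⟨fun v w => P.inner_map_map v w, hP.1, hP.2⟩

theorem exists_of_mem_stabSet {α : ∀ j, V [⋀^Fin (d j)]→L[ℝ] ℝ} {A : V →L[ℝ] V}
    (hA : A ∈ stabSet α) :
    ∃ P ∈ formStab α, (P.toContinuousLinearEquiv : V →L[ℝ] V) = A := by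
  let f : V →ₗᵢ[ℝ] V := (A : V →ₗ[ℝ] V).isometryOfInner hA.1
  let P : V ≃ₗᵢ[ℝ] V := f.toLinearIsometryEquiv rfl
  have hP : ∀ v, P v = A v := fun v => rfl
  have hP' : (P.toLinearEquiv : V →ₗ[ℝ] V) = (A : V →ₗ[ℝ] V) := by ext v; rfl
  refine ⟨P, ⟨?_, fun j v => ?_⟩, ?_⟩
  · rw [hP']; exact hA.2.1
  · simp only [hP]; exact hA.2.2 j v
  · ext v; rfl

theorem isClosed_stabSet (α : ∀ j, V [⋀^Fin (d j)]→L[ℝ] ℝ) : IsClosed (stabSet α) := by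
  have e : ∀ v : V, Continuous fun A : V →L[ℝ] V => A v := fun v =>
    (ContinuousLinearMap.apply ℝ V v).continuous
  have h : stabSet α = (⋂ v : V, ⋂ w : V, {A : V →L[ℝ] V | inner ℝ (A v) (A w) = inner ℝ v w}) ∩
      ({A : V →L[ℝ] V | LinearMap.det (A : V →ₗ[ℝ] V) = 1} ∩
        ⋂ j, ⋂ v : Fin (d j) → V, {A : V →L[ℝ] V | α j (fun i => A (v i)) = α j v}) := by
    ext A
    simp [stabSet]
  rw [h]
  refine IsClosed.inter ?_ (IsClosed.inter ?_ ?_)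
  · exact isClosed_iInter fun v => isClosed_iInter fun w =>
      isClosed_eq ((e v).inner (e w)) continuous_const
  · exact isClosed_eq ContinuousLinearMap.continuous_det continuous_const
  · exact isClosed_iInter fun j => isClosed_iInter fun v =>
      isClosed_eq ((α j).cont.comp (continuous_pi fun i => e (v i))) continuous_const

theorem norm_apply_of_mem_stabSet {α : ∀ j, V [⋀^Fin (d j)]→L[ℝ] ℝ} {A : V →L[ℝ] V}
    (hA : A ∈ stabSet α) (v : V) : ‖A v‖ = ‖v‖ := by
  rw [norm_eq_sqrt_real_inner, hA.1, ← norm_eq_sqrt_real_inner]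

theorem isCompact_stabSet (α : ∀ j, V [⋀^Fin (d j)]→L[ℝ] ℝ) : IsCompact (stabSet α) := by
  refine (isCompact_closedBall (0 : V →L[ℝ] V) 1).of_isClosed_subset (isClosed_stabSet α) ?_
  intro A hA
  rw [mem_closedBall_zero_iff]
  exact A.opNorm_le_bound zero_le_one fun v => by rw [norm_apply_of_mem_stabSet hA, one_mul]

theorem mul_mem_stabSet {α : ∀ j, V [⋀^Fin (d j)]→L[ℝ] ℝ} {A B : V →L[ℝ] V}
    (hA : A ∈ stabSet α) (hB : B ∈ stabSet α) : A * B ∈ stabSet α := by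
  obtain ⟨P, hP, rfl⟩ := exists_of_mem_stabSet hA
  obtain ⟨Q, hQ, rfl⟩ := exists_of_mem_stabSet hB
  exact coe_mem_stabSet ((formStab α).mul_mem hP hQ)

theorem exists_inv_of_mem_stabSet {α : ∀ j, V [⋀^Fin (d j)]→L[ℝ] ℝ} {A : V →L[ℝ] V}
    (hA : A ∈ stabSet α) : ∃ B ∈ stabSet α, A * B = 1 ∧ B * A = 1 := by
  obtain ⟨P, hP, rfl⟩ := exists_of_mem_stabSet hA
  refine ⟨_, coe_mem_stabSet ((formStab α).inv_mem hP), ?_, ?_⟩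
  · ext v; exact P.apply_symm_apply v
  · ext v; exact P.symm_apply_apply v

theorem exp_mem_stabSet {α : ∀ j, V [⋀^Fin (d j)]→L[ℝ] ℝ} {X : V →L[ℝ] V}
    (hX : X ∈ annihilator α) (t : ℝ) : NormedSpace.exp (t • X) ∈ stabSet α := by
  have h0 : ∀ v, NormedSpace.exp ((0 : ℝ) • X) v = v := fun v => by
    rw [zero_smul, NormedSpace.exp_zero]; rfl
  have h1 : ∀ (t : ℝ) (v w : V),
      inner ℝ (NormedSpace.exp (t • X) v) (NormedSpace.exp (t • X) w) = inner ℝ v w := by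
    intro t v w
    have hd : ∀ s : ℝ, HasDerivAt (fun s : ℝ => inner ℝ (NormedSpace.exp (s • X) v)
        (NormedSpace.exp (s • X) w)) (0 : ℝ) s := fun s =>
      ((hasDerivAt_exp_apply X v s).inner ℝ (hasDerivAt_exp_apply X w s)).congr_deriv
        (by rw [hX.1]; ring)
    have := is_const_of_deriv_eq_zero (fun s => (hd s).differentiableAt)
      (fun s => (hd s).deriv) t 0
    rw [this, h0, h0]
  have hsq : ∀ t : ℝ, (LinearMap.det ((NormedSpace.exp (t • X) : V →L[ℝ] V) : V →ₗ[ℝ] V)) ^ 2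
      = 1 := by
    intro t
    have h2 : |LinearMap.det ((NormedSpace.exp (t • X) : V →L[ℝ] V) : V →ₗ[ℝ] V)| = 1 := by
      rw [← Real.norm_eq_abs, ← LinearMap.normDet_eq_norm_det]
      exact (((NormedSpace.exp (t • X) : V →L[ℝ] V) : V →ₗ[ℝ] V).isometryOfInner
        (h1 t)).normDet_eq_one
    rw [← sq_abs, h2, one_pow]
  refine ⟨h1 t, ?_, fun j v => ?_⟩
  · rw [← hsq (t / 2), pow_two, ← LinearMap.det_comp]
    congr 1
    have h3 : t • X = (t / 2) • X + (t / 2) • X := by rw [← add_smul, add_halves]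
    let +nondep : NormedAlgebra ℚ (V →L[ℝ] V) := NormedAlgebra.restrictScalars ℚ ℝ _
    rw [h3, NormedSpace.exp_add_of_commute (Commute.refl _)]
    rfl
  · have hd : ∀ s : ℝ, HasDerivAt (fun s : ℝ => α j (fun i => NormedSpace.exp (s • X) (v i)))
        (0 : ℝ) s := fun s =>
      (hasDerivAt_alternating (α j) (fun i => hasDerivAt_exp_apply X (v i) s)).congr_deriv
        (hX.2 j _)
    have := is_const_of_deriv_eq_zero (fun s => (hd s).differentiableAt)
      (fun s => (hd s).deriv) t 0
    rw [this]
    simp only [h0]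

theorem mem_lieG_iff {α : ∀ j, V [⋀^Fin (d j)]→L[ℝ] ℝ} {X : V →L[ℝ] V} :
    X ∈ lieG α ↔ X ∈ annihilator α := by
  refine ⟨fun h => ?_, fun h t => exists_of_mem_stabSet (exp_mem_stabSet h t)⟩
  have hs : ∀ t : ℝ, NormedSpace.exp (t • X) ∈ stabSet α := fun t => by
    obtain ⟨P, hP, hP'⟩ := h t
    exact hP' ▸ coe_mem_stabSet hP
  have h0 : ∀ v, NormedSpace.exp ((0 : ℝ) • X) v = v := fun v => by
    rw [zero_smul, NormedSpace.exp_zero]; rfl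
  refine ⟨fun v w => ?_, fun j v => ?_⟩
  · have h1 := (hasDerivAt_exp_apply X v 0).inner ℝ (hasDerivAt_exp_apply X w 0)
    simp only [(hs _).1, h0] at h1
    have := h1.unique (hasDerivAt_const (0 : ℝ) _)
    linarith
  · have h1 := hasDerivAt_alternating (α j) (fun i => hasDerivAt_exp_apply X (v i) 0)
    simp only [(hs _).2.2, h0] at h1
    exact h1.unique (hasDerivAt_const (0 : ℝ) _)

theorem exp_apply_mem {X : V →L[ℝ] V} {W : Submodule ℝ V} (hX : ∀ w ∈ W, X w ∈ W) {w : V}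
    (hw : w ∈ W) : NormedSpace.exp X w ∈ W := by
  have h1 := (NormedSpace.exp_series_hasSum_exp' (𝕂 := ℝ) X).mapL
    (ContinuousLinearMap.apply ℝ V w)
  have hp : ∀ n : ℕ, (X ^ n) w ∈ W := by
    intro n
    induction n with
    | zero => exact hw
    | succ n ih => rw [pow_succ']; exact hX _ ih
  refine W.closed_of_finiteDimensional.mem_of_tendsto h1 (Filter.Eventually.of_forall fun s => ?_)
  exact W.sum_mem fun n _ => W.smul_mem _ (hp n)

theorem mem_lieH_iff {α : ∀ j, V [⋀^Fin (d j)]→L[ℝ] ℝ} {W : Submodule ℝ V} {X : V →L[ℝ] V} :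
    X ∈ lieH α W ↔ X ∈ annihilator α ∧ ∀ w ∈ W, X w ∈ W := by
  refine ⟨fun h => ⟨mem_lieG_iff.1 fun t => ?_, fun w hw => ?_⟩, fun h t => ?_⟩
  · obtain ⟨P, hP, hP'⟩ := h t
    exact ⟨P, hP.1, hP'⟩
  · have h1 := hasDerivAt_exp_apply X w 0
    rw [zero_smul, NormedSpace.exp_zero] at h1
    have h2 := hasDerivAt_iff_tendsto_slope.1 h1
    refine W.closed_of_finiteDimensional.mem_of_tendsto h2 (Filter.Eventually.of_forall fun t => ?_)
    have h3 : ∀ t : ℝ, NormedSpace.exp (t • X) w ∈ W := fun t => by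
      obtain ⟨P, hP, hP'⟩ := h t
      rw [← hP']
      exact hP.2 ▸ Submodule.mem_map_of_mem hw
    exact W.smul_mem _ (W.sub_mem (h3 t) (h3 0))
  · obtain ⟨P, hP, hP'⟩ := exists_of_mem_stabSet (exp_mem_stabSet h.1 t)
    refine ⟨P, ⟨hP, ?_⟩, hP'⟩
    refine Submodule.eq_of_le_of_finrank_eq ?_ ?_
    · rintro _ ⟨w, hw, rfl⟩
      have : P w = NormedSpace.exp (t • X) w := by rw [← hP']; rfl
      change P w ∈ W
      rw [this]
      exact exp_apply_mem (fun w hw => W.smul_mem _ (h.2 w hw)) hw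
    · exact LinearEquiv.finrank_map_eq P.toLinearEquiv W

end LinearAlgebra

section Derivations

variable {V : Type*} [NormedAddCommGroup V] [InnerProductSpace ℝ V]

/-- The sum over `i ≠ j` of the values of `β` at `v` with `v i`, `v j` replaced by `a i`, `b j`. -/
def mixedSum {m : ℕ} (β : V [⋀^Fin m]→L[ℝ] ℝ) (v a b : Fin m → V) : ℝ :=
  ∑ i, ∑ j, if j = i then 0 else β (Function.update (Function.update v i (a i)) j (b j))

theorem mixedSum_comm {m : ℕ} (β : V [⋀^Fin m]→L[ℝ] ℝ) (v a b : Fin m → V) :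
    mixedSum β v a b = mixedSum β v b a := by
  unfold mixedSum
  rw [Finset.sum_comm]
  refine Finset.sum_congr rfl fun j _ => Finset.sum_congr rfl fun i _ => ?_
  by_cases h : j = i
  · rw [if_pos h, if_pos h.symm]
  · rw [if_neg h, if_neg (Ne.symm h), Function.update_comm h]

theorem sum_update_update {m : ℕ} (β : V [⋀^Fin m]→L[ℝ] ℝ) (v a b c : Fin m → V) :
    ∑ i, ∑ j, β (Function.update (Function.update v i (a i)) j (if j = i then c i else b j)) =
      ∑ i, β (Function.update v i (c i)) + mixedSum β v a b := by
  unfold mixedSum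
  rw [← Finset.sum_add_distrib]
  refine Finset.sum_congr rfl fun i _ => ?_
  have h : ∀ j, β (Function.update (Function.update v i (a i)) j (if j = i then c i else b j)) =
      (if j = i then β (Function.update v i (c i)) else 0) +
        if j = i then 0 else β (Function.update (Function.update v i (a i)) j (b j)) := by
    intro j
    by_cases hj : j = i
    · subst hj
      simp
    · simp [hj]
  simp only [h, Finset.sum_add_distrib]
  simp

theorem sum_update_of_annihilates {m : ℕ} {β : V [⋀^Fin m]→L[ℝ] ℝ} {X : V →L[ℝ] V}
    (hX : ∀ v : Fin m → V, ∑ i, β (Function.update v i (X (v i))) = 0) (v a : Fin m → V) :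
    ∑ i, β (Function.update v i (X (a i))) = -mixedSum β v a (fun j => X (v j)) := by
  have h := sum_update_update β v a (fun j => X (v j)) (fun j => X (a j))
  have h0 : ∀ i, ∑ j, β (Function.update (Function.update v i (a i)) j
      (if j = i then X (a i) else X (v j))) = 0 := by
    intro i
    rw [← hX (Function.update v i (a i))]
    refine Finset.sum_congr rfl fun j _ => ?_
    by_cases hj : j = i
    · subst hj; simp
    · simp [hj]
  simp only [h0, Finset.sum_const_zero] at h
  linarith

variable {N : ℕ} {d : Fin (N + 1) → ℕ} {α : ∀ j, V [⋀^Fin (d j)]→L[ℝ] ℝ}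

theorem commutator_mem_annihilator {X Y : V →L[ℝ] V} (hX : X ∈ annihilator α)
    (hY : Y ∈ annihilator α) : X ∘L Y - Y ∘L X ∈ annihilator α := by
  refine ⟨fun v w => ?_, fun j v => ?_⟩
  · simp only [sub_apply, ContinuousLinearMap.comp_apply, inner_sub_left, inner_sub_right, hX.1,
      hY.1]
    ring
  · simp only [sub_apply, ContinuousLinearMap.comp_apply, ContinuousAlternatingMap.map_update_sub,
      Finset.sum_sub_distrib]
    rw [sum_update_of_annihilates (hX.2 j), sum_update_of_annihilates (hY.2 j), mixedSum_comm]
    ring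

variable [FiniteDimensional ℝ V]

theorem commutator_mem_lieH {X Y : V →L[ℝ] V} {W : Submodule ℝ V} (hX : X ∈ annihilator α)
    (hY : Y ∈ annihilator α) (hXW : X ∈ offDiag W) (hYW : Y ∈ offDiag W) :
    X ∘L Y - Y ∘L X ∈ lieH α W :=
  mem_lieH_iff.2 ⟨commutator_mem_annihilator hX hY, fun w hw =>
    W.sub_mem (hXW.2.2 _ (hYW.2.1 w hw)) (hYW.2.2 _ (hXW.2.1 w hw))⟩

variable (V) in
/-- The inner product `tr(Xᵀ Y)` on endomorphisms. -/
def traceForm : LinearMap.BilinForm ℝ (V →L[ℝ] V) :=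
  LinearMap.mk₂ ℝ (fun X Y =>
    LinearMap.trace ℝ V (LinearMap.adjoint (X : V →ₗ[ℝ] V) ∘ₗ (Y : V →ₗ[ℝ] V)))
    (fun X X' Y => by
      rw [ContinuousLinearMap.toLinearMap_add, map_add, LinearMap.add_comp, map_add])
    (fun a X Y => by
      rw [ContinuousLinearMap.toLinearMap_smul, map_smulₛₗ, LinearMap.smul_comp, map_smul]; rfl)
    (fun X Y Y' => by
      rw [ContinuousLinearMap.toLinearMap_add, LinearMap.comp_add, map_add])
    (fun a X Y => by
      rw [ContinuousLinearMap.toLinearMap_smul, LinearMap.comp_smul, map_smul])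

theorem traceForm_apply (X Y : V →L[ℝ] V) : traceForm V X Y =
    ∑ i, inner ℝ (X (stdOrthonormalBasis ℝ V i)) (Y (stdOrthonormalBasis ℝ V i)) := by
  change LinearMap.trace ℝ V (LinearMap.adjoint (X : V →ₗ[ℝ] V) ∘ₗ (Y : V →ₗ[ℝ] V)) = _
  rw [LinearMap.trace_eq_sum_inner _ (stdOrthonormalBasis ℝ V)]
  refine Finset.sum_congr rfl fun i _ => ?_
  rw [LinearMap.comp_apply, LinearMap.adjoint_inner_right]
  rfl

theorem traceForm_isRefl : (traceForm V).IsRefl := fun X Y h => by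
  rw [traceForm_apply] at h ⊢
  simpa only [real_inner_comm] using h

theorem eq_zero_of_traceForm_self {X : V →L[ℝ] V} (h : traceForm V X X = 0) : X = 0 := by
  rw [traceForm_apply, Finset.sum_eq_zero_iff_of_nonneg fun i _ => real_inner_self_nonneg] at h
  ext v
  rw [← (stdOrthonormalBasis ℝ V).sum_repr v]
  simp only [map_sum, map_smul, inner_self_eq_zero.1 (h _ (Finset.mem_univ _)), smul_zero,
    Finset.sum_const_zero, zero_apply]

/-- The orthogonal decomposition `𝔤 = 𝔥 ⊕ 𝔥^⊥`. -/
theorem exists_sub_mem_lieH {X : V →L[ℝ] V} (W : Submodule ℝ V) (hX : X ∈ annihilator α) :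
    ∃ Y ∈ perpIn (lieG α) (lieH α W), ∀ w ∈ W, X w - Y w ∈ W := by
  let 𝔥 : Submodule ℝ (V →L[ℝ] V) := annihilator α ⊓
    { carrier := {X | ∀ w ∈ W, X w ∈ W}
      add_mem' := fun hX hY w hw => W.add_mem (hX w hw) (hY w hw)
      zero_mem' := fun w _ => W.zero_mem
      smul_mem' := fun a X hX w hw => W.smul_mem a (hX w hw) }
  have hc : IsCompl 𝔥 (LinearMap.BilinForm.orthogonal (traceForm V) 𝔥) := by
    rw [LinearMap.BilinForm.isCompl_orthogonal_iff_disjoint traceForm_isRefl, Submodule.disjoint_def]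
    exact fun Z hZ hZ' => eq_zero_of_traceForm_self (hZ' Z hZ)
  obtain ⟨Z, hZ, Y, hY, hZY⟩ := Submodule.mem_sup.1 (hc.sup_eq_top ▸ Submodule.mem_top (x := X))
  have hYX : Y = X - Z := by rw [← hZY]; abel
  refine ⟨Y, ⟨mem_lieG_iff.2 (hYX ▸ Submodule.sub_mem _ hX hZ.1), fun T hT => ?_⟩, fun w hw => ?_⟩
  · exact traceForm_isRefl _ _ (hY T (mem_lieH_iff.1 hT))
  · rw [hYX, sub_apply, sub_sub_cancel]
    exact hZ.2 w hw

end Derivations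

section Orbits

variable {V : Type*} [NormedAddCommGroup V] [InnerProductSpace ℝ V] [FiniteDimensional ℝ V]
variable {N : ℕ} {d : Fin (N + 1) → ℕ} {α : ∀ j, V [⋀^Fin (d j)]→L[ℝ] ℝ}

theorem mem_annihilator_of_tendsto {A : ℕ → V →L[ℝ] V} {r : ℕ → ℝ} {Y : V →L[ℝ] V}
    (hA : ∀ n, A n ∈ stabSet α) (hr : Filter.Tendsto r Filter.atTop (𝓝 0)) (hr0 : ∀ n, 0 < r n)
    (hY : Filter.Tendsto (fun n => (r n)⁻¹ • (A n - 1)) Filter.atTop (𝓝 Y)) :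
    Y ∈ annihilator α := by
  have key : ∀ (m : ℕ) (F : (Fin m → V) → ℝ) (v : Fin m → V) (F' : (Fin m → V) →L[ℝ] ℝ),
      HasFDerivAt F F' v → (∀ n, F (fun i => A n (v i)) = F v) → F' (fun i => Y (v i)) = 0 := by
    intro m F v F' hF hconst
    have hd : Filter.Tendsto (fun n => (r n)⁻¹ • fun i => (A n - 1) (v i)) Filter.atTop
        (𝓝 (fun i => Y (v i))) := by
      rw [tendsto_pi_nhds]
      intro i
      exact ((ContinuousLinearMap.apply ℝ V (v i)).continuous.tendsto Y).comp hY
    have hd0 : Filter.Tendsto (fun n => fun i => (A n - 1) (v i)) Filter.atTop (𝓝 0) := by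
      have := hr.smul hd
      rw [zero_smul] at this
      refine this.congr fun n => ?_
      rw [smul_smul, mul_inv_cancel₀ (hr0 n).ne', one_smul]
    have hinf : Filter.Tendsto (fun n => ‖(r n)⁻¹‖) Filter.atTop Filter.atTop := by
      refine (Filter.Tendsto.congr (fun n => ?_) (Filter.Tendsto.inv_tendsto_nhdsGT_zero
        (tendsto_nhdsWithin_iff.2 ⟨hr, Filter.Eventually.of_forall hr0⟩)))
      rw [Pi.inv_apply, Real.norm_of_nonneg (inv_nonneg.2 (hr0 n).le)]
    have h := hF.hasFDerivWithinAt (s := Set.univ) |>.lim (f := F) (l := Filter.atTop)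
      (c := fun n => (r n)⁻¹) (d := fun n => fun i => (A n - 1) (v i)) hd0
      (Filter.Eventually.of_forall fun _ => Set.mem_univ _) hd
    refine tendsto_nhds_unique h (tendsto_const_nhds.congr fun n => ?_)
    have h2 : (v + fun i => (A n - 1) (v i)) = fun i => A n (v i) := by
      funext i
      simp
    rw [h2, hconst, sub_self, smul_zero]
  refine ⟨fun v w => ?_, fun j v => ?_⟩
  · have hF : HasFDerivAt (fun p : Fin 2 → V => (inner ℝ (p 0) (p 1) : ℝ)) _ ![v, w] :=
      (hasFDerivAt_apply (𝕜 := ℝ) 0 ![v, w]).inner ℝ (hasFDerivAt_apply (𝕜 := ℝ) 1 ![v, w])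
    have := key 2 _ _ _ hF fun n => (hA n).1 _ _
    simp [fderivInnerCLM_apply] at this
    linarith
  · have := key _ _ _ _ ((α j).toContinuousMultilinearMap.hasFDerivAt v) fun n => (hA n).2.2 j v
    rw [ContinuousMultilinearMap.linearDeriv_apply] at this
    exact this

theorem exp_smul_isLittleO (Y : V →L[ℝ] V) {r : ℕ → ℝ} (hr0 : ∀ n, 0 < r n)
    (hr : Filter.Tendsto r Filter.atTop (𝓝 0)) :
    Filter.Tendsto (fun n => (r n)⁻¹ • (NormedSpace.exp ((-r n) • Y) - 1)) Filter.atTop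
      (𝓝 (-Y)) := by
  have h : HasDerivAt (fun t : ℝ => NormedSpace.exp (t • (-Y))) (-Y) 0 := by
    simpa [NormedSpace.exp_zero] using hasDerivAt_exp_smul_const (-Y) (0 : ℝ)
  have h2 := (hasDerivAt_iff_tendsto_slope_zero.1 h).comp (tendsto_nhdsWithin_iff.2
    ⟨hr, Filter.Eventually.of_forall fun n => (hr0 n).ne'⟩)
  refine h2.congr fun n => ?_
  simp [NormedSpace.exp_zero]

theorem exists_mem_annihilator_of_curves (W : Submodule ℝ V) (c : V → ℝ → V) (c' : V → V)
    (hc : ∀ w ∈ W, HasDerivAt (c w) (c' w) 0) (hc0 : ∀ w ∈ W, c w 0 = w)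
    (hG : ∀ᶠ t in 𝓝 (0 : ℝ), ∃ A ∈ stabSet α, ∀ w ∈ W, ∃ w' ∈ W, A w' = c w t) :
    ∃ X ∈ annihilator α, ∀ w ∈ W, c' w - X w ∈ W := by
  -- a sequence of times
  obtain ⟨t, ht0, htG, ht⟩ : ∃ t : ℕ → ℝ, (∀ n, 0 < t n) ∧
      (∀ n, ∃ A ∈ stabSet α, ∀ w ∈ W, ∃ w' ∈ W, A w' = c w (t n)) ∧
      Filter.Tendsto t Filter.atTop (𝓝 0) := by
    obtain ⟨ε, hε, hε'⟩ := Metric.eventually_nhds_iff.1 hG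
    obtain ⟨u, -, hu, hu'⟩ := exists_seq_strictAnti_tendsto' hε
    refine ⟨u, fun n => (hu n).1, fun n => hε' ?_, hu'⟩
    rw [Real.dist_eq, sub_zero, abs_of_pos (hu n).1]
    exact (hu n).2
  let S : ℕ → Set (V →L[ℝ] V) := fun n =>
    {A | A ∈ stabSet α ∧ ∀ w ∈ W, ∃ w' ∈ W, A w' = c w (t n)}
  have hS : ∀ n, ∃ A ∈ S n, ∀ B ∈ S n, ‖A - 1‖ ≤ ‖B - 1‖ + t n ^ 2 := by
    intro n
    have hne : ((fun A : V →L[ℝ] V => ‖A - 1‖) '' S n).Nonempty := by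
      obtain ⟨A, hA⟩ := htG n
      exact ⟨_, A, hA, rfl⟩
    have hbdd : BddBelow ((fun A : V →L[ℝ] V => ‖A - 1‖) '' S n) :=
      ⟨0, by rintro _ ⟨A, -, rfl⟩; exact norm_nonneg _⟩
    obtain ⟨_, ⟨A, hA, rfl⟩, hlt⟩ := exists_lt_of_csInf_lt hne
      (lt_add_of_pos_right (sInf ((fun A : V →L[ℝ] V => ‖A - 1‖) '' S n)) (pow_pos (ht0 n) 2))
    refine ⟨A, hA, fun B hB => hlt.le.trans ?_⟩
    exact add_le_add_left (csInf_le hbdd ⟨B, hB, rfl⟩) _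
  have hSmul : ∀ n, ∀ A ∈ S n, ∀ B ∈ stabSet α, (∀ w ∈ W, ∃ w' ∈ W, B w' = w) → A * B ∈ S n := by
    intro n A hA B hB hBW
    refine ⟨mul_mem_stabSet hA.1 hB, fun w hw => ?_⟩
    obtain ⟨w', hw', h'⟩ := hA.2 w hw
    obtain ⟨w'', hw'', h''⟩ := hBW w' hw'
    exact ⟨w'', hw'', by rw [mul_apply_eq_comp, h'', h']⟩
  have hct : ∀ w ∈ W, Filter.Tendsto (fun n => c w (t n)) Filter.atTop (𝓝 w) := by
    intro w hw
    have := (hc w hw).continuousAt.tendsto.comp ht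
    rwa [hc0 w hw] at this
  choose A hA hAmin using hS
  -- along a subsequence, `A` converges to `1`
  obtain ⟨g, hg, φ, hφ, hAg⟩ := (isCompact_stabSet α).tendsto_subseq fun n => (hA n).1
  obtain ⟨g', hg', hgg', hg'g⟩ := exists_inv_of_mem_stabSet hg
  have hg'W : ∀ w ∈ W, g' w ∈ W := by
    intro w hw
    choose w' hw' hAw' using fun n => (hA (φ n)).2 w hw
    refine W.closed_of_finiteDimensional.mem_of_tendsto (b := Filter.atTop) (f := w') ?_
      (Filter.Eventually.of_forall hw')
    rw [tendsto_iff_norm_sub_tendsto_zero]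
    have h1 : Filter.Tendsto (fun n => c w (t (φ n)) - A (φ n) (g' w)) Filter.atTop
        (𝓝 (w - g (g' w))) :=
      ((hct w hw).comp hφ.tendsto_atTop).sub
        (((ContinuousLinearMap.apply ℝ V (g' w)).continuous.tendsto g).comp hAg)
    have h2 : g (g' w) = w := by
      rw [← mul_apply_eq_comp, hgg']; rfl
    rw [h2, sub_self] at h1
    have h3 := h1.norm
    rw [norm_zero] at h3
    refine h3.congr fun n => ?_
    rw [← hAw' n, ← map_sub, norm_apply_of_mem_stabSet (hA (φ n)).1]
  have hg'W' : ∀ w ∈ W, ∃ w' ∈ W, g' w' = w := by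
    have hmap : W.map (g' : V →ₗ[ℝ] V) = W := by
      refine Submodule.eq_of_le_of_finrank_eq ?_ ?_
      · rintro _ ⟨w, hw, rfl⟩
        exact hg'W w hw
      · obtain ⟨P, -, rfl⟩ := exists_of_mem_stabSet hg'
        exact LinearEquiv.finrank_map_eq P.toLinearEquiv W
    intro w hw
    rw [← hmap] at hw
    exact hw
  have hA1 : Filter.Tendsto (fun n => A (φ n)) Filter.atTop (𝓝 1) := by
    rw [tendsto_iff_norm_sub_tendsto_zero]
    have h1 : Filter.Tendsto (fun n => ‖A (φ n) * g' - 1‖ + t (φ n) ^ 2) Filter.atTop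
        (𝓝 (‖g * g' - 1‖ + 0 ^ 2)) :=
      ((hAg.mul_const g').sub_const 1).norm.add ((ht.comp hφ.tendsto_atTop).pow 2)
    rw [hgg', sub_self, norm_zero, zero_pow two_ne_zero, add_zero] at h1
    exact squeeze_zero (fun n => norm_nonneg _)
      (fun n => hAmin _ _ (hSmul _ _ (hA _) _ hg' hg'W')) h1
  -- rescale
  have hr : ∀ n, 0 < ‖A (φ n) - 1‖ + t (φ n) := fun n => add_pos_of_nonneg_of_pos (norm_nonneg _) (ht0 _)
  have hA1' := tendsto_iff_norm_sub_tendsto_zero.1 hA1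
  obtain ⟨⟨Y, τ⟩, -, ψ, hψ, hY⟩ := (isCompact_closedBall (0 : (V →L[ℝ] V) × ℝ) 1).tendsto_subseq
    (x := fun n => (‖A (φ n) - 1‖ + t (φ n))⁻¹ • (A (φ n) - 1, t (φ n))) fun n => by
      rw [mem_closedBall_zero_iff, norm_smul, norm_inv, Real.norm_of_nonneg (hr n).le,
        inv_mul_le_one₀ (hr n), Prod.norm_def]
      refine max_le (le_add_of_nonneg_right (ht0 _).le) ?_
      rw [Real.norm_of_nonneg (ht0 _).le]
      exact le_add_of_nonneg_left (norm_nonneg _)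
  set B : ℕ → V →L[ℝ] V := fun n => A (φ (ψ n)) with hB
  set s : ℕ → ℝ := fun n => t (φ (ψ n)) with hs
  set r : ℕ → ℝ := fun n => ‖B n - 1‖ + s n with hrdef
  have hr0 : ∀ n, 0 < r n := fun n => hr _
  have hY1 : Filter.Tendsto (fun n => (r n)⁻¹ • (B n - 1)) Filter.atTop (𝓝 Y) :=
    (continuous_fst.tendsto _).comp hY
  have hτ : Filter.Tendsto (fun n => (r n)⁻¹ * s n) Filter.atTop (𝓝 τ) :=
    (continuous_snd.tendsto _).comp hY
  have hst : Filter.Tendsto s Filter.atTop (𝓝 0) := (ht.comp hφ.tendsto_atTop).comp hψ.tendsto_atTop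
  have hB1 : Filter.Tendsto B Filter.atTop (𝓝 1) := hA1.comp hψ.tendsto_atTop
  have hr1 : Filter.Tendsto r Filter.atTop (𝓝 0) := by
    have := (hA1'.comp hψ.tendsto_atTop).add hst
    rwa [add_zero] at this
  have hYg : Y ∈ annihilator α := mem_annihilator_of_tendsto (fun n => (hA _).1) hr1 hr0 hY1
  have hYW : ∀ w ∈ W, τ • c' w - Y w ∈ W := by
    intro w hw
    choose w' hw' hBw' using fun n => (hA (φ (ψ n))).2 w hw
    have hBw'' : ∀ n, B n (w' n) = c w (s n) := hBw'
    have hw't : Filter.Tendsto w' Filter.atTop (𝓝 w) := by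
      rw [tendsto_iff_norm_sub_tendsto_zero]
      have h1 : Filter.Tendsto (fun n => c w (s n) - B n w) Filter.atTop (𝓝 (w - w)) :=
        ((hct w hw).comp (hφ.tendsto_atTop.comp hψ.tendsto_atTop)).sub
          (((ContinuousLinearMap.apply ℝ V w).continuous.tendsto 1).comp hB1)
      rw [sub_self] at h1
      have h3 := h1.norm
      rw [norm_zero] at h3
      refine h3.congr fun n => ?_
      rw [← hBw'' n, ← map_sub, norm_apply_of_mem_stabSet (hA _).1]
    have h1 : Filter.Tendsto (fun n => ((r n)⁻¹ • (B n - 1)) (w' n)) Filter.atTop (𝓝 (Y w)) :=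
      (isBoundedBilinearMap_apply.continuous.tendsto (Y, w)).comp (hY1.prodMk_nhds hw't)
    have h2 : Filter.Tendsto (fun n => ((r n)⁻¹ * s n) • ((s n)⁻¹ • (c w (s n) - w))) Filter.atTop
        (𝓝 (τ • c' w)) := by
      refine hτ.smul ?_
      have h3 := (hasDerivAt_iff_tendsto_slope_zero.1 (hc w hw)).comp (tendsto_nhdsWithin_iff.2
        ⟨hst, Filter.Eventually.of_forall fun n => (ht0 _).ne'⟩)
      refine h3.congr fun n => ?_
      simp [hc0 w hw, s]
    refine W.closed_of_finiteDimensional.mem_of_tendsto (h2.sub h1)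
      (Filter.Eventually.of_forall fun n => ?_)
    have h4 : ((r n)⁻¹ * s n) • ((s n)⁻¹ • (c w (s n) - w)) - ((r n)⁻¹ • (B n - 1)) (w' n) =
        (r n)⁻¹ • (w' n - w) := by
      have hsn : s n ≠ 0 := (ht0 _).ne'
      rw [smul_smul, mul_assoc, mul_inv_cancel₀ hsn, mul_one, smul_apply, ← smul_sub, sub_apply,
        hBw'', one_apply_eq_self]
      congr 1
      abel
    rw [h4]
    exact W.smul_mem _ (W.sub_mem (hw' n) hw)
  by_cases hτ0 : τ = 0
  · exfalso
    have hYW' : ∀ w ∈ W, Y w ∈ W := fun w hw => by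
      have := hYW w hw
      rw [hτ0, zero_smul, zero_sub] at this
      exact (W.neg_mem_iff).1 this
    have hYn : ‖Y‖ = 1 := by
      have h1 : Filter.Tendsto (fun n => ‖(r n)⁻¹ • (B n - 1)‖ + (r n)⁻¹ * s n) Filter.atTop
          (𝓝 (‖Y‖ + τ)) := hY1.norm.add hτ
      rw [hτ0, add_zero] at h1
      refine tendsto_nhds_unique h1 (tendsto_const_nhds.congr fun n => ?_)
      rw [norm_smul, norm_inv, Real.norm_of_nonneg (hr0 n).le, ← mul_add]
      exact (inv_mul_cancel₀ (hr0 n).ne').symm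
    have hle : ∀ n, ‖(r n)⁻¹ • (B n - 1)‖ ≤
        ‖(r n)⁻¹ • (B n * NormedSpace.exp ((-r n) • Y) - 1)‖ + ((r n)⁻¹ * s n) * s n := by
      intro n
      have hmem : B n * NormedSpace.exp ((-r n) • Y) ∈ S (φ (ψ n)) := by
        refine hSmul _ _ (hA _) _ (exp_mem_stabSet hYg _) ?_
        obtain ⟨P, hP, hP'⟩ := (mem_lieH_iff.2 ⟨hYg, hYW'⟩ : Y ∈ lieH α W) (-r n)
        intro w hw
        rw [← hP.2] at hw
        obtain ⟨w', hw', h'⟩ := hw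
        exact ⟨w', hw', by rw [← hP', ← h']; rfl⟩
      have h1 := hAmin _ _ hmem
      rw [norm_smul, norm_smul, norm_inv, Real.norm_of_nonneg (hr0 n).le, mul_assoc, ← mul_add,
        ← pow_two]
      exact mul_le_mul_of_nonneg_left h1 (inv_nonneg.2 (hr0 n).le)
    have hlim : Filter.Tendsto (fun n => ‖(r n)⁻¹ • (B n * NormedSpace.exp ((-r n) • Y) - 1)‖ +
        ((r n)⁻¹ * s n) * s n) Filter.atTop (𝓝 (‖(1 : V →L[ℝ] V) * (-Y) + Y‖ + τ * 0)) := by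
      refine Filter.Tendsto.add (Filter.Tendsto.norm ?_) (hτ.mul hst)
      refine ((hB1.mul (exp_smul_isLittleO Y hr0 hr1)).add hY1).congr fun n => ?_
      rw [mul_smul_comm, ← smul_add, mul_sub, mul_one]
      congr 1
      abel
    have := le_of_tendsto_of_tendsto' hY1.norm hlim hle
    rw [hYn, one_mul, neg_add_cancel, norm_zero, mul_zero, add_zero] at this
    linarith
  · refine ⟨τ⁻¹ • Y, Submodule.smul_mem _ _ hYg, fun w hw => ?_⟩
    have := W.smul_mem τ⁻¹ (hYW w hw)
    rwa [smul_sub, smul_smul, inv_mul_cancel₀ hτ0, one_smul] at this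

/-- Compliancy: the velocity at `W` of a curve in the orbit of `W` is that of an element of
`𝔤 ∩ (W ⊗ W^⊥)`. -/
theorem exists_mem_offDiag_of_curves (hα : IsCompliant α) {W : Submodule ℝ V}
    (hW : W ∈ calGrass (α 0)) (c : V → ℝ → V) (c' : V → V)
    (hc : ∀ w ∈ W, HasDerivAt (c w) (c' w) 0) (hc0 : ∀ w ∈ W, c w 0 = w)
    (hG : ∀ᶠ t in 𝓝 (0 : ℝ), ∃ A ∈ stabSet α, ∀ w ∈ W, ∃ w' ∈ W, A w' = c w t) :
    ∃ X ∈ annihilator α, X ∈ offDiag W ∧ ∀ w ∈ W, c' w - X w ∈ W := by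
  obtain ⟨X, hX, hXc⟩ := exists_mem_annihilator_of_curves W c c' hc hc0 hG
  obtain ⟨Y, hY, hXY⟩ := exists_sub_mem_lieH W hX
  rw [hα W hW] at hY
  refine ⟨Y, mem_lieG_iff.1 hY.1, hY.2, fun w hw => ?_⟩
  have := W.add_mem (hXc w hw) (hXY w hw)
  rwa [sub_add_sub_cancel] at this

end Orbits

section Calculus

variable {E' : Type*} [NormedAddCommGroup E'] [NormedSpace ℝ E']
  {H' : Type*} [TopologicalSpace H'] {J : ModelWithCorners ℝ E' H'}
  {L : Type*} [TopologicalSpace L] [ChartedSpace H' L]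
  {F : Type*} [NormedAddCommGroup F] [NormedSpace ℝ F]
  {F' : Type*} [NormedAddCommGroup F'] [NormedSpace ℝ F']

theorem hasDerivAt_comp_curve {h : L → F} {γ : ℝ → L} {t : ℝ}
    (hγ : MDifferentiableAt 𝓘(ℝ, ℝ) J γ t) (hh : MDifferentiableAt J 𝓘(ℝ, F) h (γ t)) :
    HasDerivAt (fun s => h (γ s)) (mvfderiv J h (γ t) (mfderiv 𝓘(ℝ, ℝ) J γ t (1 : ℝ))) t := by
  have h1 := hasMFDerivAt_iff_hasFDerivAt.1 (hh.hasMFDerivAt.comp t hγ.hasMFDerivAt)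
  have h2 : HasFDerivAt (fun s => h (γ s)) (show ℝ →L[ℝ] F from
    mvfderiv J h (γ t) ∘L mfderiv 𝓘(ℝ, ℝ) J γ t) t := h1
  exact h2.hasDerivAt

theorem mvfderiv_congr {h h' : L → F} {x : L} (hh : h =ᶠ[𝓝 x] h') :
    mvfderiv J h x = mvfderiv J h' x := by
  have h1 := hh.mfderiv_eq (I := J) (I' := 𝓘(ℝ, F))
  unfold mvfderiv
  ext u
  simp only [ContinuousLinearMap.comp_apply]
  exact DFunLike.congr_fun h1 u

theorem mvfderiv_chain {E : Type*} [NormedAddCommGroup E] [NormedSpace ℝ E]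
    {H : Type*} [TopologicalSpace H] {I : ModelWithCorners ℝ E H}
    {M : Type*} [TopologicalSpace M] [ChartedSpace H M] {f : L → M} {h : M → F} {x : L}
    (hh : MDifferentiableAt I 𝓘(ℝ, F) h (f x)) (hf : MDifferentiableAt J I f x)
    (u : TangentSpace J x) :
    mvfderiv J (fun y => h (f y)) x u = mvfderiv I h (f x) (mfderiv J I f x u) :=
  mfderiv_comp_apply x hh hf u

variable [J.Boundaryless] [IsManifold J ∞ L]

theorem exists_curve (x : L) (u : TangentSpace J x) :
    ∃ γ : ℝ → L, ∃ h : γ 0 = x, ContMDiffAt 𝓘(ℝ, ℝ) J ∞ γ 0 ∧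
      h ▸ mfderiv 𝓘(ℝ, ℝ) J γ 0 (1 : ℝ) = u := by
  obtain ⟨w, hw⟩ : ∃ w : E', w = u := ⟨u, rfl⟩
  let c : ℝ → E' := fun t => extChartAt J x x + t • w
  let γ : ℝ → L := fun t => (extChartAt J x).symm (c t)
  have hc0 : c 0 = extChartAt J x x := by simp [c]
  have h0 : γ 0 = x := by
    change (extChartAt J x).symm (c 0) = x
    rw [hc0, extChartAt_to_inv]
  have hc : ContMDiffAt 𝓘(ℝ, ℝ) 𝓘(ℝ, E') ∞ c 0 := by
    rw [contMDiffAt_iff_contDiffAt]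
    fun_prop
  have hs : ContMDiffAt 𝓘(ℝ, E') J ∞ (extChartAt J x).symm (c 0) := by
    rw [hc0]
    exact (contMDiffOn_extChartAt_symm x).contMDiffAt (extChartAt_target_mem_nhds x)
  have hder : HasDerivAt c w 0 := by
    simpa [c] using ((hasDerivAt_id (0 : ℝ)).smul_const w).const_add (extChartAt J x x)
  have hcoe : ∀ (y : L) (h : y = x) (a : TangentSpace J y), (a : E') = w → h ▸ a = u := by
    rintro y rfl a h
    exact h.trans hw
  refine ⟨γ, h0, hs.comp 0 hc, hcoe _ h0 _ ?_⟩
  have h1 : mfderiv 𝓘(ℝ, ℝ) J γ 0 = mfderiv 𝓘(ℝ, E') J (extChartAt J x).symm (c 0) ∘L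
      mfderiv 𝓘(ℝ, ℝ) 𝓘(ℝ, E') c 0 :=
    mfderiv_comp 0 (hs.mdifferentiableAt (by simp)) (hc.mdifferentiableAt (by simp))
  have h2 : mfderiv 𝓘(ℝ, ℝ) 𝓘(ℝ, E') c 0 (1 : ℝ) = w := by
    have h : fderiv ℝ c 0 (1 : ℝ) = w := fderiv_apply_one_eq_deriv.trans hder.deriv
    rw [mfderiv_eq_fderiv]
    exact h
  have h3 := mfderivWithin_range_extChartAt_symm (I := J) (x := x)
  rw [ModelWithCorners.range_eq_univ, mfderivWithin_univ, ← hc0] at h3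
  exact (DFunLike.congr_fun h1 (1 : ℝ)).trans ((DFunLike.congr_fun h3 _).trans h2)

theorem mvfderiv_clm_apply {A : L → F →L[ℝ] F'} {g : L → F} {x : L}
    (hA : MDifferentiableAt J 𝓘(ℝ, F →L[ℝ] F') A x) (hg : MDifferentiableAt J 𝓘(ℝ, F) g x)
    (u : TangentSpace J x) :
    mvfderiv J (fun y => A y (g y)) x u = mvfderiv J A x u (g x) + A x (mvfderiv J g x u) := by
  obtain ⟨γ, rfl, hγ, rfl⟩ := exists_curve x u
  have hγ' := hγ.mdifferentiableAt (by simp : (∞ : WithTop ℕ∞) ≠ 0)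
  exact (hasDerivAt_comp_curve hγ' (hA.clm_apply hg)).unique
    ((hasDerivAt_comp_curve hγ' hA).clm_apply (hasDerivAt_comp_curve hγ' hg))

theorem mvfderiv_clm_const_apply {A : L → F →L[ℝ] F'} {x : L}
    (hA : MDifferentiableAt J 𝓘(ℝ, F →L[ℝ] F') A x) (b : F) (u : TangentSpace J x) :
    mvfderiv J (fun y => A y b) x u = mvfderiv J A x u b := by
  rw [mvfderiv_clm_apply hA mdifferentiableAt_const, mvfderiv_const]
  simp

end Calculus

section ClmSmooth

variable {E' : Type*} [NormedAddCommGroup E'] [NormedSpace ℝ E']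
  {H' : Type*} [TopologicalSpace H'] {J : ModelWithCorners ℝ E' H'}
  {L : Type*} [TopologicalSpace L] [ChartedSpace H' L]
  {F : Type*} [NormedAddCommGroup F] [NormedSpace ℝ F]
  {F' : Type*} [NormedAddCommGroup F'] [NormedSpace ℝ F']

/-- A map into linear maps on a finite-dimensional space is smooth if its values on fixed vectors
are. -/
theorem contMDiffAt_clm_of_apply [FiniteDimensional ℝ F] {A : L → F →L[ℝ] F'} {x : L}
    {n : WithTop ℕ∞} (h : ∀ b, ContMDiffAt J 𝓘(ℝ, F') n (fun y => A y b) x) :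
    ContMDiffAt J 𝓘(ℝ, F →L[ℝ] F') n A x := by
  let b := Module.finBasis ℝ F
  let φ : ∀ i, F →L[ℝ] ℝ := fun i => LinearMap.toContinuousLinearMap (b.coord i)
  have hA : A = fun y => ∑ i, ContinuousLinearMap.smulRightL ℝ F F' (φ i) (A y (b i)) := by
    funext y
    refine ContinuousLinearMap.ext fun v => ?_
    calc A y v = A y (∑ i, b.repr v i • b i) := by rw [b.sum_repr]
      _ = _ := by rw [map_sum]; simp [φ]
  rw [hA]
  refine ContMDiffAt.sum fun i _ => ?_
  exact (ContinuousLinearMap.contMDiff (ContinuousLinearMap.smulRightL ℝ F F' (φ i))).contMDiffAt.comp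
    x (h (b i))

end ClmSmooth

section Coordinates

variable {E : Type*} [NormedAddCommGroup E] [NormedSpace ℝ E] [FiniteDimensional ℝ E]
  {H : Type*} [TopologicalSpace H] {I : ModelWithCorners ℝ E H}
  {M : Type*} [TopologicalSpace M] [ChartedSpace H M] [IsManifold I ∞ M]
  {E' : Type*} [NormedAddCommGroup E'] [NormedSpace ℝ E']
  {H' : Type*} [TopologicalSpace H'] {J : ModelWithCorners ℝ E' H'}
  {L : Type*} [TopologicalSpace L] [ChartedSpace H' L]

variable (I) in
/-- The coordinates of tangent vectors at `q` in the chart at `p`. -/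
abbrev toCoord (p q : M) : TangentSpace I q →L[ℝ] E :=
  (trivializationAt E (TangentSpace I) p).continuousLinearMapAt ℝ q

variable (I) in
/-- The tangent vector at `q` with given coordinates in the chart at `p`. -/
abbrev ofCoord (p q : M) : E →L[ℝ] TangentSpace I q :=
  (trivializationAt E (TangentSpace I) p).symmL ℝ q

theorem ofCoord_toCoord {p q : M} (hq : q ∈ (chartAt H p).source) (v : TangentSpace I q) :
    ofCoord I p q (toCoord I p q v) = v :=
  (trivializationAt E (TangentSpace I) p).symmL_continuousLinearMapAt hq v

theorem toCoord_ofCoord {p q : M} (hq : q ∈ (chartAt H p).source) (v : E) :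
    toCoord I p q (ofCoord I p q v) = v :=
  (trivializationAt E (TangentSpace I) p).continuousLinearMapAt_symmL hq v

theorem chart_source_mem {p q : M} (hq : q ∈ (chartAt H p).source) :
    (chartAt H p).source ∈ 𝓝 q :=
  (chartAt H p).open_source.mem_nhds hq

theorem contMDiffAt_along_iff {f : L → M} {s : ∀ y, TangentSpace I (f y)} {x : L} {p : M}
    (hf : ContMDiffAt J I ∞ f x) (hp : f x ∈ (chartAt H p).source) :
    ContMDiffAt J I.tangent ∞ (fun y => (⟨f y, s y⟩ : TangentBundle I M)) x ↔
      ContMDiffAt J 𝓘(ℝ, E) ∞ (fun y => toCoord I p (f y) (s y)) x := by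
  rw [(trivializationAt E (TangentSpace I) p).contMDiffAt_iff (IB := I)
    (f := fun y => (⟨f y, s y⟩ : TangentBundle I M))
    ((trivializationAt E (TangentSpace I) p).mem_source.2 hp)]
  have h : (fun y => ((trivializationAt E (TangentSpace I) p)
      (⟨f y, s y⟩ : TangentBundle I M)).2) =ᶠ[𝓝 x] fun y => toCoord I p (f y) (s y) := by
    filter_upwards [hf.continuousAt.preimage_mem_nhds (chart_source_mem hp)] with y hy
    exact ((trivializationAt E (TangentSpace I) p).continuousLinearMapAt_apply_of_mem ℝ hy _).symm
  rw [h.contMDiffAt_iff]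
  exact and_iff_right hf

theorem mdifferentiableAt_along_iff {f : L → M} {s : ∀ y, TangentSpace I (f y)} {x : L} {p : M}
    (hf : MDifferentiableAt J I f x) (hp : f x ∈ (chartAt H p).source) :
    MDifferentiableAt J I.tangent (fun y => (⟨f y, s y⟩ : TangentBundle I M)) x ↔
      MDifferentiableAt J 𝓘(ℝ, E) (fun y => toCoord I p (f y) (s y)) x := by
  rw [(trivializationAt E (TangentSpace I) p).mdifferentiableAt_totalSpace_iff I
    (fun y => (⟨f y, s y⟩ : TangentBundle I M))
    ((trivializationAt E (TangentSpace I) p).mem_source.2 hp)]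
  have h : (fun y => ((trivializationAt E (TangentSpace I) p)
      (⟨f y, s y⟩ : TangentBundle I M)).2) =ᶠ[𝓝 x] fun y => toCoord I p (f y) (s y) := by
    filter_upwards [hf.continuousAt.preimage_mem_nhds (chart_source_mem hp)] with y hy
    exact ((trivializationAt E (TangentSpace I) p).continuousLinearMapAt_apply_of_mem ℝ hy _).symm
  rw [h.mdifferentiableAt_iff]
  exact and_iff_right hf

theorem contMDiffAt_ofCoord {f : L → M} {x : L} {p : M} {σ : L → E}
    (hf : ContMDiffAt J I ∞ f x) (hp : f x ∈ (chartAt H p).source)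
    (hσ : ContMDiffAt J 𝓘(ℝ, E) ∞ σ x) :
    ContMDiffAt J I.tangent ∞ (fun y => (⟨f y, ofCoord I p (f y) (σ y)⟩ : TangentBundle I M)) x := by
  rw [contMDiffAt_along_iff hf hp]
  refine hσ.congr_of_eventuallyEq ?_
  filter_upwards [hf.continuousAt.preimage_mem_nhds (chart_source_mem hp)] with y hy
  exact toCoord_ofCoord hy _

theorem mdifferentiableAt_ofCoord {f : L → M} {x : L} {p : M} {σ : L → E}
    (hf : MDifferentiableAt J I f x) (hp : f x ∈ (chartAt H p).source)
    (hσ : MDifferentiableAt J 𝓘(ℝ, E) σ x) :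
    MDifferentiableAt J I.tangent
      (fun y => (⟨f y, ofCoord I p (f y) (σ y)⟩ : TangentBundle I M)) x := by
  rw [mdifferentiableAt_along_iff hf hp]
  refine hσ.congr_of_eventuallyEq ?_
  filter_upwards [hf.continuousAt.preimage_mem_nhds (chart_source_mem hp)] with y hy
  exact toCoord_ofCoord hy _

/-- The change of coordinates on tangent vectors from the chart at `p` to the chart at `q` has
symmetric derivative, since it is the derivative of the change of charts. -/
theorem exists_mvfderiv_transition [I.Boundaryless] {p q : M} (hq : q ∈ (chartAt H p).source) :
    MDifferentiableAt I 𝓘(ℝ, E →L[ℝ] E) (fun z => toCoord I q z ∘L ofCoord I p z) q ∧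
    ∀ a b : E, mvfderiv I (fun z => toCoord I q z ∘L ofCoord I p z) q (ofCoord I p q a) b =
      mvfderiv I (fun z => toCoord I q z ∘L ofCoord I p z) q (ofCoord I p q b) a := by
  let ψ : E → E := extChartAt I q ∘ (extChartAt I p).symm
  have hψ : ContDiffAt ℝ ∞ ψ (extChartAt I p q) := by
    have := contDiffWithinAt_ext_coord_change (I := I) (n := ∞) q p (y := extChartAt I p q) (by
      rw [PartialEquiv.trans_source'', PartialEquiv.symm_symm, PartialEquiv.symm_target]
      exact Set.mem_image_of_mem _ ⟨by simpa using hq, mem_extChartAt_source q⟩)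
    rwa [ModelWithCorners.range_eq_univ, contDiffWithinAt_univ] at this
  have heq : (fun z => toCoord I q z ∘L ofCoord I p z) =ᶠ[𝓝 q]
      fun z => fderiv ℝ ψ (extChartAt I p z) := by
    filter_upwards [chart_source_mem hq, chart_source_mem (mem_chart_source H q)] with z hz hz'
    refine ContinuousLinearMap.ext fun b => ?_
    have h1 := TangentBundle.symmL_trivializationAt_eq_core (I := I) hz
    have h2 := TangentBundle.continuousLinearMapAt_trivializationAt_eq_core (I := I) hz'
    have h3 := (tangentBundleCore I M).coordChange_comp (achart H p) (achart H z) (achart H q) z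
      ⟨⟨hz, mem_chart_source H z⟩, hz'⟩ b
    have h4 : (tangentBundleCore I M).coordChange (achart H p) (achart H q) z =
        fderiv ℝ ψ (extChartAt I p z) := by
      rw [tangentBundleCore_coordChange_achart, ModelWithCorners.range_eq_univ, fderivWithin_univ]
    rw [← h4, ← h3]
    exact (DFunLike.congr_fun h2 _).trans (congrArg _ (DFunLike.congr_fun h1 b))
  have hd : MDifferentiableAt 𝓘(ℝ, E) 𝓘(ℝ, E →L[ℝ] E) (fderiv ℝ ψ) (extChartAt I p q) := by
    rw [mdifferentiableAt_iff_differentiableAt]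
    exact ((hψ.fderiv_right (m := ∞) (by simp)).differentiableAt (by simp))
  have hφ : MDifferentiableAt I 𝓘(ℝ, E) (extChartAt I p) q := mdifferentiableAt_extChartAt hq
  refine ⟨(hd.comp q hφ).congr_of_eventuallyEq heq, fun a b => ?_⟩
  have hsymm : IsSymmSndFDerivAt ℝ ψ (extChartAt I p q) := hψ.isSymmSndFDerivAt (by simpa using ENat.LEInfty.out)
  have key : ∀ a : E, mvfderiv I (fun z => toCoord I q z ∘L ofCoord I p z) q (ofCoord I p q a) =
      fderiv ℝ (fderiv ℝ ψ) (extChartAt I p q) a := by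
    intro a
    rw [mvfderiv_congr heq, mvfderiv_chain hd hφ]
    have h5 : mfderiv I 𝓘(ℝ, E) (extChartAt I p) q (ofCoord I p q a) = a := by
      rw [← TangentBundle.continuousLinearMapAt_trivializationAt hq]
      exact toCoord_ofCoord hq a
    rw [h5]
    unfold mvfderiv
    rw [mfderiv_eq_fderiv]
    rfl
  rw [key, key]
  exact hsymm a b

end Coordinates

section MetricConnection

variable {E : Type*} [NormedAddCommGroup E] [NormedSpace ℝ E] [FiniteDimensional ℝ E]
  {H : Type*} [TopologicalSpace H] {I : ModelWithCorners ℝ E H}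
  {M : Type*} [TopologicalSpace M] [ChartedSpace H M] [IsManifold I ∞ M]
  [RiemannianBundle (fun x : M => TangentSpace I x)]
  [IsContMDiffRiemannianBundle I ∞ E (fun x : M => TangentSpace I x)]
  {E' : Type*} [NormedAddCommGroup E'] [NormedSpace ℝ E']
  {H' : Type*} [TopologicalSpace H'] {J : ModelWithCorners ℝ E' H'}
  {L : Type*} [TopologicalSpace L] [ChartedSpace H' L]

theorem chartMetric_apply (p q : M) (b c : E) :
    chartMetric I p q b c = inner ℝ (ofCoord I p q b) (ofCoord I p q c) := rfl

theorem contMDiffAt_chartMetric {p q : M} (hq : q ∈ (chartAt H p).source) :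
    ContMDiffAt I 𝓘(ℝ, E →L[ℝ] E →L[ℝ] ℝ) ∞ (chartMetric I p) q := by
  refine contMDiffAt_clm_of_apply fun b => contMDiffAt_clm_of_apply fun c => ?_
  simp only [chartMetric_apply]
  exact ContMDiffAt.inner_bundle (IB := I) (F := E) (E := fun x : M => TangentSpace I x)
    (b := fun y : M => y)
    (contMDiffAt_ofCoord (f := fun y : M => y) contMDiffAt_id hq contMDiffAt_const)
    (contMDiffAt_ofCoord (f := fun y : M => y) contMDiffAt_id hq contMDiffAt_const)

theorem mdifferentiableAt_chartMetric {p q : M} (hq : q ∈ (chartAt H p).source) :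
    MDifferentiableAt I 𝓘(ℝ, E →L[ℝ] E →L[ℝ] ℝ) (chartMetric I p) q :=
  (contMDiffAt_chartMetric hq).mdifferentiableAt (by simp)

variable [I.Boundaryless]

theorem mvfderiv_chartMetric_apply {p q : M} (hq : q ∈ (chartAt H p).source)
    (w : TangentSpace I q) (b c : E) :
    mvfderiv I (chartMetric I p) q w b c =
      mvfderiv I (fun z => inner ℝ (ofCoord I p z b) (ofCoord I p z c)) q w := by
  have h := mdifferentiableAt_chartMetric (I := I) hq
  have h2 : MDifferentiableAt I 𝓘(ℝ, E →L[ℝ] ℝ) (fun z => chartMetric I p z b) q :=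
    h.clm_apply mdifferentiableAt_const
  rw [← mvfderiv_clm_const_apply h b w, ← mvfderiv_clm_const_apply h2 c w]
  rfl

theorem mvfderiv_chartMetric_comm {p q : M} (hq : q ∈ (chartAt H p).source)
    (w : TangentSpace I q) (b c : E) :
    mvfderiv I (chartMetric I p) q w b c = mvfderiv I (chartMetric I p) q w c b := by
  rw [mvfderiv_chartMetric_apply hq, mvfderiv_chartMetric_apply hq]
  simp only [real_inner_comm]

theorem inner_christoffel_add (q : M) (u v w : TangentSpace I q) :
    inner ℝ (christoffel I q v u) w + inner ℝ v (christoffel I q w u) =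
      mvfderiv I (chartMetric I q) q u (toCoord I q q v) (toCoord I q q w) := by
  rw [real_inner_comm _ v]
  unfold christoffel
  rw [inner_koszulMap, inner_koszulMap]
  rw [mvfderiv_chartMetric_comm (mem_chart_source H q) u (toCoord I q q w)]
  ring

theorem christoffel_comm (q : M) (u v : TangentSpace I q) :
    christoffel I q v u = christoffel I q u v := by
  refine ext_inner_right ℝ fun w => ?_
  unfold christoffel
  rw [inner_koszulMap, inner_koszulMap,
    mvfderiv_chartMetric_comm (mem_chart_source H q) w (toCoord I q q v)]
  ring

variable [J.Boundaryless] [IsManifold J ∞ L]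

/-- The Levi-Civita connection is metric. -/
theorem mvfderiv_inner {f : L → M} {s t : ∀ y, TangentSpace I (f y)} {x : L}
    (hf : MDifferentiableAt J I f x)
    (hs : MDifferentiableAt J I.tangent (fun y => (⟨f y, s y⟩ : TangentBundle I M)) x)
    (ht : MDifferentiableAt J I.tangent (fun y => (⟨f y, t y⟩ : TangentBundle I M)) x)
    (u : TangentSpace J x) :
    mvfderiv J (fun y => inner ℝ (s y) (t y)) x u =
      inner ℝ (covAlong I J f s x u) (t x) + inner ℝ (s x) (covAlong I J f t x u) := by
  have hx := mem_chart_source H (f x)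
  have hs' := (mdifferentiableAt_along_iff hf hx).1 hs
  have ht' := (mdifferentiableAt_along_iff hf hx).1 ht
  have heq : (fun y => inner ℝ (s y) (t y)) =ᶠ[𝓝 x] fun y => chartMetric I (f x) (f y)
      (toCoord I (f x) (f y) (s y)) (toCoord I (f x) (f y) (t y)) := by
    filter_upwards [hf.continuousAt.preimage_mem_nhds (chart_source_mem hx)] with y hy
    rw [chartMetric_apply, ofCoord_toCoord hy, ofCoord_toCoord hy]
  have hg := mdifferentiableAt_chartMetric (I := I) hx
  have hgf : MDifferentiableAt J 𝓘(ℝ, E →L[ℝ] E →L[ℝ] ℝ) (fun y => chartMetric I (f x) (f y)) x :=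
    hg.comp x hf
  rw [mvfderiv_congr heq, mvfderiv_clm_apply (hgf.clm_apply hs') ht', mvfderiv_clm_apply hgf hs',
    mvfderiv_chain hg hf]
  simp only [add_apply, covAlong, coordDeriv, ContinuousLinearMap.comp_apply, inner_add_left,
    inner_add_right]
  have h1 := inner_christoffel_add (f x) (mfderiv J I f x u) (s x) (t x)
  have h2 : ∀ a : E, inner ℝ (ofCoord I (f x) (f x) a) (t x) =
      chartMetric I (f x) (f x) a (toCoord I (f x) (f x) (t x)) := fun a => by
    rw [chartMetric_apply, ofCoord_toCoord hx]
  have h3 : ∀ a : E, inner ℝ (s x) (ofCoord I (f x) (f x) a) =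
      chartMetric I (f x) (f x) (toCoord I (f x) (f x) (s x)) a := fun a => by
    rw [chartMetric_apply, ofCoord_toCoord hx]
  rw [h2, h3]
  linarith

/-- The covariant derivative along a map in terms of that of coordinate vector fields. -/
theorem covAlong_eq {f : L → M} {s : ∀ y, TangentSpace I (f y)} {x : L} {p : M}
    (hf : MDifferentiableAt J I f x) (hp : f x ∈ (chartAt H p).source)
    (hs : MDifferentiableAt J I.tangent (fun y => (⟨f y, s y⟩ : TangentBundle I M)) x)
    (u : TangentSpace J x) :
    covAlong I J f s x u =
      ofCoord I p (f x) (mvfderiv J (fun y => toCoord I p (f y) (s y)) x u) +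
      covAlong I I (fun z : M => z) (fun z => ofCoord I p z (toCoord I p (f x) (s x))) (f x)
        (mfderiv J I f x u) := by
  have hx := mem_chart_source H (f x)
  obtain ⟨hτ, -⟩ := exists_mvfderiv_transition (I := I) hp
  have hs' := (mdifferentiableAt_along_iff hf hp).1 hs
  have h1 : mvfderiv J (fun y => toCoord I (f x) (f y) (s y)) x u =
      mvfderiv I (fun z => toCoord I (f x) z ∘L ofCoord I p z) (f x) (mfderiv J I f x u)
        (toCoord I p (f x) (s x)) + toCoord I (f x) (f x) (ofCoord I p (f x)
          (mvfderiv J (fun y => toCoord I p (f y) (s y)) x u)) := by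
    have heq : (fun y => toCoord I (f x) (f y) (s y)) =ᶠ[𝓝 x] fun y =>
        (toCoord I (f x) (f y) ∘L ofCoord I p (f y)) (toCoord I p (f y) (s y)) := by
      filter_upwards [hf.continuousAt.preimage_mem_nhds (chart_source_mem hp)] with y hy
      rw [ContinuousLinearMap.comp_apply, ofCoord_toCoord hy]
    have hτf : MDifferentiableAt J 𝓘(ℝ, E →L[ℝ] E)
      (fun y => toCoord I (f x) (f y) ∘L ofCoord I p (f y)) x :=
        MDifferentiableAt.comp (g := fun z => toCoord I (f x) z ∘L ofCoord I p z) x hτ hf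
    rw [mvfderiv_congr heq, mvfderiv_clm_apply hτf hs',
      mvfderiv_chain (h := fun z => toCoord I (f x) z ∘L ofCoord I p z) hτ hf]
    rfl
  have h2 : mvfderiv I (fun z => toCoord I (f x) z (ofCoord I p z (toCoord I p (f x) (s x)))) (f x)
      (mfderiv J I f x u) = mvfderiv I (fun z => toCoord I (f x) z ∘L ofCoord I p z) (f x)
        (mfderiv J I f x u) (toCoord I p (f x) (s x)) := by
    rw [← mvfderiv_clm_const_apply hτ]
    rfl
  have h3 : mfderiv I I (fun z : M => z) (f x) (mfderiv J I f x u) = mfderiv J I f x u := by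
    have : mfderiv I I (fun z : M => z) (f x) = ContinuousLinearMap.id ℝ _ := mfderiv_id
    rw [this]; rfl
  simp only [covAlong, coordDeriv, add_apply, ContinuousLinearMap.comp_apply]
  rw [h3, h1, h2, map_add]
  have h4 := ofCoord_toCoord (I := I) hx (ofCoord I p (f x)
    (mvfderiv J (fun y => toCoord I p (f y) (s y)) x u))
  have h5 := ofCoord_toCoord (I := I) hp (s x)
  rw [h4, h5]
  abel

end MetricConnection

section Smoothness

variable {E' : Type*} [NormedAddCommGroup E'] [NormedSpace ℝ E']
  {H' : Type*} [TopologicalSpace H'] {J : ModelWithCorners ℝ E' H'}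
  {L : Type*} [TopologicalSpace L] [ChartedSpace H' L]
  {F : Type*} [NormedAddCommGroup F] [NormedSpace ℝ F]

/-- A map `w` is smooth if `B(w, c)` is for all constant `c`, where `B` is a smooth family of
nondegenerate bilinear forms. -/
theorem contMDiffAt_of_bilin [FiniteDimensional ℝ F] {B : L → F →L[ℝ] F →L[ℝ] ℝ} {w : L → F} {x : L}
    (hB : ContMDiffAt J 𝓘(ℝ, F →L[ℝ] F →L[ℝ] ℝ) ∞ B x)
    (hpos : ∀ᶠ y in 𝓝 x, ∀ b, B y b b = 0 → b = 0)
    (h : ∀ c, ContMDiffAt J 𝓘(ℝ) ∞ (fun y => B y (w y) c) x) :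
    ContMDiffAt J 𝓘(ℝ, F) ∞ w x := by
  have hequiv : ∀ y, (∀ b, B y b b = 0 → b = 0) →
      ∃ e : F ≃L[ℝ] (F →L[ℝ] ℝ), (e : F →L[ℝ] (F →L[ℝ] ℝ)) = B y := by
    intro y hy
    have hinj : Function.Injective (B y : F →ₗ[ℝ] (F →L[ℝ] ℝ)) := by
      rw [← LinearMap.ker_eq_bot, LinearMap.ker_eq_bot']
      intro b hb
      refine hy b ?_
      have : B y b = 0 := hb
      rw [this]; rfl
    have hdim : Module.finrank ℝ F = Module.finrank ℝ (F →L[ℝ] ℝ) := by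
      rw [← (LinearMap.toContinuousLinearMap (𝕜 := ℝ) (E := F) (F' := ℝ)).finrank_eq]
      exact (Subspace.dual_finrank_eq (K := ℝ) (V := F)).symm
    refine ⟨(LinearEquiv.ofInjectiveOfFinrankEq _ hinj hdim).toContinuousLinearEquiv, ?_⟩
    ext b
    rfl
  have hinv : ContMDiffAt J 𝓘(ℝ, (F →L[ℝ] ℝ) →L[ℝ] F) ∞
      (fun y => ContinuousLinearMap.inverse (B y)) x := by
    obtain ⟨e, he⟩ := hequiv x hpos.self_of_nhds
    have h1 : ContDiffAt ℝ ∞ (ContinuousLinearMap.inverse : (F →L[ℝ] (F →L[ℝ] ℝ)) → _) (B x) :=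
      he ▸ contDiffAt_map_inverse e
    exact h1.contMDiffAt.comp x hB
  have h2 : ContMDiffAt J 𝓘(ℝ, F →L[ℝ] ℝ) ∞ (fun y => B y (w y)) x := contMDiffAt_clm_of_apply h
  refine (hinv.clm_apply h2).congr_of_eventuallyEq ?_
  filter_upwards [hpos] with y hy
  obtain ⟨e, he⟩ := hequiv y hy
  rw [← he, ContinuousLinearMap.inverse_equiv]
  exact (e.symm_apply_apply (w y)).symm

variable [IsManifold J ∞ L] [FiniteDimensional ℝ E']

theorem contMDiffAt_mfderiv_apply {E : Type*} [NormedAddCommGroup E] [NormedSpace ℝ E]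
    [FiniteDimensional ℝ E]
    {H : Type*} [TopologicalSpace H] {I : ModelWithCorners ℝ E H}
    {M : Type*} [TopologicalSpace M] [ChartedSpace H M] [IsManifold I ∞ M]
    {f : L → M} {v : ∀ y : L, TangentSpace J y} {x : L}
    (hf : ContMDiffAt J I ∞ f x)
    (hv : ContMDiffAt J J.tangent ∞ (fun y => (⟨y, v y⟩ : TangentBundle J L)) x) :
    ContMDiffAt J I.tangent ∞ (fun y => (⟨f y, mfderiv J I f y (v y)⟩ : TangentBundle I M)) x := by
  rw [contMDiffAt_along_iff hf (mem_chart_source H (f x))]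
  have hv' := (contMDiffAt_along_iff (f := fun y : L => y) contMDiffAt_id
    (mem_chart_source H' x)).1 hv
  have h1 : ContMDiffAt J 𝓘(ℝ, E' →L[ℝ] E) ∞
    (inTangentCoordinates J I id f (mfderiv J I f) x) x := hf.mfderiv_const (by simp)
  refine (h1.clm_apply hv').congr_of_eventuallyEq ?_
  filter_upwards [chart_source_mem (mem_chart_source H' x)] with y hy
  have h2 : inTangentCoordinates J I id f (mfderiv J I f) x y =
    toCoord I (f x) (f y) ∘L mfderiv J I f y ∘L ofCoord J x y := rfl
  rw [h2]
  have h3 := ofCoord_toCoord (I := J) hy (v y)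
  simp only [ContinuousLinearMap.comp_apply]
  rw [h3]

theorem contMDiffAt_mvfderiv_apply [FiniteDimensional ℝ F] {h : L → F}
    {v : ∀ y : L, TangentSpace J y} {x : L} (hh : ContMDiffAt J 𝓘(ℝ, F) ∞ h x)
    (hv : ContMDiffAt J J.tangent ∞ (fun y => (⟨y, v y⟩ : TangentBundle J L)) x) :
    ContMDiffAt J 𝓘(ℝ, F) ∞ (fun y => mvfderiv J h y (v y)) x := by
  have h1 := (contMDiffAt_along_iff (I := 𝓘(ℝ, F)) hh (mem_chart_source F (h x))).1
    (contMDiffAt_mfderiv_apply hh hv)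
  refine h1.congr_of_eventuallyEq (Filter.Eventually.of_forall fun y => ?_)
  have h2 := TangentBundle.continuousLinearMapAt_model_space (𝕜 := ℝ) (h x) (h y)
  exact (DFunLike.congr_fun h2 (mfderiv J 𝓘(ℝ, F) h y (v y))).symm

end Smoothness

section Alternating

variable {E : Type*} [NormedAddCommGroup E] [NormedSpace ℝ E] [FiniteDimensional ℝ E]

/-- The product rule for a family of alternating forms with differentiable coefficients. -/
theorem hasDerivAt_alternating_family {m : ℕ} {g : ℝ → E [⋀^Fin m]→L[ℝ] ℝ}
    {g' : (Fin m → E) → ℝ} {c : ℝ → Fin m → E} {c' : Fin m → E} {t : ℝ}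
    (hg : ∀ b, HasDerivAt (fun s => g s b) (g' b) t)
    (hc : ∀ i, HasDerivAt (fun s => c s i) (c' i) t) :
    HasDerivAt (fun s => g s (c s))
      (g' (c t) + ∑ i, g t (Function.update (c t) i (c' i))) t := by
  let e := Module.finBasis ℝ E
  let φ : ∀ i, E →L[ℝ] ℝ := fun i => LinearMap.toContinuousLinearMap (e.coord i)
  let T : (Fin m → Fin (Module.finrank ℝ E)) → ContinuousMultilinearMap ℝ (fun _ : Fin m => E) ℝ :=
    fun r => (ContinuousMultilinearMap.mkPiAlgebra ℝ (Fin m) ℝ).compContinuousLinearMap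
      fun i => φ (r i)
  have hT : ∀ r b, T r b = ∏ i, e.repr (b i) (r i) := fun r b => by simp [T, φ]
  have hexp : ∀ (β : E [⋀^Fin m]→L[ℝ] ℝ) (b : Fin m → E),
      β b = ∑ r, β (fun i => e (r i)) * T r b := by
    intro β b
    calc β b = β.toMultilinearMap (fun i => ∑ k, e.repr (b i) k • e k) := by
            simp only [e.sum_repr]; rfl
      _ = _ := by
        rw [MultilinearMap.map_sum]
        refine Finset.sum_congr rfl fun r _ => ?_
        rw [MultilinearMap.map_smul_univ, hT, smul_eq_mul, mul_comm]
        rfl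
  have h1 : HasDerivAt (fun s => ∑ r, g s (fun i => e (r i)) * T r (c s))
      (∑ r, (g' (fun i => e (r i)) * T r (c t) + g t (fun i => e (r i)) *
        ∑ i, T r (Function.update (c t) i (c' i)))) t := by
    refine HasDerivAt.fun_sum fun r _ => (hg _).mul ?_
    have h2 := ((T r).hasFDerivAt (c t)).comp_hasDerivAt t (hasDerivAt_pi.2 hc)
    rw [ContinuousMultilinearMap.linearDeriv_apply] at h2
    exact h2
  have h3 : ∀ b, g' b = ∑ r, g' (fun i => e (r i)) * T r b := by
    intro b
    refine (hg b).unique ?_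
    have : (fun s => g s b) = fun s => ∑ r, g s (fun i => e (r i)) * T r b := by
      funext s; exact hexp _ _
    rw [this]
    exact HasDerivAt.fun_sum fun r _ => (hg _).mul_const _
  have h4 : (fun s => g s (c s)) = fun s => ∑ r, g s (fun i => e (r i)) * T r (c s) := by
    funext s; exact hexp _ _
  rw [h4]
  refine h1.congr_deriv ?_
  rw [Finset.sum_add_distrib, ← h3]
  congr 1
  simp only [hexp (g t) (Function.update _ _ _), Finset.mul_sum]
  exact Finset.sum_comm

end Alternating

section LeviCivita

variable {E : Type*} [NormedAddCommGroup E] [NormedSpace ℝ E] [FiniteDimensional ℝ E]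
  {H : Type*} [TopologicalSpace H] {I : ModelWithCorners ℝ E H}
  {M : Type*} [TopologicalSpace M] [ChartedSpace H M] [IsManifold I ∞ M]
  [RiemannianBundle (fun x : M => TangentSpace I x)]
  {E' : Type*} [NormedAddCommGroup E'] [NormedSpace ℝ E']
  {H' : Type*} [TopologicalSpace H'] {J : ModelWithCorners ℝ E' H'}
  {L : Type*} [TopologicalSpace L] [ChartedSpace H' L]

theorem covAlong_zero {f : L → M} (x : L) :
    covAlong I J f (fun y => (0 : TangentSpace I (f y))) x = 0 := by
  unfold covAlong coordDeriv christoffel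
  have h := koszulMap_smul ((trivializationAt E (TangentSpace I) (f x)).continuousLinearMapAt ℝ
    (f x)) (mvfderiv I (chartMetric I (f x)) (f x)) 0 0
  rw [zero_smul, zero_smul] at h
  simp only [map_zero]
  rw [mvfderiv_const, h]
  simp

variable [IsContMDiffRiemannianBundle I ∞ E (fun x : M => TangentSpace I x)] [I.Boundaryless]

theorem covAlong_coord_comm {p q : M} (hq : q ∈ (chartAt H p).source) (a b : E) :
    covAlong I I (fun z : M => z) (fun z => ofCoord I p z b) q (ofCoord I p q a) =
      covAlong I I (fun z : M => z) (fun z => ofCoord I p z a) q (ofCoord I p q b) := by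
  obtain ⟨hτ, hsymm⟩ := exists_mvfderiv_transition (I := I) hq
  have h2 : ∀ b w, mvfderiv I (fun z => toCoord I q z (ofCoord I p z b)) q w =
      mvfderiv I (fun z => toCoord I q z ∘L ofCoord I p z) q w b := by
    intro b w
    rw [← mvfderiv_clm_const_apply hτ]
    rfl
  have h3 : ∀ w : TangentSpace I q, mfderiv I I (fun z : M => z) q w = w := by
    have : mfderiv I I (fun z : M => z) q = ContinuousLinearMap.id ℝ _ := mfderiv_id
    intro w
    rw [this]; rfl
  simp only [covAlong, coordDeriv, add_apply, ContinuousLinearMap.comp_apply]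
  rw [h3, h3, h2, h2, hsymm, christoffel_comm]

/-- The Koszul formula for coordinate vector fields. -/
theorem inner_covAlong_coord {p q : M} (hq : q ∈ (chartAt H p).source) (a b c : E) :
    inner ℝ (covAlong I I (fun z : M => z) (fun z => ofCoord I p z b) q (ofCoord I p q a))
        (ofCoord I p q c) =
      (mvfderiv I (chartMetric I p) q (ofCoord I p q a) b c +
        mvfderiv I (chartMetric I p) q (ofCoord I p q b) a c -
        mvfderiv I (chartMetric I p) q (ofCoord I p q c) a b) / 2 := by
  have hd : ∀ a b c : E, mvfderiv I (chartMetric I p) q (ofCoord I p q a) b c =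
      inner ℝ (covAlong I I (fun z : M => z) (fun z => ofCoord I p z b) q (ofCoord I p q a))
        (ofCoord I p q c) + inner ℝ (ofCoord I p q b)
        (covAlong I I (fun z : M => z) (fun z => ofCoord I p z c) q (ofCoord I p q a)) := by
    intro a b c
    rw [mvfderiv_chartMetric_apply hq]
    exact mvfderiv_inner (f := fun z : M => z) mdifferentiableAt_id
      (mdifferentiableAt_ofCoord (f := fun z : M => z) mdifferentiableAt_id hq
        mdifferentiableAt_const)
      (mdifferentiableAt_ofCoord (f := fun z : M => z) mdifferentiableAt_id hq
        mdifferentiableAt_const) _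
  rw [hd, hd, hd, covAlong_coord_comm hq b a, covAlong_coord_comm hq c a,
    covAlong_coord_comm hq c b, real_inner_comm (ofCoord I p q b)]
  ring

end LeviCivita

section LeviCivita

variable {E : Type*} [NormedAddCommGroup E] [NormedSpace ℝ E] [FiniteDimensional ℝ E]
  {H : Type*} [TopologicalSpace H] {I : ModelWithCorners ℝ E H}
  {M : Type*} [TopologicalSpace M] [ChartedSpace H M] [IsManifold I ∞ M]
  [RiemannianBundle (fun x : M => TangentSpace I x)]
  [IsContMDiffRiemannianBundle I ∞ E (fun x : M => TangentSpace I x)] [I.Boundaryless]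
  {E' : Type*} [NormedAddCommGroup E'] [NormedSpace ℝ E']
  {H' : Type*} [TopologicalSpace H'] {J : ModelWithCorners ℝ E' H'}
  {L : Type*} [TopologicalSpace L] [ChartedSpace H' L] [IsManifold J ∞ L] [J.Boundaryless]

theorem eq_zero_of_chartMetric_self {p q : M} (hq : q ∈ (chartAt H p).source) {b : E}
    (h : chartMetric I p q b b = 0) : b = 0 := by
  rw [chartMetric_apply, inner_self_eq_zero] at h
  rw [← toCoord_ofCoord (I := I) hq b, h, map_zero]

theorem eventually_mdifferentiableAt {F H₁ M₁ : Type*} [NormedAddCommGroup F]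
    [NormedSpace ℝ F] [TopologicalSpace H₁] {I₁ : ModelWithCorners ℝ F H₁} [TopologicalSpace M₁]
    [ChartedSpace H₁ M₁] [IsManifold I₁ 1 M₁] {f : L → M₁} {x : L} (hf : ContMDiffAt J I₁ ∞ f x) :
    ∀ᶠ y in 𝓝 x, MDifferentiableAt J I₁ f y := by
  have : IsManifold J 1 L := IsManifold.of_le (n := ∞) (by simp)
  filter_upwards [(contMDiffAt_iff_contMDiffAt_nhds (by simp)).1 (hf.of_le (m := 1) (by simp))]
    with y hy
  exact hy.mdifferentiableAt (by simp)

set_option maxSynthPendingDepth 3 in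
/-- The Levi-Civita derivative of a smooth section is smooth. -/
theorem contMDiffAt_covAlong [FiniteDimensional ℝ E'] {f : L → M} {s : ∀ y, TangentSpace I (f y)}
    {v : ∀ y : L, TangentSpace J y} {x : L}
    (hf : ContMDiffAt J I ∞ f x)
    (hs : ContMDiffAt J I.tangent ∞ (fun y => (⟨f y, s y⟩ : TangentBundle I M)) x)
    (hv : ContMDiffAt J J.tangent ∞ (fun y => (⟨y, v y⟩ : TangentBundle J L)) x) :
    ContMDiffAt J I.tangent ∞
      (fun y => (⟨f y, covAlong I J f s y (v y)⟩ : TangentBundle I M)) x := by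
  have hx := mem_chart_source H (f x)
  set p := f x with hp
  have hs' := (contMDiffAt_along_iff hf hx).1 hs
  have hg : ContMDiffAt J 𝓘(ℝ, E →L[ℝ] E →L[ℝ] ℝ) ∞ (fun y => chartMetric I p (f y)) x :=
    (contMDiffAt_chartMetric hx).comp x hf
  have hD : ContMDiffAt I 𝓘(ℝ, E →L[ℝ] E →L[ℝ] E →L[ℝ] ℝ) ∞
      (fun z => (mvfderiv I (chartMetric I p) z ∘L ofCoord I p z : E →L[ℝ] E →L[ℝ] E →L[ℝ] ℝ))
      (f x) :=
    contMDiffAt_clm_of_apply fun a => contMDiffAt_mvfderiv_apply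
      (v := fun z => ofCoord I p z a) (contMDiffAt_chartMetric hx)
      (contMDiffAt_ofCoord (f := fun z : M => z) contMDiffAt_id hx contMDiffAt_const)
  have hDf : ContMDiffAt J 𝓘(ℝ, E →L[ℝ] E →L[ℝ] E →L[ℝ] ℝ) ∞
      (fun y => (mvfderiv I (chartMetric I p) (f y) ∘L ofCoord I p (f y) :
        E →L[ℝ] E →L[ℝ] E →L[ℝ] ℝ)) x := ContMDiffAt.comp (g := fun z =>
          (mvfderiv I (chartMetric I p) z ∘L ofCoord I p z : E →L[ℝ] E →L[ℝ] E →L[ℝ] ℝ)) x hD hf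
  have ha := (contMDiffAt_along_iff hf hx).1 (contMDiffAt_mfderiv_apply hf hv)
  have hds : ContMDiffAt J 𝓘(ℝ, E) ∞
      (fun y => mvfderiv J (fun y => toCoord I p (f y) (s y)) y (v y)) x :=
    contMDiffAt_mvfderiv_apply hs' hv
  rw [contMDiffAt_along_iff hf hx]
  have hsource : ∀ᶠ y in 𝓝 x, f y ∈ (chartAt H p).source :=
    hf.continuousAt.preimage_mem_nhds (chart_source_mem hx)
  refine contMDiffAt_of_bilin hg (hsource.mono fun y hy b hb => eq_zero_of_chartMetric_self hy hb)
    fun c => ?_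
  have hc : ContMDiffAt J 𝓘(ℝ, E) ∞ (fun _ : L => c) x := contMDiffAt_const
  have hmain := ((hg.clm_apply hds).clm_apply hc).add
    ((((((hDf.clm_apply ha).clm_apply hs').clm_apply hc).add
      (((hDf.clm_apply hs').clm_apply ha).clm_apply hc)).sub
      (((hDf.clm_apply hc).clm_apply ha).clm_apply hs')).mul
      (contMDiffAt_const (c := (1 / 2 : ℝ))))
  refine hmain.congr_of_eventuallyEq ?_
  filter_upwards [hsource, eventually_mdifferentiableAt hf,
    eventually_mdifferentiableAt hs] with y hy hfy hsy
  rw [chartMetric_apply, ofCoord_toCoord hy, covAlong_eq hfy hy hsy, inner_add_left]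
  have h1 := inner_covAlong_coord (I := I) hy (toCoord I p (f y) (mfderiv J I f y (v y)))
    (toCoord I p (f y) (s y)) c
  rw [ofCoord_toCoord hy] at h1
  rw [h1]
  simp only [Pi.add_apply, Pi.mul_apply, ContinuousLinearMap.comp_apply,
    chartMetric_apply, ofCoord_toCoord hy]
  ring

/-- Parallel forms are constant along parallel sections along a map. -/
theorem hasDerivAt_parallelForm {m : ℕ} {β : ∀ x : M, TangentSpace I x [⋀^Fin m]→L[ℝ] ℝ}
    (hβ : IsSmoothForm I β) (hβ' : IsParallelForm I β) {f : L → M}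
    {s : Fin m → ∀ y, TangentSpace I (f y)} {γ : ℝ → L} {t : ℝ}
    (hγ : MDifferentiableAt 𝓘(ℝ, ℝ) J γ t) (hf : MDifferentiableAt J I f (γ t))
    (hs : ∀ i, MDifferentiableAt J I.tangent (fun y => (⟨f y, s i y⟩ : TangentBundle I M)) (γ t)) :
    HasDerivAt (fun r => β (f (γ r)) (fun i => s i (γ r)))
      (∑ i, β (f (γ t)) (Function.update (fun j => s j (γ t)) i
        (covAlong I J f (s i) (γ t) (mfderiv 𝓘(ℝ, ℝ) J γ t (1 : ℝ))))) t := by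
  set u : TangentSpace J (γ t) := mfderiv 𝓘(ℝ, ℝ) J γ t (1 : ℝ) with hu
  have hp := mem_chart_source H (f (γ t))
  set p := f (γ t) with hpdef
  let g : ℝ → E [⋀^Fin m]→L[ℝ] ℝ := fun r =>
    (β (f (γ r))).compContinuousLinearMap (ofCoord I p (f (γ r)))
  have hgb : ∀ b, HasDerivAt (fun r => g r b) (∑ i, β p (Function.update
      (fun j => ofCoord I p p (b j)) i (covAlong I I (fun z : M => z) (fun z => ofCoord I p z (b i)) p
        (mfderiv J I f (γ t) u)))) t := by
    intro b
    have hd : MDifferentiableAt I 𝓘(ℝ) (fun z => β z (fun i => ofCoord I p z (b i))) (f (γ t)) :=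
      ((hβ p b).contMDiffAt (chart_source_mem hp)).mdifferentiableAt (by simp)
    have h1 := hasDerivAt_comp_curve hγ (MDifferentiableAt.comp (g := fun z =>
      β z (fun i => ofCoord I p z (b i))) (γ t) hd hf)
    have h2 := mvfderiv_chain hd hf u
    rw [hβ' (f (γ t)) (fun i z => ofCoord I p z (b i)) (fun i => mdifferentiableAt_ofCoord
      (f := fun z : M => z) mdifferentiableAt_id hp mdifferentiableAt_const)] at h2
    rw [← h2]
    exact h1
  have hc : ∀ i, HasDerivAt (fun r => toCoord I p (f (γ r)) (s i (γ r)))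
      (mvfderiv J (fun y => toCoord I p (f y) (s i y)) (γ t) u) t := by
    intro i
    exact hasDerivAt_comp_curve hγ ((mdifferentiableAt_along_iff hf hp).1 (hs i))
  have h := hasDerivAt_alternating_family hgb hc
  have heq : (fun r => β (f (γ r)) (fun i => s i (γ r))) =ᶠ[𝓝 t]
      fun r => g r (fun i => toCoord I p (f (γ r)) (s i (γ r))) := by
    have hcont : ContinuousAt (fun r => f (γ r)) t :=
      ContinuousAt.comp (g := f) hf.continuousAt hγ.continuousAt
    filter_upwards [hcont.preimage_mem_nhds (chart_source_mem hp)] with r hr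
    change _ = β (f (γ r)) (fun i => ofCoord I p (f (γ r)) (toCoord I p (f (γ r)) (s i (γ r))))
    congr 1
    funext i
    exact (ofCoord_toCoord hr _).symm
  refine (h.congr_of_eventuallyEq heq).congr_deriv ?_
  rw [← Finset.sum_add_distrib]
  refine Finset.sum_congr rfl fun i _ => ?_
  have hback : (fun j => ofCoord I p p (toCoord I p p (s j (γ t)))) = fun j => s j (γ t) := by
    funext j
    exact ofCoord_toCoord hp _
  have hg : ∀ (b : Fin m → E) (b' : E), g t (Function.update b i b') =
      β p (Function.update (fun j => ofCoord I p p (b j)) i (ofCoord I p p b')) := by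
    intro b b'
    change β p (fun j => ofCoord I p p (Function.update b i b' j)) = _
    congr 1
    funext j
    by_cases hj : j = i
    · subst hj; simp
    · simp [hj]
  rw [covAlong_eq hf hp (hs i), ContinuousAlternatingMap.map_update_add, hg, hback, add_comm]

end LeviCivita

section Interval

theorem eventually_eq_of_hasDerivAt_zero {F : Type*} [NormedAddCommGroup F] [NormedSpace ℝ F]
    {ε : ℝ} {h : ℝ → F} (hh : ∀ t ∈ Set.Ioo (-ε) ε, HasDerivAt h 0 t) {t : ℝ}
    (ht : t ∈ Set.Ioo (-ε) ε) : h t = h 0 := by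
  have h0 : (0 : ℝ) ∈ Set.Ioo (-ε) ε := by
    constructor <;> linarith [ht.1, ht.2]
  refine isOpen_Ioo.is_const_of_fderiv_eq_zero (𝕜 := ℝ) isPreconnected_Ioo
    (fun s hs => (hh s hs).differentiableAt.differentiableWithinAt) (fun s hs => ?_) ht h0
  rw [(hh s hs).hasFDerivAt.fderiv]
  simp

/-- Local existence for linear differential equations. -/
theorem exists_linear_ode {F : Type*} [NormedAddCommGroup F] [NormedSpace ℝ F] [CompleteSpace F]
    {a : ℝ → F →L[ℝ] F} (ha : ContDiffAt ℝ 1 a 0) :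
    ∃ Y : ℝ → F →L[ℝ] F, Y 0 = ContinuousLinearMap.id ℝ F ∧
      ∀ᶠ t in 𝓝 (0 : ℝ), HasDerivAt Y (-(a t ∘L Y t)) t := by
  let X : ℝ × (F →L[ℝ] F) → ℝ × (F →L[ℝ] F) := fun q => (1, -(a q.1 ∘L q.2))
  have hX : ContDiffAt ℝ 1 X ((0 : ℝ), ContinuousLinearMap.id ℝ F) := by
    refine contDiffAt_const.prodMk (ContDiffAt.neg ?_)
    have h1 : ContDiffAt ℝ 1 (fun q : ℝ × (F →L[ℝ] F) => a q.1) (0, ContinuousLinearMap.id ℝ F) :=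
      ContDiffAt.comp (g := a) _ ha contDiffAt_fst
    exact h1.clm_comp contDiffAt_snd
  obtain ⟨y, hy0, ε, hε, hy⟩ :=
    hX.exists_forall_mem_closedBall_exists_eq_forall_mem_Ioo_hasDerivAt₀ 0
  rw [zero_sub, zero_add] at hy
  have hfst : ∀ t ∈ Set.Ioo (-ε) ε, (y t).1 = t := by
    intro t ht
    have h1 : ∀ s ∈ Set.Ioo (-ε) ε, HasDerivAt (fun s => (y s).1 - s) 0 s := fun s hs =>
      (((hasFDerivAt_fst (𝕜 := ℝ) (p := y s)).comp_hasDerivAt s (hy s hs)).sub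
        (hasDerivAt_id s)).congr_deriv (by simp [X])
    have := eventually_eq_of_hasDerivAt_zero h1 ht
    rw [hy0] at this
    simpa [sub_eq_zero] using this
  refine ⟨fun t => (y t).2, by simp [hy0], ?_⟩
  filter_upwards [Ioo_mem_nhds (neg_lt_zero.2 hε) hε] with t ht
  have h1 := (hasFDerivAt_snd (𝕜 := ℝ) (p := y t)).comp_hasDerivAt t (hy t ht)
  simp only [X, hfst t ht] at h1
  exact h1

end Interval

section Transport

variable {E : Type*} [NormedAddCommGroup E] [NormedSpace ℝ E] [FiniteDimensional ℝ E]
  {H : Type*} [TopologicalSpace H] {I : ModelWithCorners ℝ E H}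
  {M : Type*} [TopologicalSpace M] [ChartedSpace H M] [IsManifold I ∞ M]
  [RiemannianBundle (fun x : M => TangentSpace I x)]
  [IsContMDiffRiemannianBundle I ∞ E (fun x : M => TangentSpace I x)] [I.Boundaryless]

theorem contMDiffAt_unitField (t : ℝ) :
    ContMDiffAt 𝓘(ℝ, ℝ) 𝓘(ℝ, ℝ).tangent ∞
      (fun r : ℝ => (⟨r, (1 : ℝ)⟩ : TangentBundle 𝓘(ℝ, ℝ) ℝ)) t := by
  refine (contMDiffAt_along_iff (f := fun r : ℝ => r) (s := fun _ => (1 : ℝ)) contMDiffAt_id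
    (mem_chart_source ℝ t)).2 ?_
  refine (contMDiffAt_const (c := (1 : ℝ))).congr_of_eventuallyEq
    (Filter.Eventually.of_forall fun r => ?_)
  have h2 := TangentBundle.continuousLinearMapAt_model_space (𝕜 := ℝ) t r
  exact DFunLike.congr_fun h2 (1 : ℝ)

theorem mvfderiv_real {F : Type*} [NormedAddCommGroup F] [NormedSpace ℝ F] {h : ℝ → F} {h' : F}
    {t : ℝ} (hh : HasDerivAt h h' t) : mvfderiv 𝓘(ℝ, ℝ) h t (1 : ℝ) = h' := by
  have h1 : fderiv ℝ h t (1 : ℝ) = h' := fderiv_apply_one_eq_deriv.trans hh.deriv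
  unfold mvfderiv
  rw [mfderiv_eq_fderiv]
  exact h1

theorem hasDerivAt_of_mdifferentiableAt {F : Type*} [NormedAddCommGroup F] [NormedSpace ℝ F]
    {h : ℝ → F} {t : ℝ} (hh : MDifferentiableAt 𝓘(ℝ, ℝ) 𝓘(ℝ, F) h t) :
    HasDerivAt h (mvfderiv 𝓘(ℝ, ℝ) h t (1 : ℝ)) t := by
  have h1 := (mdifferentiableAt_iff_differentiableAt.1 hh).hasDerivAt
  rwa [mvfderiv_real h1]

/-- Parallel transport along a curve exists for small times. -/
theorem exists_parallelTransport {f : ℝ → M} (hf : ContMDiffAt 𝓘(ℝ, ℝ) I ∞ f 0) :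
    ∃ P : ∀ t, TangentSpace I (f 0) →L[ℝ] TangentSpace I (f t),
      P 0 = ContinuousLinearMap.id ℝ _ ∧ ∀ᶠ t in 𝓝 (0 : ℝ), MDifferentiableAt 𝓘(ℝ, ℝ) I f t ∧
        ∀ v, MDifferentiableAt 𝓘(ℝ, ℝ) I.tangent (fun r => (⟨f r, P r v⟩ : TangentBundle I M)) t ∧
          covAlong I 𝓘(ℝ, ℝ) f (fun r => P r v) t (1 : ℝ) = 0 := by
  have hp := mem_chart_source H (f 0)
  set p := f 0 with hpdef
  have hgood : ∀ᶠ t in 𝓝 (0 : ℝ), f t ∈ (chartAt H p).source ∧ MDifferentiableAt 𝓘(ℝ, ℝ) I f t :=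
    Filter.Eventually.and (hf.continuousAt.preimage_mem_nhds (chart_source_mem hp))
      (eventually_mdifferentiableAt hf)
  have hA : ∀ t, ∃ A : E →L[ℝ] E, f t ∈ (chartAt H p).source ∧ MDifferentiableAt 𝓘(ℝ, ℝ) I f t →
      ∀ b, A b = toCoord I p (f t)
        (covAlong I 𝓘(ℝ, ℝ) f (fun r => ofCoord I p (f r) b) t (1 : ℝ)) := by
    intro t
    by_cases ht : f t ∈ (chartAt H p).source ∧ MDifferentiableAt 𝓘(ℝ, ℝ) I f t
    · have hd : ∀ b : E, MDifferentiableAt 𝓘(ℝ, ℝ) I.tangent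
          (fun r => (⟨f r, ofCoord I p (f r) b⟩ : TangentBundle I M)) t := fun b =>
        mdifferentiableAt_ofCoord ht.2 ht.1 mdifferentiableAt_const
      refine ⟨LinearMap.toContinuousLinearMap
        { toFun := fun b => toCoord I p (f t)
            (covAlong I 𝓘(ℝ, ℝ) f (fun r => ofCoord I p (f r) b) t (1 : ℝ))
          map_add' := fun b c => ?_
          map_smul' := fun a b => ?_ }, fun _ b => rfl⟩
      · have h1 := covAlong_add I 𝓘(ℝ, ℝ) ht.2.continuousAt (hd b) (hd c)
        simp only [← map_add] at h1
        exact (congrArg (toCoord I p (f t)) (DFunLike.congr_fun h1 (1 : ℝ))).trans (map_add _ _ _)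
      · have h1 := covAlong_smul I 𝓘(ℝ, ℝ) a ht.2.continuousAt (hd b)
        simp only [← map_smul] at h1
        exact (congrArg (toCoord I p (f t)) (DFunLike.congr_fun h1 (1 : ℝ))).trans
          (map_smul _ _ _)
    · exact ⟨0, fun h => absurd h ht⟩
  choose a ha using hA
  have hsm : ContMDiffAt 𝓘(ℝ, ℝ) 𝓘(ℝ, E →L[ℝ] E) ∞ a 0 := by
    refine contMDiffAt_clm_of_apply fun b => ?_
    have h1 := (contMDiffAt_along_iff hf hp).1 (contMDiffAt_covAlong (v := fun _ => (1 : ℝ)) hf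
      (contMDiffAt_ofCoord hf hp (contMDiffAt_const (c := b))) (contMDiffAt_unitField 0))
    exact h1.congr_of_eventuallyEq (hgood.mono fun t ht => ha t ht b)
  obtain ⟨Y, hY0, hY⟩ := exists_linear_ode (contMDiffAt_iff_contDiffAt.1 hsm |>.of_le (by simp))
  refine ⟨fun t => ofCoord I p (f t) ∘L Y t ∘L toCoord I p (f 0), ?_, ?_⟩
  · change ofCoord I p (f 0) ∘L Y 0 ∘L toCoord I p (f 0) = _
    rw [hY0]
    ext v
    exact ofCoord_toCoord hp v
  have hev : ∀ᶠ t in 𝓝 (0 : ℝ), ∀ᶠ r in 𝓝 t, f r ∈ (chartAt H p).source :=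
    (hgood.mono fun t ht => ht.1).eventually_nhds
  filter_upwards [hgood, hY, hev] with t ht hYt hevt
  refine ⟨ht.2, fun v => ?_⟩
  have hder : HasDerivAt (fun r => Y r (toCoord I p (f 0) v))
      (-(a t (Y t (toCoord I p (f 0) v)))) t :=
    (hYt.clm_apply (hasDerivAt_const t (toCoord I p (f 0) v))).congr_deriv (by simp)
  have hd : MDifferentiableAt 𝓘(ℝ, ℝ) I.tangent (fun r =>
      (⟨f r, ofCoord I p (f r) (Y r (toCoord I p (f 0) v))⟩ : TangentBundle I M)) t :=
    mdifferentiableAt_ofCoord ht.2 ht.1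
      (mdifferentiableAt_iff_differentiableAt.2 hder.differentiableAt)
  refine ⟨hd, ?_⟩
  have h1 := covAlong_eq ht.2 ht.1 hd (1 : ℝ)
  have h2 := covAlong_eq (s := fun r => ofCoord I p (f r) (Y t (toCoord I p (f 0) v))) ht.2 ht.1
    (mdifferentiableAt_ofCoord ht.2 ht.1 mdifferentiableAt_const) (1 : ℝ)
  have h3 : mvfderiv 𝓘(ℝ, ℝ)
      (fun r => toCoord I p (f r) (ofCoord I p (f r) (Y r (toCoord I p (f 0) v)))) t (1 : ℝ) =
      -(a t (Y t (toCoord I p (f 0) v))) := by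
    have heq : (fun r => toCoord I p (f r) (ofCoord I p (f r) (Y r (toCoord I p (f 0) v)))) =ᶠ[𝓝 t]
        fun r => Y r (toCoord I p (f 0) v) := hevt.mono fun r hr => toCoord_ofCoord hr _
    rw [mvfderiv_congr heq, mvfderiv_real hder]
  have h4 : mvfderiv 𝓘(ℝ, ℝ)
      (fun r => toCoord I p (f r) (ofCoord I p (f r) (Y t (toCoord I p (f 0) v)))) t (1 : ℝ) =
      0 := by
    have heq : (fun r => toCoord I p (f r) (ofCoord I p (f r) (Y t (toCoord I p (f 0) v)))) =ᶠ[𝓝 t]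
        fun _ => Y t (toCoord I p (f 0) v) := hevt.mono fun r hr => toCoord_ofCoord hr _
    rw [mvfderiv_congr heq, mvfderiv_const]
    rfl
  rw [h4, map_zero, zero_add] at h2
  have h5 := ha t ht (Y t (toCoord I p (f 0) v))
  rw [h2] at h5
  rw [h3, h5, map_neg, ofCoord_toCoord ht.1] at h1
  exact h1.trans (neg_add_cancel _)

end Transport

section Submanifold

variable {E : Type*} [NormedAddCommGroup E] [NormedSpace ℝ E] [FiniteDimensional ℝ E]
  {H : Type*} [TopologicalSpace H] {I : ModelWithCorners ℝ E H}
  {M : Type*} [TopologicalSpace M] [ChartedSpace H M] [IsManifold I ∞ M]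
  [RiemannianBundle (fun x : M => TangentSpace I x)]
  [IsContMDiffRiemannianBundle I ∞ E (fun x : M => TangentSpace I x)] [I.Boundaryless]
  {E' : Type*} [NormedAddCommGroup E'] [NormedSpace ℝ E'] [FiniteDimensional ℝ E']
  {H' : Type*} [TopologicalSpace H'] {J : ModelWithCorners ℝ E' H'}
  {L : Type*} [TopologicalSpace L] [ChartedSpace H' L] [IsManifold J ∞ L] [J.Boundaryless]
  {ι : L → M}

variable (I J) in
/-- The section `s` of `f^* TM` is smooth at `x`. -/
abbrev SmoothAt (f : L → M) (s : ∀ y, TangentSpace I (f y)) (x : L) : Prop :=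
  ContMDiffAt J I.tangent ∞ (fun y => (⟨f y, s y⟩ : TangentBundle I M)) x

theorem SmoothAt.mdifferentiableAt {f : L → M} {s : ∀ y, TangentSpace I (f y)} {x : L}
    (hs : SmoothAt I J f s x) :
    MDifferentiableAt J I.tangent (fun y => (⟨f y, s y⟩ : TangentBundle I M)) x :=
  ContMDiffAt.mdifferentiableAt hs (by simp)

theorem SmoothAt.congr {f : L → M} {s t : ∀ y, TangentSpace I (f y)} {x : L}
    (hs : SmoothAt I J f s x) (h : ∀ᶠ y in 𝓝 x, s y = t y) : SmoothAt I J f t x :=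
  ContMDiffAt.congr_of_eventuallyEq hs (h.mono fun y hy => by
    change (⟨f y, t y⟩ : TangentBundle I M) = ⟨f y, s y⟩
    rw [hy])

theorem SmoothAt.sub {f : L → M} {s t : ∀ y, TangentSpace I (f y)} {x : L}
    (hf : ContMDiffAt J I ∞ f x) (hs : SmoothAt I J f s x) (ht : SmoothAt I J f t x) :
    SmoothAt I J f (fun y => s y - t y) x := by
  have hx := mem_chart_source H (f x)
  refine (contMDiffAt_along_iff hf hx).2 ?_
  simp only [map_sub]
  exact ContMDiffAt.sub ((contMDiffAt_along_iff hf hx).1 hs) ((contMDiffAt_along_iff hf hx).1 ht)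

theorem exists_eventually_smoothAt {f : L → M} (hf : ContMDiff J I ∞ f) {x : L}
    (a : TangentSpace I (f x)) :
    ∃ s : ∀ y, TangentSpace I (f y), (∀ᶠ y in 𝓝 x, SmoothAt I J f s y) ∧ s x = a := by
  refine ⟨fun y => ofCoord I (f x) (f y) (toCoord I (f x) (f x) a), ?_,
    ofCoord_toCoord (mem_chart_source H (f x)) a⟩
  filter_upwards [hf.continuous.continuousAt.preimage_mem_nhds
    (chart_source_mem (mem_chart_source H (f x)))] with y hy
  exact contMDiffAt_ofCoord (hf y) hy contMDiffAt_const

theorem smoothAt_constExt (x : L) (v : TangentSpace J x) :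
    SmoothAt J J (fun y : L => y) (constExt J x v) x :=
  contMDiffAt_ofCoord (f := fun y : L => y) contMDiffAt_id (mem_chart_source H' x) contMDiffAt_const

/-- Covariant differentiation along a curve in the source. -/
theorem covAlong_comp_curve {f : L → M} {s : ∀ y, TangentSpace I (f y)} {γ : ℝ → L} {t : ℝ}
    (hγ : MDifferentiableAt 𝓘(ℝ, ℝ) J γ t) (hf : MDifferentiableAt J I f (γ t))
    (hs : MDifferentiableAt J I.tangent (fun y => (⟨f y, s y⟩ : TangentBundle I M)) (γ t)) :
    covAlong I 𝓘(ℝ, ℝ) (fun r => f (γ r)) (fun r => s (γ r)) t (1 : ℝ) =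
      covAlong I J f s (γ t) (mfderiv 𝓘(ℝ, ℝ) J γ t (1 : ℝ)) := by
  have hx := mem_chart_source H (f (γ t))
  have h1 := mvfderiv_chain ((mdifferentiableAt_along_iff hf hx).1 hs) hγ (1 : ℝ)
  have h2 := mfderiv_comp_apply t hf hγ (1 : ℝ)
  have h3 : mfderiv 𝓘(ℝ, ℝ) I (fun r => f (γ r)) t (1 : ℝ) =
      mfderiv J I f (γ t) (mfderiv 𝓘(ℝ, ℝ) J γ t (1 : ℝ)) := h2
  exact congrArg₂ (fun a b => ofCoord I (f (γ t)) (f (γ t)) a + christoffel I (f (γ t)) (s (γ t)) b)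
    h1 h3

namespace IsSmoothImmersion

theorem mfderiv_mem_tanPlane (x : L) (v : TangentSpace J x) :
    mfderiv J I ι x v ∈ tanPlane I J ι x := ⟨v, rfl⟩

theorem mfderiv_tanPart (hι : IsSmoothImmersion I J ι) (x : L) (a : TangentSpace I (ι x)) :
    mfderiv J I ι x (hι.tanPart x a) = (tanPlane I J ι x).starProjection a := by
  have h := LinearEquiv.apply_symm_apply (hι.tanEquiv x)
    ((tanPlane I J ι x).orthogonalProjectionOnto a)
  exact congrArg Subtype.val h

theorem mfderiv_tanPart_of_mem (hι : IsSmoothImmersion I J ι) {x : L} {a : TangentSpace I (ι x)}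
    (ha : a ∈ tanPlane I J ι x) : mfderiv J I ι x (hι.tanPart x a) = a := by
  rw [mfderiv_tanPart, Submodule.starProjection_eq_self_iff.2 ha]

theorem tanPart_eq_zero (hι : IsSmoothImmersion I J ι) {x : L} {a : TangentSpace I (ι x)}
    (ha : a ∈ (tanPlane I J ι x)ᗮ) : hι.tanPart x a = 0 := by
  apply hι.injective x
  rw [mfderiv_tanPart, (Submodule.starProjection_apply_eq_zero_iff _).2 ha, map_zero]

theorem projN_eq (hι : IsSmoothImmersion I J ι) (x : L) (a : TangentSpace I (ι x)) :
    projN I J ι x a = a - mfderiv J I ι x (hι.tanPart x a) := by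
  rw [mfderiv_tanPart]
  exact Submodule.starProjection_orthogonal_val a

theorem projN_mem (x : L) (a : TangentSpace I (ι x)) : projN I J ι x a ∈ (tanPlane I J ι x)ᗮ :=
  Submodule.starProjection_apply_mem _ _

theorem projN_of_mem {x : L} {a : TangentSpace I (ι x)} (ha : a ∈ (tanPlane I J ι x)ᗮ) :
    projN I J ι x a = a := Submodule.starProjection_eq_self_iff.2 ha

theorem projN_eq_zero {x : L} {a : TangentSpace I (ι x)} (ha : a ∈ tanPlane I J ι x) :
    projN I J ι x a = 0 :=
  (Submodule.starProjection_apply_eq_zero_iff _).2 (Submodule.le_orthogonal_orthogonal _ ha)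

theorem inner_mfderiv_of_mem_orthogonal {x : L} (v : TangentSpace J x) {a : TangentSpace I (ι x)}
    (ha : a ∈ (tanPlane I J ι x)ᗮ) : inner ℝ (mfderiv J I ι x v) a = 0 :=
  (Submodule.mem_orthogonal _ _).1 ha _ (mfderiv_mem_tanPlane x v)

theorem inner_mfderiv_tanPart (hι : IsSmoothImmersion I J ι) (x : L) (v : TangentSpace J x)
    (a : TangentSpace I (ι x)) :
    inner ℝ (mfderiv J I ι x (hι.tanPart x a)) (mfderiv J I ι x v) =
      inner ℝ a (mfderiv J I ι x v) := by
  have h := inner_mfderiv_of_mem_orthogonal v (projN_mem (I := I) (J := J) x a)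
  rw [hι.projN_eq, inner_sub_right, sub_eq_zero] at h
  rw [real_inner_comm, ← h, real_inner_comm]

/-- The tangential part of a smooth section is smooth. -/
theorem smoothAt_tanPart (hι : IsSmoothImmersion I J ι) {s : ∀ y, TangentSpace I (ι y)} {x : L}
    (hs : SmoothAt I J ι s x) :
    SmoothAt J J (fun y : L => y) (fun y => hι.tanPart y (s y)) x := by
  have hx := mem_chart_source H' x
  have hc : ∀ c : E', SmoothAt I J ι (fun y => mfderiv J I ι y (ofCoord J x y c)) x := fun c =>
    contMDiffAt_mfderiv_apply (hι.smooth x)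
      (contMDiffAt_ofCoord (f := fun y : L => y) contMDiffAt_id hx contMDiffAt_const)
  have hin : ∀ {s t : ∀ y, TangentSpace I (ι y)}, SmoothAt I J ι s x → SmoothAt I J ι t x →
      ContMDiffAt J 𝓘(ℝ) ∞ (fun y => inner ℝ (s y) (t y)) x := fun {s t} hs ht =>
    ContMDiffAt.inner_bundle (IB := I) (F := E) (E := fun x : M => TangentSpace I x) (b := ι) hs ht
  let B : L → E' →L[ℝ] E' →L[ℝ] ℝ := fun y =>
    (innerSL ℝ (E := TangentSpace I (ι y))).bilinearComp (mfderiv J I ι y ∘L ofCoord J x y)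
      (mfderiv J I ι y ∘L ofCoord J x y)
  have hB : ∀ y b c, B y b c = inner ℝ (mfderiv J I ι y (ofCoord J x y b))
      (mfderiv J I ι y (ofCoord J x y c)) := fun _ _ _ => rfl
  have hsource : ∀ᶠ y in 𝓝 x, y ∈ (chartAt H' x).source := chart_source_mem hx
  refine (contMDiffAt_along_iff (f := fun y : L => y) contMDiffAt_id hx).2 ?_
  refine contMDiffAt_of_bilin (B := B) ?_ ?_ fun c => ?_
  · refine contMDiffAt_clm_of_apply fun b => contMDiffAt_clm_of_apply fun c => ?_
    simp only [hB]
    exact hin (hc b) (hc c)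
  · filter_upwards [hsource] with y hy b hb
    rw [hB, inner_self_eq_zero] at hb
    have h1 := hι.injective y (hb.trans (map_zero _).symm)
    rw [← toCoord_ofCoord (I := J) hy b, h1, map_zero]
  · refine (hin hs (hc c)).congr_of_eventuallyEq ?_
    filter_upwards [hsource] with y hy
    rw [hB, ofCoord_toCoord hy, hι.inner_mfderiv_tanPart]

theorem smoothAt_mfderiv (hι : IsSmoothImmersion I J ι) {v : ∀ y : L, TangentSpace J y} {x : L}
    (hv : SmoothAt J J (fun y : L => y) v x) :
    SmoothAt I J ι (fun y => mfderiv J I ι y (v y)) x :=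
  contMDiffAt_mfderiv_apply (hι.smooth x) hv

theorem smoothAt_projN (hι : IsSmoothImmersion I J ι) {s : ∀ y, TangentSpace I (ι y)} {x : L}
    (hs : SmoothAt I J ι s x) : SmoothAt I J ι (fun y => projN I J ι y (s y)) x :=
  (hs.sub (hι.smooth x) (hι.smoothAt_mfderiv (hι.smoothAt_tanPart hs))).congr
    (Filter.Eventually.of_forall fun y => (hι.projN_eq y (s y)).symm)

theorem mdifferentiableAt (hι : IsSmoothImmersion I J ι) (x : L) : MDifferentiableAt J I ι x :=
  (hι.smooth x).mdifferentiableAt (by simp)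

theorem inner_covAlong_add_eq_zero (hι : IsSmoothImmersion I J ι) {s t : ∀ y, TangentSpace I (ι y)}
    {x : L} (hs : SmoothAt I J ι s x) (ht : SmoothAt I J ι t x)
    (h : ∀ y, inner ℝ (s y) (t y) = 0) (u : TangentSpace J x) :
    inner ℝ (covAlong I J ι s x u) (t x) + inner ℝ (s x) (covAlong I J ι t x u) = 0 := by
  rw [← mvfderiv_inner (hι.mdifferentiableAt x) hs.mdifferentiableAt ht.mdifferentiableAt]
  simp only [h]
  rw [mvfderiv_const]
  rfl

/-- The second fundamental form is tensorial. -/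
theorem secondFF_apply (hι : IsSmoothImmersion I J ι) {v : ∀ y : L, TangentSpace J y} {x : L}
    (hv : SmoothAt J J (fun y : L => y) v x) (u : TangentSpace J x) :
    hι.secondFF x u (v x) = projN I J ι x (covAlong I J ι (fun y => mfderiv J I ι y (v y)) x u) := by
  have key : ∀ w : ∀ y : L, TangentSpace J y, SmoothAt J J (fun y : L => y) w x →
      ∀ ξ : ∀ y, TangentSpace I (ι y), SmoothAt I J ι ξ x → (∀ y, ξ y ∈ (tanPlane I J ι y)ᗮ) →
      inner ℝ (projN I J ι x (covAlong I J ι (fun y => mfderiv J I ι y (w y)) x u)) (ξ x) =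
        -inner ℝ (mfderiv J I ι x (w x)) (covAlong I J ι ξ x u) := by
    intro w hw ξ hξ hξ'
    have h1 := hι.inner_covAlong_add_eq_zero (hι.smoothAt_mfderiv hw) hξ
      (fun y => inner_mfderiv_of_mem_orthogonal _ (hξ' y)) u
    rw [hι.projN_eq, inner_sub_left, inner_mfderiv_of_mem_orthogonal _ (hξ' x), sub_zero]
    linarith
  rw [← sub_eq_zero]
  change projN I J ι x (covAlong I J ι (fun y => mfderiv J I ι y (constExt J x (v x) y)) x u) -
    projN I J ι x (covAlong I J ι (fun y => mfderiv J I ι y (v y)) x u) = 0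
  set z := projN I J ι x (covAlong I J ι (fun y => mfderiv J I ι y (constExt J x (v x) y)) x u) -
    projN I J ι x (covAlong I J ι (fun y => mfderiv J I ι y (v y)) x u) with hz
  obtain ⟨s, hs, hsx⟩ := exists_eventually_smoothAt hι.smooth z
  replace hs := hs.self_of_nhds
  have hzN : z ∈ (tanPlane I J ι x)ᗮ := Submodule.sub_mem _ (projN_mem _ _) (projN_mem _ _)
  have h1 := key _ (smoothAt_constExt x (v x)) _ (hι.smoothAt_projN hs) fun y => projN_mem _ _
  have h2 := key v hv _ (hι.smoothAt_projN hs) fun y => projN_mem _ _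
  rw [hsx, projN_of_mem hzN] at h1 h2
  rw [constExt_self] at h1
  have h3 := h1.trans h2.symm
  rw [← sub_eq_zero, ← inner_sub_left, ← hz] at h3
  exact inner_self_eq_zero.1 h3

theorem secondFF_mem (hι : IsSmoothImmersion I J ι) (x : L) (u v : TangentSpace J x) :
    hι.secondFF x u v ∈ (tanPlane I J ι x)ᗮ := projN_mem _ _

theorem inner_sffEnd (hι : IsSmoothImmersion I J ι) (x : L) (u : TangentSpace J x)
    (a b : TangentSpace I (ι x)) :
    inner ℝ (hι.sffEnd x u a) b = inner ℝ (hι.secondFF x u (hι.tanPart x a)) b -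
      inner ℝ a (hι.secondFF x u (hι.tanPart x b)) := by
  have h : hι.sffEnd x u a = hι.secondFF x u (hι.tanPart x a) -
      LinearMap.adjoint (hι.secondFF x u ∘ₗ hι.tanPart x) a := rfl
  rw [h, inner_sub_left, LinearMap.adjoint_inner_left]
  rfl

theorem inner_sffEnd_comm (hι : IsSmoothImmersion I J ι) (x : L) (u : TangentSpace J x)
    (a b : TangentSpace I (ι x)) :
    inner ℝ (hι.sffEnd x u a) b = -inner ℝ a (hι.sffEnd x u b) := by
  rw [real_inner_comm _ a, inner_sffEnd, inner_sffEnd, real_inner_comm b, real_inner_comm _ a]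
  ring

theorem sffEnd_mem_offDiag (hι : IsSmoothImmersion I J ι) (x : L) (u : TangentSpace J x) :
    hι.sffEnd x u ∈ offDiag (tanPlane I J ι x) := by
  refine ⟨hι.inner_sffEnd_comm x u, fun w hw => ?_, fun w hw => ?_⟩
  · refine (Submodule.mem_orthogonal' _ _).2 fun z hz => ?_
    rw [inner_sffEnd, (Submodule.mem_orthogonal' _ _).1 (hι.secondFF_mem x u _) z hz,
      (Submodule.mem_orthogonal _ _).1 (hι.secondFF_mem x u _) w hw, sub_zero]
  · rw [← Submodule.orthogonal_orthogonal (tanPlane I J ι x)]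
    refine (Submodule.mem_orthogonal' _ _).2 fun z hz => ?_
    rw [inner_sffEnd, hι.tanPart_eq_zero hw, hι.tanPart_eq_zero hz, map_zero, inner_zero_left,
      inner_zero_right, sub_zero]

/-- The Gauss and Weingarten formulas: `∇̄ = ∇̂ + B`. -/
theorem covAlong_eq_hatCov_add (hι : IsSmoothImmersion I J ι) {s : ∀ y, TangentSpace I (ι y)}
    {x : L} (hs : SmoothAt I J ι s x) (u : TangentSpace J x) :
    covAlong I J ι s x u = hι.hatCov s x u + hι.sffEnd x u (s x) := by
  have hT := hι.smoothAt_tanPart hs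
  have hN := hι.smoothAt_projN hs
  have hsum : covAlong I J ι s x u = covAlong I J ι (fun y => mfderiv J I ι y (hι.tanPart y (s y))) x u +
      covAlong I J ι (fun y => projN I J ι y (s y)) x u := by
    rw [← add_apply, ← covAlong_add I J (hι.smooth x).continuousAt
      (hι.smoothAt_mfderiv hT).mdifferentiableAt hN.mdifferentiableAt]
    congr 2
    funext y
    rw [hι.projN_eq, add_sub_cancel]
  set a := covAlong I J ι (fun y => mfderiv J I ι y (hι.tanPart y (s y))) x u with ha
  set b := covAlong I J ι (fun y => projN I J ι y (s y)) x u with hb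
  have hA := hι.secondFF_apply hT u
  rw [← ha] at hA
  have hhat : hι.hatCov s x u = mfderiv J I ι x (hι.tanPart x a) + projN I J ι x b := rfl
  refine ext_inner_right ℝ fun z => ?_
  have hz : z = mfderiv J I ι x (hι.tanPart x z) + projN I J ι x z := by
    rw [hι.projN_eq, add_sub_cancel]
  have h1 := hι.inner_covAlong_add_eq_zero (t := fun y => projN I J ι y (s y))
    (hι.smoothAt_mfderiv (smoothAt_constExt x (hι.tanPart x z))) hN
    (fun y => inner_mfderiv_of_mem_orthogonal _ (projN_mem y _)) u
  have h2 : inner ℝ (covAlong I J ι (fun y => mfderiv J I ι y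
      (constExt J x (hι.tanPart x z) y)) x u) (projN I J ι x (s x)) =
      inner ℝ (s x) (hι.secondFF x u (hι.tanPart x z)) := by
    have h3 : hι.secondFF x u (hι.tanPart x z) = projN I J ι x (covAlong I J ι (fun y =>
      mfderiv J I ι y (constExt J x (hι.tanPart x z) y)) x u) := rfl
    rw [h3]
    exact (Submodule.inner_starProjection_left_eq_right _ _ _).symm.trans (real_inner_comm _ _)
  rw [constExt_self, h2, ← hb] at h1
  have h4 : inner ℝ b z = inner ℝ (mfderiv J I ι x (hι.tanPart x z)) b +
      inner ℝ (projN I J ι x b) z := by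
    rw [real_inner_comm z b, hz, inner_add_left, ← hz]
    congr 1
    exact (Submodule.inner_starProjection_left_eq_right _ _ _).trans (real_inner_comm _ _)
  have h5 : a = mfderiv J I ι x (hι.tanPart x a) + projN I J ι x a := by
    rw [hι.projN_eq, add_sub_cancel]
  rw [hsum, inner_add_left, h4, hhat, inner_add_left, inner_add_left, inner_sffEnd, hA]
  nth_rewrite 1 [h5]
  rw [inner_add_left]
  linarith

end IsSmoothImmersion

end Submanifold

section LinearAlgebra

variable {V V' : Type*} [NormedAddCommGroup V] [InnerProductSpace ℝ V]
  [NormedAddCommGroup V'] [InnerProductSpace ℝ V']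

theorem map_mem_calGrass {k : ℕ} {β : V [⋀^Fin k]→L[ℝ] ℝ} {β' : V' [⋀^Fin k]→L[ℝ] ℝ}
    (Q : V ≃ₗᵢ[ℝ] V') (hQ : ∀ v : Fin k → V, β' (fun i => Q (v i)) = β v) {W : Submodule ℝ V}
    (hW : W ∈ calGrass β) : W.map (Q.toLinearEquiv : V →ₗ[ℝ] V') ∈ calGrass β' := by
  obtain ⟨o, h, ho⟩ := hW
  let e : W ≃ₗᵢ[ℝ] W.map (Q.toLinearEquiv : V →ₗ[ℝ] V') := Q.submoduleMap W
  have he : ∀ w : W.map (Q.toLinearEquiv : V →ₗ[ℝ] V'), Q (e.symm w : V) = w := fun w =>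
    congrArg Subtype.val (e.apply_symm_apply w)
  have h' : Module.finrank ℝ (W.map (Q.toLinearEquiv : V →ₗ[ℝ] V')) = k :=
    e.toLinearEquiv.finrank_eq.symm.trans h
  refine ⟨Orientation.map (Fin k) e.toLinearEquiv o, h', fun w => ?_⟩
  have := Fact.mk h
  have := Fact.mk h'
  rw [o.volumeForm_map e]
  refine Eq.trans ?_ (ho (e.symm ∘ w))
  rw [← hQ]
  simp only [Function.comp_apply, he]

theorem eq_of_mem_offDiag [FiniteDimensional ℝ V] {W : Submodule ℝ V} {X Y : V →L[ℝ] V}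
    (hX : X ∈ offDiag W) (hY : Y ∈ offDiag W) (h : ∀ w ∈ W, X w = Y w) : X = Y := by
  have h2 : ∀ n ∈ Wᗮ, X n = Y n := by
    intro n hn
    have h3 : X n - Y n ∈ W := W.sub_mem (hX.2.2 n hn) (hY.2.2 n hn)
    rw [← sub_eq_zero, ← inner_self_eq_zero (𝕜 := ℝ), inner_sub_left, hX.1, hY.1, h _ h3, sub_self]
  ext v
  rw [← Submodule.starProjection_add_starProjection_orthogonal (K := W) v, map_add, map_add,
    h _ (Submodule.starProjection_apply_mem _ _), h2 _ (Submodule.starProjection_apply_mem _ _)]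

end LinearAlgebra

section Transport

variable {E : Type*} [NormedAddCommGroup E] [NormedSpace ℝ E] [FiniteDimensional ℝ E]
  {H : Type*} [TopologicalSpace H] {I : ModelWithCorners ℝ E H}
  {M : Type*} [TopologicalSpace M] [ChartedSpace H M] [IsManifold I ∞ M]
  [RiemannianBundle (fun x : M => TangentSpace I x)]
  [IsContMDiffRiemannianBundle I ∞ E (fun x : M => TangentSpace I x)] [I.Boundaryless]

theorem hasDerivAt_inner_along {f : ℝ → M} {s s' : ∀ t, TangentSpace I (f t)} {t : ℝ}
    (hf : MDifferentiableAt 𝓘(ℝ, ℝ) I f t)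
    (hs : MDifferentiableAt 𝓘(ℝ, ℝ) I.tangent (fun r => (⟨f r, s r⟩ : TangentBundle I M)) t)
    (hs' : MDifferentiableAt 𝓘(ℝ, ℝ) I.tangent (fun r => (⟨f r, s' r⟩ : TangentBundle I M)) t) :
    HasDerivAt (fun r => inner ℝ (s r) (s' r))
      (inner ℝ (covAlong I 𝓘(ℝ, ℝ) f s t (1 : ℝ)) (s' t) +
        inner ℝ (s t) (covAlong I 𝓘(ℝ, ℝ) f s' t (1 : ℝ))) t := by
  have h1 : MDifferentiableAt 𝓘(ℝ, ℝ) 𝓘(ℝ) (fun r => inner ℝ (s r) (s' r)) t :=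
    MDifferentiableAt.inner_bundle (IB := I) (F := E) (E := fun x : M => TangentSpace I x) (b := f)
      hs hs'
  exact (hasDerivAt_of_mdifferentiableAt h1).congr_deriv (mvfderiv_inner hf hs hs' (1 : ℝ))

/-- Parallel transport is isometric and preserves parallel forms. -/
theorem exists_isometric_parallelTransport {f : ℝ → M} (hf : ContMDiffAt 𝓘(ℝ, ℝ) I ∞ f 0) :
    ∃ P : ∀ t, TangentSpace I (f 0) →L[ℝ] TangentSpace I (f t),
      P 0 = ContinuousLinearMap.id ℝ _ ∧
      (∀ v, MDifferentiableAt 𝓘(ℝ, ℝ) I.tangent (fun r => (⟨f r, P r v⟩ : TangentBundle I M)) 0 ∧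
          covAlong I 𝓘(ℝ, ℝ) f (fun r => P r v) 0 (1 : ℝ) = 0) ∧
      ∀ᶠ t in 𝓝 (0 : ℝ), (∃ Q : TangentSpace I (f 0) ≃ₗᵢ[ℝ] TangentSpace I (f t),
          ∀ v, Q v = P t v) ∧
        ∀ (m : ℕ) (β : ∀ x : M, TangentSpace I x [⋀^Fin m]→L[ℝ] ℝ), IsSmoothForm I β →
          IsParallelForm I β → ∀ v, β (f t) (fun i => P t (v i)) = β (f 0) v := by
  obtain ⟨P, hP0, hP⟩ := exists_parallelTransport hf
  refine ⟨P, hP0, hP.self_of_nhds.2, ?_⟩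
  obtain ⟨ε, hε, hball⟩ := Metric.eventually_nhds_iff_ball.1 hP
  rw [Real.ball_eq_Ioo, zero_sub, zero_add] at hball
  filter_upwards [Ioo_mem_nhds (neg_lt_zero.2 hε) hε] with t ht
  have hP0v : ∀ v, P 0 v = v := fun v => by rw [hP0]; rfl
  refine ⟨?_, fun m β hβ hβ' v => ?_⟩
  · have hinner : ∀ v w, inner ℝ (P t v) (P t w) = inner ℝ v w := by
      intro v w
      have h1 := eventually_eq_of_hasDerivAt_zero (h := fun r => inner ℝ (P r v) (P r w))
        (fun r hr => (hasDerivAt_inner_along (hball r hr).1 ((hball r hr).2 v).1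
          ((hball r hr).2 w).1).congr_deriv (by
            rw [((hball r hr).2 v).2, ((hball r hr).2 w).2, inner_zero_left, inner_zero_right,
              add_zero])) ht
      simp only [hP0v] at h1
      exact h1
    let g : TangentSpace I (f 0) →ₗᵢ[ℝ] TangentSpace I (f t) :=
      (P t : TangentSpace I (f 0) →ₗ[ℝ] TangentSpace I (f t)).isometryOfInner hinner
    exact ⟨g.toLinearIsometryEquiv rfl, fun v => rfl⟩
  · have h1 := eventually_eq_of_hasDerivAt_zero (h := fun r => β (f r) (fun i => P r (v i)))
      (fun r hr => (hasDerivAt_parallelForm (γ := fun r : ℝ => r) hβ hβ' mdifferentiableAt_id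
        (hball r hr).1 (s := fun i r => P r (v i)) fun i => ((hball r hr).2 (v i)).1).congr_deriv (by
          have hid : mfderiv 𝓘(ℝ, ℝ) 𝓘(ℝ, ℝ) (fun r : ℝ => r) r =
            ContinuousLinearMap.id ℝ _ := mfderiv_id
          refine Finset.sum_eq_zero fun i _ => ?_
          have h2 : covAlong I 𝓘(ℝ, ℝ) f (fun r => P r (v i)) r
              (mfderiv 𝓘(ℝ, ℝ) 𝓘(ℝ, ℝ) (fun r : ℝ => r) r (1 : ℝ)) = 0 :=
            (congrArg _ (DFunLike.congr_fun hid (1 : ℝ))).trans ((hball r hr).2 (v i)).2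
          rw [h2]
          exact (β (f r)).map_coord_zero i (Function.update_self _ _ _))) ht
    simp only [hP0v] at h1
    exact h1

end Transport

section Submanifold

variable {E : Type*} [NormedAddCommGroup E] [NormedSpace ℝ E] [FiniteDimensional ℝ E]
  {H : Type*} [TopologicalSpace H] {I : ModelWithCorners ℝ E H}
  {M : Type*} [TopologicalSpace M] [ChartedSpace H M] [IsManifold I ∞ M]
  [RiemannianBundle (fun x : M => TangentSpace I x)]
  [IsContMDiffRiemannianBundle I ∞ E (fun x : M => TangentSpace I x)] [I.Boundaryless]
  {E' : Type*} [NormedAddCommGroup E'] [NormedSpace ℝ E'] [FiniteDimensional ℝ E']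
  {H' : Type*} [TopologicalSpace H'] {J : ModelWithCorners ℝ E' H'}
  {L : Type*} [TopologicalSpace L] [ChartedSpace H' L] [IsManifold J ∞ L] [J.Boundaryless]
  {ι : L → M}

theorem IsSmoothImmersion.IsCalibratedBy.mem_calGrass {hι : IsSmoothImmersion I J ι} {k : ℕ}
    {o : ∀ x : L, Orientation ℝ (TangentSpace J x) (Fin k)}
    {β : ∀ x : M, TangentSpace I x [⋀^Fin k]→L[ℝ] ℝ} (h : hι.IsCalibratedBy o β) (x : L) :
    tanPlane I J ι x ∈ calGrass (β (ι x)) := ⟨_, h x⟩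

namespace IsSmoothImmersion

theorem hatCov_mem_tanPlane (hι : IsSmoothImmersion I J ι) {s : ∀ y, TangentSpace I (ι y)} {x : L}
    (hs : ∀ y, s y ∈ tanPlane I J ι y) (u : TangentSpace J x) :
    hι.hatCov s x u ∈ tanPlane I J ι x := by
  have h : norCov I J ι (fun y => projN I J ι y (s y)) x u = 0 := by
    have h1 : (fun y => projN I J ι y (s y)) = fun y => (0 : TangentSpace I (ι y)) := by
      funext y
      exact projN_eq_zero (hs y)
    rw [h1]
    unfold norCov
    rw [covAlong_zero, zero_apply, map_zero]
  unfold hatCov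
  rw [h, add_zero]
  exact mfderiv_mem_tanPlane x _

theorem hatCov_mem_orthogonal (hι : IsSmoothImmersion I J ι) {s : ∀ y, TangentSpace I (ι y)}
    {x : L} (hs : ∀ y, s y ∈ (tanPlane I J ι y)ᗮ) (u : TangentSpace J x) :
    hι.hatCov s x u ∈ (tanPlane I J ι x)ᗮ := by
  have h : hι.tanCov (fun y => hι.tanPart y (s y)) x u = 0 := by
    have h1 : (fun y => mfderiv J I ι y (hι.tanPart y (s y))) =
        fun y => (0 : TangentSpace I (ι y)) := by
      funext y
      rw [hι.tanPart_eq_zero (hs y), map_zero]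
    unfold tanCov
    rw [h1, covAlong_zero, zero_apply, map_zero]
  unfold hatCov
  rw [h, map_zero, zero_add]
  exact projN_mem _ _

variable {N : ℕ} {d : Fin (N + 1) → ℕ} {α : ∀ j, ∀ x : M, TangentSpace I x [⋀^Fin (d j)]→L[ℝ] ℝ}

/-- The second fundamental form of a calibrated submanifold takes values in `𝔤`. -/
theorem sffEnd_mem_annihilator (hι : IsSmoothImmersion I J ι) (hα : ∀ j, IsSmoothForm I (α j))
    (hα' : ∀ j, IsParallelForm I (α j)) (htr : ∀ x, IsTransitiveOnCal (formStab fun j => α j x) (α 0 x))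
    (hco : ∀ x, IsCompliant fun j => α j x) (hcal : ∀ y, tanPlane I J ι y ∈ calGrass (α 0 (ι y)))
    (x : L) (u : TangentSpace J x) : hι.sffEnd x u ∈ annihilator fun j => α j (ι x) := by
  obtain ⟨γ, rfl, hγ, rfl⟩ := exists_curve x u
  have hγ' := hγ.mdifferentiableAt (by simp : (∞ : WithTop ℕ∞) ≠ 0)
  set f : ℝ → M := fun t => ι (γ t) with hfdef
  have hf : ContMDiffAt 𝓘(ℝ, ℝ) I ∞ f 0 := (hι.smooth (γ 0)).comp 0 hγ
  obtain ⟨P, hP0, hPd, hP⟩ := exists_isometric_parallelTransport hf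
  let s : TangentSpace I (ι (γ 0)) → ∀ y, TangentSpace I (ι y) := fun w y =>
    mfderiv J I ι y (constExt J (γ 0) (hι.tanPart (γ 0) w) y)
  have hs : ∀ w, SmoothAt I J ι (s w) (γ 0) := fun w => hι.smoothAt_mfderiv (smoothAt_constExt _ _)
  have hsT : ∀ w y, s w y ∈ tanPlane I J ι y := fun w y => mfderiv_mem_tanPlane y _
  have hs0 : ∀ w ∈ tanPlane I J ι (γ 0), s w (γ 0) = w := fun w hw => by
    change mfderiv J I ι (γ 0) (constExt J (γ 0) (hι.tanPart (γ 0) w) (γ 0)) = w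
    rw [constExt_self, hι.mfderiv_tanPart_of_mem hw]
  let e := stdOrthonormalBasis ℝ (TangentSpace I (ι (γ 0)))
  let c : TangentSpace I (ι (γ 0)) → ℝ → TangentSpace I (ι (γ 0)) := fun w t =>
    ∑ i, (inner ℝ (P t (e i)) (s w (γ t)) : ℝ) • e i
  let c' : TangentSpace I (ι (γ 0)) → TangentSpace I (ι (γ 0)) := fun w =>
    covAlong I J ι (s w) (γ 0) (mfderiv 𝓘(ℝ, ℝ) J γ 0 (1 : ℝ))
  have hP0v : ∀ v, P 0 v = v := fun v => by rw [hP0]; rfl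
  have hc : ∀ w ∈ tanPlane I J ι (γ 0), HasDerivAt (c w) (c' w) 0 := by
    intro w _
    have hsw : MDifferentiableAt 𝓘(ℝ, ℝ) I.tangent
        (fun r => (⟨f r, s w (γ r)⟩ : TangentBundle I M)) 0 :=
      MDifferentiableAt.comp (g := fun y => (⟨ι y, s w y⟩ : TangentBundle I M)) 0
        (hs w).mdifferentiableAt hγ'
    have h1 : ∀ i, HasDerivAt (fun t => inner ℝ (P t (e i)) (s w (γ t))) (inner ℝ (e i) (c' w)) 0 := by
      intro i
      refine (hasDerivAt_inner_along (f := f) (s' := fun r => s w (γ r)) (hf.mdifferentiableAt (by simp))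
        (hPd (e i)).1 hsw).congr_deriv ?_
      rw [(hPd (e i)).2, inner_zero_left, zero_add, hP0v]
      congr 1
      exact covAlong_comp_curve hγ' (hι.mdifferentiableAt _) (hs w).mdifferentiableAt
    refine (HasDerivAt.fun_sum fun i _ => (h1 i).smul_const (e i)).congr_deriv ?_
    exact e.sum_repr' _
  have hc0 : ∀ w ∈ tanPlane I J ι (γ 0), c w 0 = w := by
    intro w hw
    change ∑ i, (inner ℝ (P 0 (e i)) (s w (γ 0)) : ℝ) • e i = w
    simp only [hP0v, hs0 w hw]
    exact e.sum_repr' w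
  obtain ⟨X, hX, hXoff, hXc⟩ := exists_mem_offDiag_of_curves (hco (ι (γ 0))) (hcal (γ 0)) c c' hc hc0
    (by
      filter_upwards [hP] with t ht
      obtain ⟨⟨Q, hQ⟩, hform⟩ := ht
      have hW := map_mem_calGrass (β := α 0 (f t)) (β' := α 0 (f 0)) Q.symm (fun v => by
        rw [← hform _ (α 0) (hα 0) (hα' 0)]
        simp only [← hQ, LinearIsometryEquiv.apply_symm_apply]) (hcal (γ t))
      obtain ⟨A, hA, hAW⟩ := htr (ι (γ 0)) _ (hcal (γ 0)) _ hW
      refine ⟨_, coe_mem_stabSet hA, fun w hw => ?_⟩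
      have h1 : c w t = Q.symm (s w (γ t)) := by
        rw [← e.sum_repr' (Q.symm (s w (γ t)))]
        refine Finset.sum_congr rfl fun i _ => ?_
        congr 1
        rw [← hQ, ← Q.symm.inner_map_map, Q.symm_apply_apply]
      have h2 : c w t ∈ (tanPlane I J ι (γ t)).map (Q.symm.toLinearEquiv :
          TangentSpace I (f t) →ₗ[ℝ] TangentSpace I (f 0)) := by
        rw [h1]
        exact Submodule.mem_map_of_mem (hsT w (γ t))
      rw [← hAW] at h2
      obtain ⟨w', hw', h3⟩ := h2
      exact ⟨w', hw', h3⟩)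
  have hB := hι.sffEnd_mem_offDiag (γ 0) (mfderiv 𝓘(ℝ, ℝ) J γ 0 (1 : ℝ))
  have hBX : hι.sffEnd (γ 0) (mfderiv 𝓘(ℝ, ℝ) J γ 0 (1 : ℝ)) = X := by
    refine eq_of_mem_offDiag hB hXoff fun w hw => ?_
    have h1 := hι.covAlong_eq_hatCov_add (hs w) (mfderiv 𝓘(ℝ, ℝ) J γ 0 (1 : ℝ))
    rw [hs0 w hw] at h1
    have h2 := hι.hatCov_mem_tanPlane (hsT w) (mfderiv 𝓘(ℝ, ℝ) J γ 0 (1 : ℝ))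
    have h3 := hXc w hw
    change covAlong I J ι (s w) (γ 0) (mfderiv 𝓘(ℝ, ℝ) J γ 0 (1 : ℝ)) - X w ∈ _ at h3
    rw [h1] at h3
    have h4 := Submodule.sub_mem _ h3 h2
    rw [add_sub_assoc, add_sub_cancel_left] at h4
    have h5 := Submodule.sub_mem _ (hB.2.1 w hw) (hXoff.2.1 w hw)
    exact sub_eq_zero.1 (inner_self_eq_zero.1 ((Submodule.mem_orthogonal _ _).1 h5 _ h4))
  rw [hBX]
  exact hX

end IsSmoothImmersion

end Submanifold

section Submanifold

variable {E : Type*} [NormedAddCommGroup E] [NormedSpace ℝ E] [FiniteDimensional ℝ E]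
  {H : Type*} [TopologicalSpace H] {I : ModelWithCorners ℝ E H}
  {M : Type*} [TopologicalSpace M] [ChartedSpace H M] [IsManifold I ∞ M]
  [RiemannianBundle (fun x : M => TangentSpace I x)]
  [IsContMDiffRiemannianBundle I ∞ E (fun x : M => TangentSpace I x)] [I.Boundaryless]
  {E' : Type*} [NormedAddCommGroup E'] [NormedSpace ℝ E'] [FiniteDimensional ℝ E']
  {H' : Type*} [TopologicalSpace H'] {J : ModelWithCorners ℝ E' H'}
  {L : Type*} [TopologicalSpace L] [ChartedSpace H' L] [IsManifold J ∞ L] [J.Boundaryless]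
  {ι : L → M}

namespace IsSmoothImmersion

/-- `(∇̂_w B)_v s` for a tangent vector `w` at `x`. -/
def covDerivAt (hι : IsSmoothImmersion I J ι) (v : ∀ y : L, TangentSpace J y)
    (s : ∀ y, TangentSpace I (ι y)) (x : L) (w : TangentSpace J x) : TangentSpace I (ι x) :=
  hι.hatCov (fun y => hι.sffEnd y (v y) (s y)) x w - hι.sffEnd x (hι.tanCov v x w) (s x) -
    hι.sffEnd x (v x) (hι.hatCov s x w)

theorem smoothAt_sffEnd (hι : IsSmoothImmersion I J ι) {v : ∀ y : L, TangentSpace J y}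
    {s : ∀ y, TangentSpace I (ι y)} {x : L} (hv : SmoothAt J J (fun y : L => y) v x)
    (hs : ∀ᶠ y in 𝓝 x, SmoothAt I J ι s y) :
    SmoothAt I J ι (fun y => hι.sffEnd y (v y) (s y)) x := by
  have hsx := hs.self_of_nhds
  have h1 : SmoothAt I J ι (fun y => covAlong I J ι s y (v y)) x :=
    contMDiffAt_covAlong (hι.smooth x) hsx hv
  have h2 : SmoothAt I J ι (fun y => mfderiv J I ι y (hι.tanCov (fun y => hι.tanPart y (s y)) y
      (v y))) x :=
    hι.smoothAt_mfderiv (hι.smoothAt_tanPart (contMDiffAt_covAlong (hι.smooth x)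
      (hι.smoothAt_mfderiv (hι.smoothAt_tanPart hsx)) hv))
  have h3 : SmoothAt I J ι (fun y => norCov I J ι (fun y => projN I J ι y (s y)) y (v y)) x :=
    hι.smoothAt_projN (contMDiffAt_covAlong (hι.smooth x) (hι.smoothAt_projN hsx) hv)
  refine ((h1.sub (hι.smooth x) h2).sub (hι.smooth x) h3).congr ?_
  filter_upwards [hs] with y hy
  rw [hι.covAlong_eq_hatCov_add hy]
  unfold hatCov
  abel

/-- The connection `∇̂` is metric. -/
theorem mvfderiv_inner_hatCov (hι : IsSmoothImmersion I J ι) {s t : ∀ y, TangentSpace I (ι y)}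
    {x : L} (hs : SmoothAt I J ι s x) (ht : SmoothAt I J ι t x) (w : TangentSpace J x) :
    mvfderiv J (fun y => inner ℝ (s y) (t y)) x w =
      inner ℝ (hι.hatCov s x w) (t x) + inner ℝ (s x) (hι.hatCov t x w) := by
  rw [mvfderiv_inner (hι.mdifferentiableAt x) hs.mdifferentiableAt ht.mdifferentiableAt,
    hι.covAlong_eq_hatCov_add hs, hι.covAlong_eq_hatCov_add ht, inner_add_left, inner_add_right,
    hι.inner_sffEnd_comm]
  ring

theorem inner_covDerivAt_comm (hι : IsSmoothImmersion I J ι) {v : ∀ y : L, TangentSpace J y}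
    {s t : ∀ y, TangentSpace I (ι y)} {x : L} (hv : SmoothAt J J (fun y : L => y) v x)
    (hs : ∀ᶠ y in 𝓝 x, SmoothAt I J ι s y) (ht : ∀ᶠ y in 𝓝 x, SmoothAt I J ι t y)
    (w : TangentSpace J x) :
    inner ℝ (hι.covDerivAt v s x w) (t x) = -inner ℝ (s x) (hι.covDerivAt v t x w) := by
  have h1 := hι.mvfderiv_inner_hatCov (hι.smoothAt_sffEnd hv hs) ht.self_of_nhds w
  have h2 := hι.mvfderiv_inner_hatCov (hι.smoothAt_sffEnd hv ht) hs.self_of_nhds w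
  have h3 : (fun y => inner ℝ (hι.sffEnd y (v y) (s y)) (t y)) =
      -fun y => inner ℝ (hι.sffEnd y (v y) (t y)) (s y) := by
    funext y
    rw [hι.inner_sffEnd_comm, Pi.neg_apply, real_inner_comm]
  rw [h3, mvfderiv_neg, neg_apply, h2] at h1
  unfold covDerivAt
  simp only [inner_sub_left, inner_sub_right]
  rw [hι.inner_sffEnd_comm x _ (s x) (t x), hι.inner_sffEnd_comm x _ (hι.hatCov s x w) (t x)]
  rw [hι.inner_sffEnd_comm x _ (t x) (hι.hatCov s x w), hι.inner_sffEnd_comm x _ (s x) _,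
    real_inner_comm (s x) (hι.hatCov _ x w)] at h1
  rw [real_inner_comm (hι.sffEnd x (v x) (t x)) (hι.hatCov s x w),
    hι.inner_sffEnd_comm x _ (t x) (hι.hatCov s x w)]
  linarith

/-- `(∇̂_w B)_v` is tensorial. -/
theorem exists_covDerivAt_eq (hι : IsSmoothImmersion I J ι) {v : ∀ y : L, TangentSpace J y}
    {x : L} (hv : SmoothAt J J (fun y : L => y) v x) (w : TangentSpace J x) :
    ∃ X : TangentSpace I (ι x) →L[ℝ] TangentSpace I (ι x), ∀ s : ∀ y, TangentSpace I (ι y),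
      (∀ᶠ y in 𝓝 x, SmoothAt I J ι s y) → hι.covDerivAt v s x w = X (s x) := by
  let e := stdOrthonormalBasis ℝ (TangentSpace I (ι x))
  choose r hr hrx using fun i => exists_eventually_smoothAt (x := x) hι.smooth (e i)
  refine ⟨-∑ i, (innerSL ℝ (hι.covDerivAt v (r i) x w)).smulRight (e i), fun s hs => ?_⟩
  rw [neg_apply, sum_apply, ← e.sum_repr' (hι.covDerivAt v s x w),
    ← Finset.sum_neg_distrib]
  refine Finset.sum_congr rfl fun i _ => ?_
  have h := hι.inner_covDerivAt_comm hv hs (hr i) w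
  rw [hrx] at h
  rw [real_inner_comm, h, neg_smul, real_inner_comm]
  rfl

theorem mem_offDiag_of_covDerivAt_eq (hι : IsSmoothImmersion I J ι)
    {v : ∀ y : L, TangentSpace J y} {x : L} (hv : SmoothAt J J (fun y : L => y) v x)
    {w : TangentSpace J x} {X : TangentSpace I (ι x) →L[ℝ] TangentSpace I (ι x)}
    (hX : ∀ s : ∀ y, TangentSpace I (ι y), (∀ᶠ y in 𝓝 x, SmoothAt I J ι s y) →
      hι.covDerivAt v s x w = X (s x)) : X ∈ offDiag (tanPlane I J ι x) := by
  refine ⟨fun a b => ?_, fun a ha => ?_, fun a ha => ?_⟩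
  · obtain ⟨s, hs, rfl⟩ := exists_eventually_smoothAt (x := x) hι.smooth a
    obtain ⟨t, ht, rfl⟩ := exists_eventually_smoothAt (x := x) hι.smooth b
    rw [← hX s hs, ← hX t ht]
    exact hι.inner_covDerivAt_comm hv hs ht w
  · obtain ⟨s, hs, hsx⟩ := exists_eventually_smoothAt (x := x) hι.smooth a
    have h := hX (fun y => mfderiv J I ι y (hι.tanPart y (s y)))
      (hs.mono fun y hy => hι.smoothAt_mfderiv (hι.smoothAt_tanPart hy))
    rw [hsx, hι.mfderiv_tanPart_of_mem ha] at h
    have hT : ∀ y, mfderiv J I ι y (hι.tanPart y (s y)) ∈ tanPlane I J ι y := fun y =>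
      mfderiv_mem_tanPlane y _
    rw [← h]
    exact Submodule.sub_mem _ (Submodule.sub_mem _
      (hι.hatCov_mem_orthogonal (fun y => (hι.sffEnd_mem_offDiag y _).2.1 _ (hT y)) w)
      ((hι.sffEnd_mem_offDiag x _).2.1 _ (hT x)))
      ((hι.sffEnd_mem_offDiag x _).2.1 _ (hι.hatCov_mem_tanPlane hT w))
  · obtain ⟨s, hs, hsx⟩ := exists_eventually_smoothAt (x := x) hι.smooth a
    have h := hX (fun y => projN I J ι y (s y)) (hs.mono fun y hy => hι.smoothAt_projN hy)
    rw [hsx, projN_of_mem ha] at h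
    have hN : ∀ y, projN I J ι y (s y) ∈ (tanPlane I J ι y)ᗮ := fun y => projN_mem y _
    rw [← h]
    exact Submodule.sub_mem _ (Submodule.sub_mem _
      (hι.hatCov_mem_tanPlane (fun y => (hι.sffEnd_mem_offDiag y _).2.2 _ (hN y)) w)
      ((hι.sffEnd_mem_offDiag x _).2.2 _ (hN x)))
      ((hι.sffEnd_mem_offDiag x _).2.2 _ (hι.hatCov_mem_orthogonal hN w))

/-- Parallel forms are parallel for `∇̂` if `B` takes values in their annihilator. -/
theorem hasDerivAt_form_hatCov (hι : IsSmoothImmersion I J ι) {m : ℕ}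
    {β : ∀ x : M, TangentSpace I x [⋀^Fin m]→L[ℝ] ℝ} (hβ : IsSmoothForm I β)
    (hβ' : IsParallelForm I β) {γ : ℝ → L} {t : ℝ} (hγ : MDifferentiableAt 𝓘(ℝ, ℝ) J γ t)
    (hB : ∀ a : Fin m → TangentSpace I (ι (γ t)), ∑ i, β (ι (γ t)) (Function.update a i
      (hι.sffEnd (γ t) (mfderiv 𝓘(ℝ, ℝ) J γ t (1 : ℝ)) (a i))) = 0)
    {s : Fin m → ∀ y, TangentSpace I (ι y)} (hs : ∀ i, SmoothAt I J ι (s i) (γ t)) :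
    HasDerivAt (fun r => β (ι (γ r)) (fun i => s i (γ r)))
      (∑ i, β (ι (γ t)) (Function.update (fun j => s j (γ t)) i
        (hι.hatCov (s i) (γ t) (mfderiv 𝓘(ℝ, ℝ) J γ t (1 : ℝ))))) t := by
  refine (hasDerivAt_parallelForm hβ hβ' hγ (hι.mdifferentiableAt _)
    fun i => (hs i).mdifferentiableAt).congr_deriv ?_
  rw [← add_zero (∑ i, β (ι (γ t)) (Function.update (fun j => s j (γ t)) i
        (hι.hatCov (s i) (γ t) (mfderiv 𝓘(ℝ, ℝ) J γ t (1 : ℝ))))), ← hB fun i => s i (γ t),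
    ← Finset.sum_add_distrib]
  refine Finset.sum_congr rfl fun i _ => ?_
  rw [hι.covAlong_eq_hatCov_add (hs i), ContinuousAlternatingMap.map_update_add]

theorem sum_update_covDerivAt (hι : IsSmoothImmersion I J ι) {m : ℕ}
    {β : ∀ x : M, TangentSpace I x [⋀^Fin m]→L[ℝ] ℝ} (hβ : IsSmoothForm I β)
    (hβ' : IsParallelForm I β)
    (hB : ∀ (y : L) (u : TangentSpace J y) (a : Fin m → TangentSpace I (ι y)),
      ∑ i, β (ι y) (Function.update a i (hι.sffEnd y u (a i))) = 0)
    {v : ∀ y : L, TangentSpace J y} {x : L} (hv : SmoothAt J J (fun y : L => y) v x)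
    {s : Fin m → ∀ y, TangentSpace I (ι y)} (hs : ∀ i, ∀ᶠ y in 𝓝 x, SmoothAt I J ι (s i) y)
    (w : TangentSpace J x) :
    ∑ i, β (ι x) (Function.update (fun j => s j x) i (hι.covDerivAt v (s i) x w)) = 0 := by
  obtain ⟨γ, rfl, hγ, rfl⟩ := exists_curve x w
  have hγ' := hγ.mdifferentiableAt (by simp : (∞ : WithTop ℕ∞) ≠ 0)
  set w := mfderiv 𝓘(ℝ, ℝ) J γ 0 (1 : ℝ) with hw
  let b : Fin m → ∀ y, TangentSpace I (ι y) := fun i y => hι.sffEnd y (v y) (s i y)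
  let σ : Fin m → Fin m → ∀ y, TangentSpace I (ι y) := fun i j =>
    if j = i then b i else s j
  have hσ : ∀ i y, (fun j => σ i j y) = Function.update (fun j => s j y) i (b i y) := by
    intro i y
    funext j
    by_cases h : j = i
    · subst h; simp [σ]
    · simp [σ, h]
  have hσs : ∀ i j, SmoothAt I J ι (σ i j) (γ 0) := by
    intro i j
    by_cases h : j = i
    · simp only [σ, h, if_true]
      exact hι.smoothAt_sffEnd hv (hs i)
    · simp only [σ, h, if_false]
      exact (hs j).self_of_nhds
  have hder := HasDerivAt.fun_sum (u := Finset.univ) fun i _ =>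
    hι.hasDerivAt_form_hatCov hβ hβ' hγ' (hB (γ 0) _) (hσs i)
  have hzero : (fun r => ∑ i, β (ι (γ r)) (fun j => σ i j (γ r))) = fun _ => 0 := by
    funext r
    simp only [hσ]
    exact hB (γ r) (v (γ r)) fun j => s j (γ r)
  rw [hzero] at hder
  have h1 := hder.unique (hasDerivAt_const (0 : ℝ) (0 : ℝ))
  have hcov : ∀ i j, hι.hatCov (σ i j) (γ 0) w =
      if j = i then hι.hatCov (b i) (γ 0) w else hι.hatCov (s j) (γ 0) w := by
    intro i j
    by_cases h : j = i <;> simp [σ, h]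
  simp only [hσ, ← hw, hcov] at h1
  rw [sum_update_update] at h1
  have h2 := sum_update_of_annihilates (hB (γ 0) (v (γ 0))) (fun j => s j (γ 0))
    (fun i => hι.hatCov (s i) (γ 0) w)
  have h3 := hB (γ 0) (hι.tanCov v (γ 0) w) (fun j => s j (γ 0))
  rw [mixedSum_comm] at h2
  unfold covDerivAt
  simp only [ContinuousAlternatingMap.map_update_sub, Finset.sum_sub_distrib]
  rw [h2, h3]
  linarith

variable {N : ℕ} {d : Fin (N + 1) → ℕ} {α : ∀ j, ∀ x : M, TangentSpace I x [⋀^Fin (d j)]→L[ℝ] ℝ}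

/-- For a second fundamental form with values in `𝔤`, its covariant derivative takes values in
`𝔤 ∩ (W ⊗ W^⊥)`. -/
theorem exists_covDerivAt_mem (hι : IsSmoothImmersion I J ι) (hα : ∀ j, IsSmoothForm I (α j))
    (hα' : ∀ j, IsParallelForm I (α j))
    (hB : ∀ (y : L) (u : TangentSpace J y), hι.sffEnd y u ∈ annihilator fun j => α j (ι y))
    {v : ∀ y : L, TangentSpace J y} {x : L} (hv : SmoothAt J J (fun y : L => y) v x)
    (w : TangentSpace J x) :
    ∃ X ∈ annihilator fun j => α j (ι x), X ∈ offDiag (tanPlane I J ι x) ∧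
      ∀ s : ∀ y, TangentSpace I (ι y), (∀ᶠ y in 𝓝 x, SmoothAt I J ι s y) →
        hι.covDerivAt v s x w = X (s x) := by
  obtain ⟨X, hX⟩ := hι.exists_covDerivAt_eq hv w
  have hoff := hι.mem_offDiag_of_covDerivAt_eq hv hX
  refine ⟨X, ⟨hoff.1, fun j a => ?_⟩, hoff, hX⟩
  choose s hs hsx using fun i => exists_eventually_smoothAt (x := x) hι.smooth (a i)
  have h := hι.sum_update_covDerivAt (hα j) (hα' j) (fun y u a => (hB y u).2 j a) hv hs w
  simp only [hX _ (hs _), hsx] at h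
  exact h

end IsSmoothImmersion

end Submanifold

theorem sub_mem_offDiag {V : Type*} [NormedAddCommGroup V] [InnerProductSpace ℝ V]
    {W : Submodule ℝ V} {X Y : V →L[ℝ] V} (hX : X ∈ offDiag W) (hY : Y ∈ offDiag W) :
    X - Y ∈ offDiag W :=
  ⟨fun v w => by
    rw [sub_apply, sub_apply, inner_sub_left, inner_sub_right, hX.1, hY.1]
    ring, fun w hw => Wᗮ.sub_mem (hX.2.1 w hw) (hY.2.1 w hw),
    fun w hw => W.sub_mem (hX.2.2 w hw) (hY.2.2 w hw)⟩

end Calib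
end

theorem mainTheorem2 {n N : ℕ} {d : Fin (N + 1) → ℕ}
    -- the oriented Riemannian manifold `M` of dimension `n`
    {M : Type*} [TopologicalSpace M] [T2Space M] [SecondCountableTopology M]
    [ChartedSpace (EuclideanSpace ℝ (Fin n)) M] [IsManifold (𝓡 n) ∞ M]
    [RiemannianBundle (fun x : M => TangentSpace (𝓡 n) x)]
    [IsContMDiffRiemannianBundle (𝓡 n) ∞ (EuclideanSpace ℝ (Fin n))
      (fun x : M => TangentSpace (𝓡 n) x)]
    (oM : ∀ x : M, Orientation ℝ (TangentSpace (𝓡 n) x) (Fin n))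
    (hoM : Calib.IsManifoldOrientation (𝓡 n) oM)
    -- the forms `α 0, …, α N` on `M`, of degrees `d 0, …, d N`
    (α : ∀ j, ∀ x : M, TangentSpace (𝓡 n) x [⋀^Fin (d j)]→L[ℝ] ℝ)
    (hα : Calib.IsParallelCompliant (𝓡 n) oM α)
    -- the oriented immersed submanifold `L`, of dimension `d 0`
    {L : Type*} [TopologicalSpace L] [T2Space L] [SecondCountableTopology L]
    [ChartedSpace (EuclideanSpace ℝ (Fin (d 0))) L] [IsManifold (𝓡 (d 0)) ∞ L]
    (oL : ∀ x : L, Orientation ℝ (TangentSpace (𝓡 (d 0)) x) (Fin (d 0)))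
    (hoL : Calib.IsManifoldOrientation (𝓡 (d 0)) oL)
    {ι : L → M} (hι : Calib.IsSmoothImmersion (𝓡 n) (𝓡 (d 0)) ι)
    (hcal : hι.IsCalibratedBy oL (α 0))
    -- smooth vector fields `u`, `v` on `L`
    (u v : ∀ x : L, TangentSpace (𝓡 (d 0)) x)
    (hu : Calib.IsSmoothAlong (𝓡 (d 0)) (𝓡 (d 0)) (fun x : L => x) u)
    (hv : Calib.IsSmoothAlong (𝓡 (d 0)) (𝓡 (d 0)) (fun x : L => x) v) (x : L) :
    -- `[B_u, B_v]` lies in `𝔥`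
    hι.sffEnd x (u x) ∘L hι.sffEnd x (v x) - hι.sffEnd x (v x) ∘L hι.sffEnd x (u x) ∈
        Calib.lieH (fun j => α j (ι x)) (Calib.tanPlane (𝓡 n) (𝓡 (d 0)) ι x) ∧
      -- the map `s ↦ ((∇̂_u B)_v - (∇̂_v B)_u) s` on sections of `E` is given at `x` by an
      -- endomorphism that lies in the orthogonal complement of `𝔥` in `𝔤`
      ∃ X ∈ Calib.perpIn (Calib.lieG (fun j => α j (ι x)))
          (Calib.lieH (fun j => α j (ι x)) (Calib.tanPlane (𝓡 n) (𝓡 (d 0)) ι x)),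
        ∀ s : ∀ y : L, TangentSpace (𝓡 n) (ι y),
          Calib.IsSmoothAlong (𝓡 n) (𝓡 (d 0)) ι s →
            hι.covDerivB u v s x - hι.covDerivB v u s x = X (s x) := by
  have hB := hι.sffEnd_mem_annihilator hα.smooth hα.parallel hα.transitive hα.compliant
    (fun y => hcal.mem_calGrass y)
  refine ⟨Calib.commutator_mem_lieH (hB x (u x)) (hB x (v x)) (hι.sffEnd_mem_offDiag x (u x))
    (hι.sffEnd_mem_offDiag x (v x)), ?_⟩
  obtain ⟨X, hX, hXoff, hXs⟩ := hι.exists_covDerivAt_mem hα.smooth hα.parallel hB (hv x) (u x)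
  obtain ⟨Y, hY, hYoff, hYs⟩ := hι.exists_covDerivAt_mem hα.smooth hα.parallel hB (hu x) (v x)
  refine ⟨X - Y, ?_, fun s hs => ?_⟩
  · rw [hα.compliant (ι x) _ (hcal.mem_calGrass x)]
    exact ⟨Calib.mem_lieG_iff.2 (Submodule.sub_mem _ hX hY), Calib.sub_mem_offDiag hXoff hYoff⟩
  · have h1 := hXs s (Filter.Eventually.of_forall hs)
    have h2 := hYs s (Filter.Eventually.of_forall hs)
    exact congrArg₂ (· - ·) h1 h2
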